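/- Let $\pi:Y\to X$ be a smooth fibre bundle over an $n$-dimensional manifold, with bundle coordinates $(x^\mu,y^i)$, and write $\omega=dx^1\wedge\cdots\wedge dx^n$, $\omega_\lambda=\partial_\lambda\rfloor\omega$. Let $J^1Y$ be its first-order jet manifold, with coordinates $(x^\mu,y^i,y^i_\mu)$, and let $\Pi=\bigwedge^nT^*X\otimes_YV^*Y\otimes_YTX$ be the Legendre bundle, with coordinates $(x^\mu,y^i,p^\mu_i)$. Write $\partial^\lambda_i=\partial/\partial y^i_\lambda$ on $J^1Y$ and $\partial^i_\lambda=\partial/\partial p_i^\lambda$ on $\Pi$. All objects are smooth and all sections are global. Let $L=\mathcal L\,\omega:J^1Y\to\bigwedge^nT^*X$ be a first-order Lagrangian, let $\widehat L:J^1Y\to\Pi$, $p^\lambda_i\circ\widehat L=\partial^\lambda_i\mathcal L$, be its Legendre map and $N_L=\widehat L(J^1Y)$. Assume that $L$ is almost-regular: $N_L$ is a closed imbedded subbundle $i_N:N_L\to\Pi$ of $\Pi\to Y$, and $\widehat L:J^1Y\to N_L$ is a submersion with connected fibres. A Hamiltonian is a section $p=-\mathcal H$ of $T^*Y\wedge(\bigwedge^{n-1}T^*X)\to\Pi$;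 it has the Hamiltonian form $H=p^\lambda_i\,dy^i\wedge\omega_\lambda-\mathcal H\omega$ on $\Pi$ and the Hamiltonian map $\widehat H:\Pi\to J^1Y$, $y^i_\lambda\circ\widehat H=\partial^i_\lambda\mathcal H$. It is associated to $L$ if $\widehat L\circ\widehat H\circ\widehat L=\widehat L$ and, at the points of $N_L$, $p^\mu_i\partial^i_\mu\mathcal H-\mathcal H=\mathcal L(x^\mu,y^j,\partial^j_\lambda\mathcal H)$. The Cartan equations for a section $\overline s=(s^i,s^i_\lambda)$ of $J^1Y\to X$ are, along $\overline s$, $$(\partial_\mu s^j-s^j_\mu)\,\partial^\lambda_i\partial^\mu_j\mathcal L=0,\qquad \partial_i\mathcal L-\partial_\lambda\big((\partial^\lambda_i\mathcal L)\circ\overline s\big)+(\partial_\mu s^j-s^j_\mu)\,\partial_i\partial^\mu_j\mathcal L=0 .$$ For a Hamiltonian $\mathcal H$ associated to $L$, the constrained Hamilton equations for a section $r$ of $N_L\to X$ are the Euler--Lagrange equations of the constrained Lagrangian $L_N=h_0(i_N^*H)$ on $J^1N_L$, where $h_0$ replaces the differential of each fibre coordinate $q^a$ of $N_L\to X$ by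 $q^a_\lambda dx^\lambda$. Suppose that $L$ admits associated Hamiltonians, and let the constrained Hamilton equations be formed with any one of them. Then a section $\overline s$ of $J^1Y\to X$ is a solution of the Cartan equations if and only if $\widehat L\circ\overline s$ is a solution of the constrained Hamilton equations. In particular, for every solution $r$ of the constrained Hamilton equations and every Hamiltonian associated to $L$, with Hamiltonian map $\widehat H$, the section $\overline s=\widehat H\circ r$ of $J^1Y\to X$ is a solution of the Cartan equations. -/

import Mathlib

open scoped Manifold ContDiff Topology

noncomputable section

namespace CovariantField

/-- The model space `ℝⁿ`. -/
abbrev Euc (n : ℕ) : Type := EuclideanSpace ℝ (Fin n)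

/-- A chart of the smooth manifold `M`: a diffeomorphism of an open subset of `M` onto an open
subset of a normed space. -/
structure IsSmoothChart {E H F : Type*} [NormedAddCommGroup E] [NormedSpace ℝ E]
    [TopologicalSpace H] (I : ModelWithCorners ℝ E H) [NormedAddCommGroup F] [NormedSpace ℝ F]
    {M : Type*} [TopologicalSpace M] [ChartedSpace H M] (e : OpenPartialHomeomorph M F) :
    Prop where
  smooth : ContMDiffOn I 𝓘(ℝ, F) ∞ e e.source
  symm_smooth : ContMDiffOn 𝓘(ℝ, F) I ∞ e.symm e.target

section chart
variable {E H F F' : Type*} [NormedAddCommGroup E] [NormedSpace ℝ E]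
    [TopologicalSpace H] {I : ModelWithCorners ℝ E H} [NormedAddCommGroup F] [NormedSpace ℝ F]
    [NormedAddCommGroup F'] [NormedSpace ℝ F']
    {M : Type*} [TopologicalSpace M] [ChartedSpace H M] {e : OpenPartialHomeomorph M F}
    {e' : OpenPartialHomeomorph M F'}

/-- The differential of a chart, with values in the model space. -/
def chartDeriv (I : ModelWithCorners ℝ E H) (e : OpenPartialHomeomorph M F) (x : M) :
    TangentSpace I x →L[ℝ] F :=
  mfderiv I 𝓘(ℝ, F) e x

theorem IsSmoothChart.mdiff (he : IsSmoothChart I e) : e.MDifferentiable I 𝓘(ℝ, F) :=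
  ⟨he.smooth.mdifferentiableOn (by simp), he.symm_smooth.mdifferentiableOn (by simp)⟩

theorem IsSmoothChart.isInvertible (he : IsSmoothChart I e) {x : M} (hx : x ∈ e.source) :
    (chartDeriv I e x).IsInvertible :=
  ⟨he.mdiff.mfderiv hx, rfl⟩

theorem IsSmoothChart.inverse_eq (he : IsSmoothChart I e) {x : M} (hx : x ∈ e.source) :
    (chartDeriv I e x).inverse = mfderiv 𝓘(ℝ, F) I e.symm (e x) := by
  exact ContinuousLinearMap.inverse_equiv (he.mdiff.mfderiv hx)

theorem IsSmoothChart.comp_inverse (he : IsSmoothChart I e) {x : M} (hx : x ∈ e.source) :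
    (chartDeriv I e x).comp (chartDeriv I e x).inverse = ContinuousLinearMap.id ℝ F :=
  (he.isInvertible hx).self_comp_inverse

theorem IsSmoothChart.inverse_comp (he : IsSmoothChart I e) {x : M} (hx : x ∈ e.source) :
    (chartDeriv I e x).inverse.comp (chartDeriv I e x) = ContinuousLinearMap.id ℝ _ :=
  (he.isInvertible hx).inverse_comp_self

theorem IsSmoothChart.transition (he : IsSmoothChart I e) (he' : IsSmoothChart I e') {x : M}
    (hx : x ∈ e.source) (hx' : x ∈ e'.source) :
    (chartDeriv I e' x).comp (chartDeriv I e x).inverse = fderiv ℝ (e' ∘ e.symm) (e x) := by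
  rw [he.inverse_eq hx, ← mfderiv_eq_fderiv, mfderiv_comp (I' := I)]
  · rw [e.left_inv hx]; rfl
  · rw [e.left_inv hx]; exact he'.mdiff.mdifferentiableAt hx'
  · exact he.mdiff.mdifferentiableAt_symm (e.map_source hx)

theorem IsSmoothChart.contDiffOn_transition (he : IsSmoothChart I e) (he' : IsSmoothChart I e') :
    ContDiffOn ℝ ∞ (e' ∘ e.symm) (e.symm.trans e').source := by
  rw [← contMDiffOn_iff_contDiffOn]
  exact he'.smooth.comp (he.symm_smooth.mono (by simp)) (fun x hx => by simpa using hx.2)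

theorem IsSmoothChart.contDiffOn_fderiv_transition (he : IsSmoothChart I e)
    (he' : IsSmoothChart I e') :
    ContDiffOn ℝ ∞ (fderiv ℝ (e' ∘ e.symm)) (e.symm.trans e').source :=
  (he.contDiffOn_transition he').fderiv_of_isOpen (e.symm.trans e').open_source (by simp)

theorem isSmoothChart_chartAt (n : ℕ) {M : Type*} [TopologicalSpace M] [ChartedSpace (Euc n) M]
    [IsManifold (𝓡 n) ∞ M] (x : M) : IsSmoothChart (𝓡 n) (chartAt (Euc n) x) :=
  ⟨contMDiffOn_chart, contMDiffOn_chart_symm⟩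

end chart

universe u
/-- `p : P → B` is a smooth (locally trivial) fibre bundle whose typical fibre is a smooth manifold
of dimension `m`. -/
class SmoothFiberBundle {EP HP EB HB : Type*}
    [NormedAddCommGroup EP] [NormedSpace ℝ EP] [TopologicalSpace HP]
    [NormedAddCommGroup EB] [NormedSpace ℝ EB] [TopologicalSpace HB]
    (IP : ModelWithCorners ℝ EP HP) (IB : ModelWithCorners ℝ EB HB) (m : ℕ)
    {P : Type u} {B : Type*} [TopologicalSpace P] [ChartedSpace HP P]
    [TopologicalSpace B] [ChartedSpace HB B] (p : P → B) : Prop where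
  exists_trivialization : ∃ (M : Type u) (_ : TopologicalSpace M) (_ : ChartedSpace (Euc m) M)
    (_ : IsManifold (𝓡 m) ∞ M), ∀ b : B, ∃ e : Bundle.Trivialization M p, b ∈ e.baseSet ∧
      ContMDiffOn IP (IB.prod (𝓡 m)) ∞ e e.source ∧
      ContMDiffOn (IB.prod (𝓡 m)) IP ∞ e.toOpenPartialHomeomorph.symm e.target

/-- The fibre of `⋀ⁿT*X` at `x`, where `n = dim X`. -/
abbrev Density (n : ℕ) {X : Type*} [TopologicalSpace X] [ChartedSpace (Euc n) X] (x : X) : Type :=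
  TangentSpace (𝓡 n) x [⋀^Fin n]→L[ℝ] ℝ

/-- The vertical tangent space `V_yQ = ker (dπ)_y`. -/
abbrev Vert (n m : ℕ) {X : Type*} [TopologicalSpace X] [ChartedSpace (Euc n) X]
    {Q : Type*} [TopologicalSpace Q] [ChartedSpace (Euc (n + m)) Q] (π : Q → X) (y : Q) :
    Submodule ℝ (TangentSpace (𝓡 (n + m)) y) :=
  (mfderiv (𝓡 (n + m)) (𝓡 n) π y).ker

variable {n m : ℕ} {X : Type*} [TopologicalSpace X] [ChartedSpace (Euc n) X]
  {Q : Type u} [TopologicalSpace Q] [ChartedSpace (Euc (n + m)) Q]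

/-- The first order jet manifold `J¹Q` of `π : Q → X`: a jet at `y` is a linear right inverse
`T_{π y}X → T_yQ` of the differential `(dπ)_y`. -/
@[ext]
structure Jet (n m : ℕ) {X : Type*} [TopologicalSpace X] [ChartedSpace (Euc n) X]
    {Q : Type*} [TopologicalSpace Q] [ChartedSpace (Euc (n + m)) Q] (π : Q → X) where
  pt : Q
  lin : TangentSpace (𝓡 n) (π pt) →L[ℝ] TangentSpace (𝓡 (n + m)) pt
  right_inv : (mfderiv (𝓡 (n + m)) (𝓡 n) π pt).comp lin = ContinuousLinearMap.id ℝ _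

/-- The Legendre bundle `⋀ⁿT*X ⊗ V*Q ⊗ TX` over `Q`. Its fibre at `y` over `x = π y` is realized,
by the canonical isomorphism of finite-dimensional spaces, as the space of linear maps
`T*_xX ⊗ V_yQ = Hom(T_xX, V_yQ) → ⋀ⁿT*_xX`. -/
@[ext]
structure Legendre (n m : ℕ) {X : Type*} [TopologicalSpace X] [ChartedSpace (Euc n) X]
    {Q : Type*} [TopologicalSpace Q] [ChartedSpace (Euc (n + m)) Q] (π : Q → X) where
  pt : Q
  mom : (TangentSpace (𝓡 n) (π pt) →L[ℝ] Vert n m π pt) →L[ℝ] Density n (π pt)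

/-- Bundle coordinates `(x^μ, y^i)` of `π : Q → X`: a chart `tot` of `Q` and a chart `base` of `X` such
that the first component of `tot` is `base ∘ π`. -/
structure FibChart (n m : ℕ) {X : Type*} [TopologicalSpace X] [ChartedSpace (Euc n) X]
    {Q : Type*} [TopologicalSpace Q] [ChartedSpace (Euc (n + m)) Q] (π : Q → X) where
  tot : OpenPartialHomeomorph Q (Euc n × Euc m)
  base : OpenPartialHomeomorph X (Euc n)
  tot_smooth : IsSmoothChart (𝓡 (n + m)) tot
  base_smooth : IsSmoothChart (𝓡 n) base
  mapsTo : ∀ y ∈ tot.source, π y ∈ base.source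
  base_proj : ∀ y ∈ tot.source, base (π y) = (tot y).1

/-- In a smooth fibre bundle there is a fibred chart around every point. -/
theorem exists_fibChart [IsManifold (𝓡 n) ∞ X] (π : Q → X)
    [h : SmoothFiberBundle (𝓡 (n + m)) (𝓡 n) m π] (y : Q) :
    ∃ c : FibChart n m π, y ∈ c.tot.source := by
  obtain ⟨M, _, _, _, hM⟩ := h.exists_trivialization
  obtain ⟨e, hb, he, he'⟩ := hM (π y)
  have hy : y ∈ e.source := by rw [e.source_eq]; exact hb
  have h1 := isSmoothChart_chartAt n (π y)
  have h2 := isSmoothChart_chartAt m (e y).2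
  refine ⟨⟨e.toOpenPartialHomeomorph.trans
    ((chartAt (Euc n) (π y)).prod (chartAt (Euc m) (e y).2)), chartAt (Euc n) (π y),
    ⟨?_, ?_⟩, h1, ?_, ?_⟩, ?_⟩
  · have hs : ∀ z ∈ (e.toOpenPartialHomeomorph.trans
        ((chartAt (Euc n) (π y)).prod (chartAt (Euc m) (e y).2))).source,
        z ∈ e.source ∧ (e z).1 ∈ (chartAt (Euc n) (π y)).source ∧
          (e z).2 ∈ (chartAt (Euc m) (e y).2).source := fun z hz => by simpa using hz
    have he0 := he.mono (fun z hz => (hs z hz).1)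
    exact (h1.smooth.comp (contMDiff_fst.comp_contMDiffOn he0)
        (fun z hz => (hs z hz).2.1)).prodMk_space
      (h2.smooth.comp (contMDiff_snd.comp_contMDiffOn he0) (fun z hz => (hs z hz).2.2))
  · have hs : ∀ w ∈ (e.toOpenPartialHomeomorph.trans
        ((chartAt (Euc n) (π y)).prod (chartAt (Euc m) (e y).2))).target,
        (w.1 ∈ (chartAt (Euc n) (π y)).target ∧ w.2 ∈ (chartAt (Euc m) (e y).2).target) ∧
        ((chartAt (Euc n) (π y)).symm w.1, (chartAt (Euc m) (e y).2).symm w.2) ∈ e.target :=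
      fun w hw => by simpa using hw
    refine he'.comp ((h1.symm_smooth.comp contDiff_fst.contMDiff.contMDiffOn
      (fun w hw => (hs w hw).1.1)).prodMk
      (h2.symm_smooth.comp contDiff_snd.contMDiff.contMDiffOn (fun w hw => (hs w hw).1.2)))
      (fun w hw => (hs w hw).2)
  · intro z hz
    have : z ∈ e.source ∧ (e z).1 ∈ (chartAt (Euc n) (π y)).source ∧
          (e z).2 ∈ (chartAt (Euc m) (e y).2).source := by simpa using hz
    rw [← e.proj_toFun z this.1]
    exact this.2.1
  · intro z hz
    have : z ∈ e.source := hz.1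
    rw [← e.proj_toFun z this]
    simp
  · simp [hy]

namespace FibChart
variable {π : Q → X} (c : FibChart n m π)

/-- The differential of the coordinates `(x^μ, y^i)`. -/
abbrev dtot (y : Q) : TangentSpace (𝓡 (n + m)) y →L[ℝ] Euc n × Euc m :=
  chartDeriv (𝓡 (n + m)) c.tot y

/-- The differential of the coordinates `x^μ`. -/
abbrev dbase (x : X) : TangentSpace (𝓡 n) x →L[ℝ] Euc n :=
  chartDeriv (𝓡 n) c.base x

theorem mdifferentiableAt_proj {y : Q} (hy : y ∈ c.tot.source) :
    MDifferentiableAt (𝓡 (n + m)) (𝓡 n) π y := by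
  have hev : π =ᶠ[𝓝 y] fun z => c.base.symm (c.tot z).1 := by
    filter_upwards [c.tot.open_source.mem_nhds hy] with z hz
    rw [← c.base_proj z hz, c.base.left_inv (c.mapsTo z hz)]
  refine MDifferentiableAt.congr_of_eventuallyEq ?_ hev
  have h1 : MDifferentiableAt (𝓡 (n + m)) (𝓡 n) (fun z => (c.tot z).1) y :=
    (mdifferentiableAt_fst (I := 𝓡 n) (I' := 𝓡 m)).comp y (by
      have := c.tot_smooth.mdiff.mdifferentiableAt hy
      rw [modelWithCornersSelf_prod, ← chartedSpaceSelf_prod] at this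
      exact this)
  refine MDifferentiableAt.comp (I' := 𝓡 n) y ?_ h1
  rw [← c.base_proj y hy]
  exact c.base_smooth.mdiff.mdifferentiableAt_symm (c.base.map_source (c.mapsTo y hy))

theorem dbase_comp {y : Q} (hy : y ∈ c.tot.source) :
    (c.dbase (π y)).comp (mfderiv (𝓡 (n + m)) (𝓡 n) π y) =
      (ContinuousLinearMap.fst ℝ (Euc n) (Euc m)).comp (c.dtot y) := by
  have h1 : mfderiv (𝓡 (n + m)) (𝓡 n) (c.base ∘ π) y =
      (mfderiv (𝓡 n) (𝓡 n) c.base (π y)).comp (mfderiv (𝓡 (n + m)) (𝓡 n) π y) :=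
    mfderiv_comp y (c.base_smooth.mdiff.mdifferentiableAt (c.mapsTo y hy))
      (c.mdifferentiableAt_proj hy)
  have h2 : mfderiv (𝓡 (n + m)) (𝓡 n) (Prod.fst ∘ c.tot) y =
      (mfderiv 𝓘(ℝ, Euc n × Euc m) (𝓡 n) (Prod.fst) (c.tot y)).comp
        (mfderiv (𝓡 (n + m)) 𝓘(ℝ, Euc n × Euc m) c.tot y) :=
    mfderiv_comp y differentiableAt_fst.mdifferentiableAt
      (c.tot_smooth.mdiff.mdifferentiableAt hy)
  have hev : c.base ∘ π =ᶠ[𝓝 y] Prod.fst ∘ c.tot := by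
    filter_upwards [c.tot.open_source.mem_nhds hy] with z hz using c.base_proj z hz
  rw [hev.mfderiv_eq, h2, mfderiv_eq_fderiv, fderiv_fst] at h1
  exact h1.symm

/-- `dπ ∘ (dc)⁻¹ = (db)⁻¹ ∘ pr₁` -/
theorem proj_comp_inverse {y : Q} (hy : y ∈ c.tot.source) :
    (mfderiv (𝓡 (n + m)) (𝓡 n) π y).comp (c.dtot y).inverse =
      (c.dbase (π y)).inverse.comp (ContinuousLinearMap.fst ℝ (Euc n) (Euc m)) := by
  have h := c.dbase_comp hy
  have hb := c.base_smooth.inverse_comp (c.mapsTo y hy)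
  have ht := c.tot_smooth.comp_inverse hy
  calc (mfderiv (𝓡 (n + m)) (𝓡 n) π y).comp (c.dtot y).inverse
      = ((c.dbase (π y)).inverse.comp (c.dbase (π y))).comp
          ((mfderiv (𝓡 (n + m)) (𝓡 n) π y).comp (c.dtot y).inverse) := by
        rw [hb]; rfl
    _ = (c.dbase (π y)).inverse.comp (((c.dbase (π y)).comp
          (mfderiv (𝓡 (n + m)) (𝓡 n) π y)).comp (c.dtot y).inverse) := rfl
    _ = (c.dbase (π y)).inverse.comp ((ContinuousLinearMap.fst ℝ (Euc n) (Euc m)).comp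
          ((c.dtot y).comp (c.dtot y).inverse)) := by rw [h]; rfl
    _ = _ := by rw [ht]; rfl


/-- The jet over `y` with velocity `v` in the fibred chart `c`. -/
def jetAt (y : Q) (hy : y ∈ c.tot.source) (v : Euc n →L[ℝ] Euc m) : Jet n m π where
  pt := y
  lin := (c.dtot y).inverse.comp
    (((ContinuousLinearMap.id ℝ (Euc n)).prod v).comp (c.dbase (π y)))
  right_inv := by
    rw [← ContinuousLinearMap.comp_assoc, c.proj_comp_inverse hy]
    exact c.base_smooth.inverse_comp (c.mapsTo y hy)

/-- The coordinates `y^i_μ` of a jet, as the linear map `e_μ ↦ ∑ y^i_μ e_i`. -/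
def vel (z : Jet n m π) : Euc n →L[ℝ] Euc m :=
  (ContinuousLinearMap.snd ℝ (Euc n) (Euc m)).comp
    ((c.dtot z.pt).comp (z.lin.comp (c.dbase (π z.pt)).inverse))

/-- The coordinates `(x^μ, y^i, y^i_μ)` of a jet. -/
def jetCoord (z : Jet n m π) : Euc n × Euc m × (Euc n →L[ℝ] Euc m) :=
  ((c.tot z.pt).1, (c.tot z.pt).2, c.vel z)

/-- The jet with given coordinates. -/
def jetOf (w : Euc n × Euc m × (Euc n →L[ℝ] Euc m)) (hw : (w.1, w.2.1) ∈ c.tot.target) :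
    Jet n m π :=
  c.jetAt (c.tot.symm (w.1, w.2.1)) (c.tot.map_target hw) w.2.2

theorem vel_jetAt (y : Q) (hy : y ∈ c.tot.source) (v : Euc n →L[ℝ] Euc m) :
    c.vel (c.jetAt y hy v) = v := by
  have ht := c.tot_smooth.comp_inverse hy
  have hb := c.base_smooth.comp_inverse (c.mapsTo y hy)
  calc c.vel (c.jetAt y hy v) = (ContinuousLinearMap.snd ℝ (Euc n) (Euc m)).comp
        (((c.dtot y).comp (c.dtot y).inverse).comp
          (((ContinuousLinearMap.id ℝ (Euc n)).prod v).comp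
            ((c.dbase (π y)).comp (c.dbase (π y)).inverse))) := rfl
    _ = v := by rw [ht, hb]; rfl

theorem jetAt_vel (z : Jet n m π) (hz : z.pt ∈ c.tot.source) :
    c.jetAt z.pt hz (c.vel z) = z := by
  have ht := c.tot_smooth.inverse_comp hz
  have hb := c.base_smooth.inverse_comp (c.mapsTo _ hz)
  have hb' := c.base_smooth.comp_inverse (c.mapsTo _ hz)
  have key : (ContinuousLinearMap.id ℝ (Euc n)).prod (c.vel z) =
      (c.dtot z.pt).comp (z.lin.comp (c.dbase (π z.pt)).inverse) := by
    have h1 : (ContinuousLinearMap.fst ℝ (Euc n) (Euc m)).comp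
        ((c.dtot z.pt).comp (z.lin.comp (c.dbase (π z.pt)).inverse)) =
        ContinuousLinearMap.id ℝ (Euc n) := by
      rw [← ContinuousLinearMap.comp_assoc, ← c.dbase_comp hz, ContinuousLinearMap.comp_assoc,
        ← ContinuousLinearMap.comp_assoc _ z.lin, z.right_inv]
      exact hb'
    rw [← h1]
    rfl
  obtain ⟨y, A, hA⟩ := z
  have : (c.dtot y).inverse.comp
    (((ContinuousLinearMap.id ℝ (Euc n)).prod (c.vel ⟨y, A, hA⟩)).comp (c.dbase (π y))) = A := by
    rw [key]
    calc _ = ((c.dtot y).inverse.comp (c.dtot y)).comp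
          (A.comp ((c.dbase (π y)).inverse.comp (c.dbase (π y)))) := rfl
      _ = A := by rw [ht, hb]; rfl
  simp only [jetAt, this]

theorem jetOf_jetCoord (z : Jet n m π) (hz : z.pt ∈ c.tot.source)
    (hw : ((c.jetCoord z).1, (c.jetCoord z).2.1) ∈ c.tot.target) :
    c.jetOf (c.jetCoord z) hw = z := by
  have h : ∀ (y : Q) (hy : y ∈ c.tot.source), y = z.pt → c.jetAt y hy (c.vel z) = z := by
    rintro y hy rfl
    exact c.jetAt_vel z hy
  exact h _ _ (c.tot.left_inv hz)

theorem jetCoord_jetOf (w : Euc n × Euc m × (Euc n →L[ℝ] Euc m))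
    (hw : (w.1, w.2.1) ∈ c.tot.target) : c.jetCoord (c.jetOf w hw) = w := by
  have h : c.tot (c.jetOf w hw).pt = (w.1, w.2.1) := c.tot.right_inv hw
  simp only [jetCoord, h]
  rw [jetOf, c.vel_jetAt]

open Classical in
/-- The chart of the jet manifold induced by a fibred chart; `z₀` is a junk value. -/
def jetChart (z₀ : Jet n m π) :
    PartialEquiv (Jet n m π) (Euc n × Euc m × (Euc n →L[ℝ] Euc m)) where
  toFun := c.jetCoord
  invFun w := if hw : (w.1, w.2.1) ∈ c.tot.target then c.jetOf w hw else z₀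
  source := {z | z.pt ∈ c.tot.source}
  target := {w | (w.1, w.2.1) ∈ c.tot.target}
  map_source' z hz := c.tot.map_source hz
  map_target' w hw := by
    change (w.1, w.2.1) ∈ c.tot.target at hw
    simp only [hw, dite_true]
    exact c.tot.map_target hw
  left_inv' z hz := by
    have hw : ((c.jetCoord z).1, (c.jetCoord z).2.1) ∈ c.tot.target := c.tot.map_source hz
    rw [dif_pos hw]
    exact c.jetOf_jetCoord z hz hw
  right_inv' w hw := by
    change (w.1, w.2.1) ∈ c.tot.target at hw
    rw [dif_pos hw]
    exact c.jetCoord_jetOf w hw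

theorem jetChart_symm_apply (z₀ : Jet n m π) {w : Euc n × Euc m × (Euc n →L[ℝ] Euc m)}
    (hw : (w.1, w.2.1) ∈ c.tot.target) : (c.jetChart z₀).symm w = c.jetOf w hw :=
  dif_pos hw

/-- The set of coordinates `(ξ, η, ·)` over the overlap of two fibred charts. -/
def overlap (c c' : FibChart n m π) (F : Type*) : Set (Euc n × Euc m × F) :=
  {w | (w.1, w.2.1) ∈ (c.tot.symm.trans c'.tot).source}

theorem isOpen_overlap (c c' : FibChart n m π) (F : Type*) [TopologicalSpace F] :
    IsOpen (overlap c c' F) :=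
  (c.tot.symm.trans c'.tot).open_source.preimage (by fun_prop)

theorem jetChart_symm_trans_source (c c' : FibChart n m π) (z₀ z₁ : Jet n m π) :
    ((c.jetChart z₀).symm.trans (c'.jetChart z₁)).source = overlap c c' _ := by
  ext w
  constructor
  · rintro ⟨h1, h2⟩
    have h1 : (w.1, w.2.1) ∈ c.tot.target := h1
    refine ⟨h1, ?_⟩
    have h3 : ((c.jetChart z₀).symm w).pt ∈ c'.tot.source := h2
    rwa [c.jetChart_symm_apply z₀ h1] at h3
  · rintro ⟨h1, h2⟩
    have h1 : (w.1, w.2.1) ∈ c.tot.target := h1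
    refine ⟨h1, ?_⟩
    change ((c.jetChart z₀).symm w).pt ∈ c'.tot.source
    rw [c.jetChart_symm_apply z₀ h1]
    exact h2

/-- On an overlap of fibred charts `ξ' = b'∘b⁻¹ ξ` lies in the overlap of base charts. -/
theorem base_mem_overlap {c c' : FibChart n m π} {y : Q} (hy : y ∈ c.tot.source)
    (hy' : y ∈ c'.tot.source) : c'.base (π y) ∈ (c'.base.symm.trans c.base).source := by
  refine ⟨c'.base.map_source (c'.mapsTo y hy'), ?_⟩
  change c'.base.symm (c'.base (π y)) ∈ c.base.source
  rw [c'.base.left_inv (c'.mapsTo y hy')]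
  exact c.mapsTo y hy

theorem contDiffOn_baseDeriv (c c' : FibChart n m π) (F : Type*) [NormedAddCommGroup F]
    [NormedSpace ℝ F] :
    ContDiffOn ℝ ∞ (fun w : Euc n × Euc m × F =>
      fderiv ℝ (c.base ∘ c'.base.symm) ((c'.tot ∘ c.tot.symm) (w.1, w.2.1)).1)
      (overlap c c' F) := by
  have h1 : ContDiffOn ℝ ∞ (fun w : Euc n × Euc m × F =>
      ((c'.tot ∘ c.tot.symm) (w.1, w.2.1)).1) (overlap c c' F) :=
    contDiff_fst.comp_contDiffOn ((c.tot_smooth.contDiffOn_transition c'.tot_smooth).comp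
      (f := fun w : Euc n × Euc m × F => (w.1, w.2.1)) (by fun_prop) (fun w hw => hw))
  refine (c'.base_smooth.contDiffOn_fderiv_transition c.base_smooth).comp h1 ?_
  rintro w ⟨hw1, hw2⟩
  have hw2 : c.tot.symm (w.1, w.2.1) ∈ c'.tot.source := hw2
  have hw1 := c.tot.map_target hw1
  have := base_mem_overlap hw1 hw2
  rwa [c'.base_proj _ hw2] at this

theorem contDiffOn_totDeriv (c c' : FibChart n m π) (F : Type*) [NormedAddCommGroup F]
    [NormedSpace ℝ F] :
    ContDiffOn ℝ ∞ (fun w : Euc n × Euc m × F =>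
      fderiv ℝ (c'.tot ∘ c.tot.symm) (w.1, w.2.1)) (overlap c c' F) :=
  (c.tot_smooth.contDiffOn_fderiv_transition c'.tot_smooth).comp
      (f := fun w : Euc n × Euc m × F => (w.1, w.2.1)) (by fun_prop) (fun w hw => hw)

theorem contDiffOn_jetTransition (c c' : FibChart n m π) (z₀ z₁ : Jet n m π) :
    ContDiffOn ℝ ∞ ((c.jetChart z₀).symm.trans (c'.jetChart z₁))
      ((c.jetChart z₀).symm.trans (c'.jetChart z₁)).source := by
  rw [jetChart_symm_trans_source]
  have h0 : ContDiffOn ℝ ∞ (fun w : Euc n × Euc m × (Euc n →L[ℝ] Euc m) =>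
      (c'.tot ∘ c.tot.symm) (w.1, w.2.1)) (overlap c c' _) :=
    (c.tot_smooth.contDiffOn_transition c'.tot_smooth).comp
      (f := fun w : Euc n × Euc m × _ => (w.1, w.2.1)) (by fun_prop) (fun w hw => hw)
  have h1 := contDiffOn_totDeriv c c' (Euc n →L[ℝ] Euc m)
  have h2 := contDiffOn_baseDeriv c c' (Euc n →L[ℝ] Euc m)
  have h4 : ContDiffOn ℝ ∞ (fun w : Euc n × Euc m × (Euc n →L[ℝ] Euc m) =>
      (ContinuousLinearMap.id ℝ (Euc n)).prod w.2.2) (overlap c c' _) := by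
    have : (fun w : Euc n × Euc m × (Euc n →L[ℝ] Euc m) =>
      (ContinuousLinearMap.id ℝ (Euc n)).prod w.2.2) = fun w =>
      ((ContinuousLinearMap.inl ℝ (Euc n) (Euc m)) +
        (ContinuousLinearMap.inr ℝ (Euc n) (Euc m)).comp w.2.2) := by
      ext w v i <;> simp
    rw [this]
    exact (contDiff_const.add (contDiff_const.clm_comp (by fun_prop))).contDiffOn
  have h3 : ContDiffOn ℝ ∞ (fun w : Euc n × Euc m × (Euc n →L[ℝ] Euc m) =>
      (ContinuousLinearMap.snd ℝ (Euc n) (Euc m)).comp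
        ((fderiv ℝ (c'.tot ∘ c.tot.symm) (w.1, w.2.1)).comp
        (((ContinuousLinearMap.id ℝ (Euc n)).prod w.2.2).comp
          (fderiv ℝ (c.base ∘ c'.base.symm) ((c'.tot ∘ c.tot.symm) (w.1, w.2.1)).1))))
      (overlap c c' _) :=
    contDiffOn_const.clm_comp (h1.clm_comp (h4.clm_comp h2))
  refine ((contDiff_fst.comp_contDiffOn h0).prodMk
    ((contDiff_snd.comp_contDiffOn h0).prodMk h3)).congr ?_
  rintro w ⟨hw1, hw2⟩
  have hw1 : (w.1, w.2.1) ∈ c.tot.target := hw1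
  have hw2 : c.tot.symm (w.1, w.2.1) ∈ c'.tot.source := hw2
  have hs := c.tot.map_target hw1
  have e1 := c.tot_smooth.transition c'.tot_smooth hs hw2
  have e2 := c'.base_smooth.transition c.base_smooth (c'.mapsTo _ hw2) (c.mapsTo _ hs)
  rw [c.tot.right_inv hw1] at e1
  rw [c'.base_proj _ hw2] at e2
  have : ((c.jetChart z₀).symm.trans (c'.jetChart z₁)) w = c'.jetCoord (c.jetOf w hw1) := by
    change c'.jetCoord ((c.jetChart z₀).symm w) = _
    rw [c.jetChart_symm_apply z₀ hw1]
  rw [this]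
  refine Prod.ext rfl (Prod.ext rfl ?_)
  simp only [Function.comp_apply] at e2 ⊢
  rw [← e1, ← e2]
  rfl


/-- The coordinate frame `∂₁, …, ∂ₙ` of `T_xX`. -/
def frame (x : X) (l : Fin n) : TangentSpace (𝓡 n) x :=
  (c.dbase x).inverse (EuclideanSpace.single l 1)

end FibChart

/-- The form `dx¹ ∧ ⋯ ∧ dxⁿ` on `ℝⁿ`. -/
def stdVol (n : ℕ) : Euc n [⋀^Fin n]→L[ℝ] ℝ :=
  { (EuclideanSpace.basisFun (Fin n) ℝ).toBasis.det with
    cont := by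
      change Continuous fun v : Fin n → Euc n => (EuclideanSpace.basisFun (Fin n) ℝ).toBasis.det v
      simp only [Module.Basis.det_apply]
      refine Continuous.matrix_det (continuous_matrix fun i j => ?_)
      simp only [Module.Basis.toMatrix_apply, OrthonormalBasis.coe_toBasis_repr_apply,
        EuclideanSpace.basisFun_repr]
      fun_prop }

theorem stdVol_single (n : ℕ) : stdVol n (fun l => EuclideanSpace.single l 1) = 1 := by
  change (EuclideanSpace.basisFun (Fin n) ℝ).toBasis.det _ = 1
  have : (fun l => EuclideanSpace.single l (1 : ℝ)) =
      (EuclideanSpace.basisFun (Fin n) ℝ).toBasis := by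
    ext l; simp
  rw [this]
  exact Module.Basis.det_self _

/-- An `n`-form is its value at a frame times the corresponding volume form. -/
theorem eq_smul_stdVol {n : ℕ} (a : Euc n [⋀^Fin n]→L[ℝ] ℝ) :
    a = a (fun l => EuclideanSpace.single l 1) • stdVol n := by
  have h := AlternatingMap.eq_smul_basis_det (EuclideanSpace.basisFun (Fin n) ℝ).toBasis
    a.toAlternatingMap
  ext v
  have h2 := congrArg (fun f => f v) h
  have h3 : (fun l => EuclideanSpace.single l (1 : ℝ)) =
      (EuclideanSpace.basisFun (Fin n) ℝ).toBasis := by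
    ext l; simp
  rw [h3]
  exact h2

namespace FibChart
variable {π : Q → X} (c : FibChart n m π)

/-- The form `ω = dx¹ ∧ ⋯ ∧ dxⁿ` at `x`. -/
def vol (x : X) : Density n x :=
  (stdVol n).compContinuousLinearMap (c.dbase x)

theorem vol_frame {x : X} (hx : x ∈ c.base.source) : c.vol x (c.frame x) = 1 := by
  rw [← stdVol_single n]
  change stdVol n (fun l => c.dbase x (c.frame x l)) = _
  congr 1
  ext1 l
  exact congrArg (fun f : Euc n →L[ℝ] Euc n => f (EuclideanSpace.single l 1))
    (c.base_smooth.comp_inverse hx)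

theorem eq_smul_vol {x : X} (hx : x ∈ c.base.source) (a : Density n x) :
    a = a (c.frame x) • c.vol x := by
  have h := eq_smul_stdVol (a.compContinuousLinearMap (c.dbase x).inverse)
  have h1 : (a.compContinuousLinearMap (c.dbase x).inverse).compContinuousLinearMap (c.dbase x)
      = a := by
    ext v
    change a (fun l => ((c.dbase x).inverse.comp (c.dbase x)) (v l)) = _
    rw [c.base_smooth.inverse_comp hx]
    rfl
  conv_lhs => rw [← h1, h]
  rfl

/-- The velocity coordinates of `B ∈ T*_xX ⊗ V_yY`. -/
def vertVel (y : Q) :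
    (TangentSpace (𝓡 n) (π y) →L[ℝ] Vert n m π y) →L[ℝ] (Euc n →L[ℝ] Euc m) :=
  (ContinuousLinearMap.precomp (Euc m) (c.dbase (π y)).inverse).comp
    (ContinuousLinearMap.postcomp (TangentSpace (𝓡 n) (π y))
      ((ContinuousLinearMap.snd ℝ (Euc n) (Euc m)).comp
        ((c.dtot y).comp (Vert n m π y).subtypeL)))

open Classical in
/-- The isomorphism `ℝᵐ → V_yY` given by the frame `∂_i`. -/
def vertIncl (y : Q) : Euc m →L[ℝ] Vert n m π y :=
  if hy : y ∈ c.tot.source then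
    ((c.dtot y).inverse.comp (ContinuousLinearMap.inr ℝ (Euc n) (Euc m))).codRestrict
      (Vert n m π y) (fun u => by
        have h := congrArg (fun f : Euc n × Euc m →L[ℝ] TangentSpace (𝓡 n) (π y) => f (0, u))
          (c.proj_comp_inverse hy)
        refine LinearMap.mem_ker.2 (h.trans ?_)
        exact map_zero (c.dbase (π y)).inverse)
  else 0

/-- The element of `T*_xX ⊗ V_yY` with given velocity coordinates. -/
def vertOf (y : Q) :
    (Euc n →L[ℝ] Euc m) →L[ℝ] (TangentSpace (𝓡 n) (π y) →L[ℝ] Vert n m π y) :=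
  (ContinuousLinearMap.precomp (Vert n m π y) (c.dbase (π y))).comp
    (ContinuousLinearMap.postcomp (Euc n) (c.vertIncl y))

/-- The coordinates `p^μ_i` of an element `q` of the Legendre bundle, as the linear form
`v ↦ ∑ p^μ_i v^i_μ`. -/
def momCoord (q : Legendre n m π) : (Euc n →L[ℝ] Euc m) →L[ℝ] ℝ :=
  (ContinuousAlternatingMap.apply ℝ (TangentSpace (𝓡 n) (π q.pt)) ℝ (c.frame (π q.pt))).comp
    (q.mom.comp (c.vertOf q.pt))

/-- The element of the Legendre bundle over `y` with momenta `p`. -/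
def legendreAt (y : Q) (p : (Euc n →L[ℝ] Euc m) →L[ℝ] ℝ) : Legendre n m π where
  pt := y
  mom := (p.comp (c.vertVel y)).smulRight (c.vol (π y))

/-- The coordinates `(x^μ, y^i, p^μ_i)` of an element of the Legendre bundle. -/
def legendreCoord (q : Legendre n m π) :
    Euc n × Euc m × ((Euc n →L[ℝ] Euc m) →L[ℝ] ℝ) :=
  ((c.tot q.pt).1, (c.tot q.pt).2, c.momCoord q)

/-- The element of the Legendre bundle with given coordinates. -/
def legendreOf (w : Euc n × Euc m × ((Euc n →L[ℝ] Euc m) →L[ℝ] ℝ)) : Legendre n m π :=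
  c.legendreAt (c.tot.symm (w.1, w.2.1)) w.2.2

theorem coe_vertIncl {y : Q} (hy : y ∈ c.tot.source) (u : Euc m) :
    (c.vertIncl y u : TangentSpace (𝓡 (n + m)) y) = (c.dtot y).inverse (0, u) := by
  rw [vertIncl, dif_pos hy]
  rfl

theorem vertVel_apply (y : Q) (B : TangentSpace (𝓡 n) (π y) →L[ℝ] Vert n m π y) (v : Euc n) :
    c.vertVel y B v = (c.dtot y (B ((c.dbase (π y)).inverse v))).2 := rfl

theorem vertOf_apply (y : Q) (v : Euc n →L[ℝ] Euc m) (u : TangentSpace (𝓡 n) (π y)) :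
    c.vertOf y v u = c.vertIncl y (v (c.dbase (π y) u)) := rfl

theorem vertVel_vertOf {y : Q} (hy : y ∈ c.tot.source) (v : Euc n →L[ℝ] Euc m) :
    c.vertVel y (c.vertOf y v) = v := by
  refine ContinuousLinearMap.ext fun u => ?_
  rw [vertVel_apply, vertOf_apply, c.coe_vertIncl hy]
  have h1 : c.dtot y ((c.dtot y).inverse (0, v (c.dbase (π y) ((c.dbase (π y)).inverse u)))) = _ :=
    congrArg (fun f : Euc n × Euc m →L[ℝ] Euc n × Euc m => f _) (c.tot_smooth.comp_inverse hy)
  have h2 : c.dbase (π y) ((c.dbase (π y)).inverse u) = u :=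
    congrArg (fun f : Euc n →L[ℝ] Euc n => f u) (c.base_smooth.comp_inverse (c.mapsTo y hy))
  rw [h1, h2]
  rfl

theorem vertOf_vertVel {y : Q} (hy : y ∈ c.tot.source)
    (B : TangentSpace (𝓡 n) (π y) →L[ℝ] Vert n m π y) : c.vertOf y (c.vertVel y B) = B := by
  refine ContinuousLinearMap.ext fun u => Subtype.ext ?_
  rw [vertOf_apply, c.coe_vertIncl hy, vertVel_apply]
  have h2 : (c.dbase (π y)).inverse (c.dbase (π y) u) = u :=
    congrArg (fun f : TangentSpace (𝓡 n) (π y) →L[ℝ] TangentSpace (𝓡 n) (π y) => f u)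
      (c.base_smooth.inverse_comp (c.mapsTo y hy))
  rw [h2]
  have h3 : (c.dtot y (B u)).1 = 0 := by
    have h := congrArg (fun f : TangentSpace (𝓡 (n + m)) y →L[ℝ] Euc n => f (B u))
      (c.dbase_comp hy)
    refine h.symm.trans ?_
    have hB : mfderiv (𝓡 (n + m)) (𝓡 n) π y (B u) = 0 := LinearMap.mem_ker.1 (B u).2
    change c.dbase (π y) (mfderiv (𝓡 (n + m)) (𝓡 n) π y (B u)) = 0
    rw [hB, map_zero]
  rw [show ((0 : Euc n), (c.dtot y (B u)).2) = c.dtot y (B u) from Prod.ext h3.symm rfl]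
  exact congrArg (fun f : TangentSpace (𝓡 (n + m)) y →L[ℝ] TangentSpace (𝓡 (n + m)) y => f (B u))
    (c.tot_smooth.inverse_comp hy)

theorem momCoord_legendreAt {y : Q} (hy : y ∈ c.tot.source)
    (p : (Euc n →L[ℝ] Euc m) →L[ℝ] ℝ) : c.momCoord (c.legendreAt y p) = p := by
  refine ContinuousLinearMap.ext fun v => ?_
  change p (c.vertVel y (c.vertOf y v)) * c.vol (π y) (c.frame (π y)) = p v
  rw [c.vertVel_vertOf hy, c.vol_frame (c.mapsTo y hy), mul_one]

theorem legendreAt_momCoord (q : Legendre n m π) (hq : q.pt ∈ c.tot.source) :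
    c.legendreAt q.pt (c.momCoord q) = q := by
  obtain ⟨y, p⟩ := q
  have hq : y ∈ c.tot.source := hq
  have : ((c.momCoord ⟨y, p⟩).comp (c.vertVel y)).smulRight (c.vol (π y)) = p := by
    refine ContinuousLinearMap.ext fun B => ?_
    change (p (c.vertOf y (c.vertVel y B))) (c.frame (π y)) • c.vol (π y) = p B
    rw [c.vertOf_vertVel hq]
    exact (c.eq_smul_vol (c.mapsTo y hq) (p B)).symm
  simp only [legendreAt, this]

/-- The chart of the Legendre bundle induced by a fibred chart. -/
def legendreChart :
    PartialEquiv (Legendre n m π) (Euc n × Euc m × ((Euc n →L[ℝ] Euc m) →L[ℝ] ℝ)) where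
  toFun := c.legendreCoord
  invFun := c.legendreOf
  source := {q | q.pt ∈ c.tot.source}
  target := {w | (w.1, w.2.1) ∈ c.tot.target}
  map_source' q hq := c.tot.map_source hq
  map_target' w hw := c.tot.map_target hw
  left_inv' q hq := by
    have h : ∀ y : Q, y = q.pt → c.legendreAt y (c.momCoord q) = q := by
      rintro y rfl
      exact c.legendreAt_momCoord q hq
    exact h _ (c.tot.left_inv hq)
  right_inv' w hw := by
    have h : c.tot (c.legendreOf w).pt = (w.1, w.2.1) := c.tot.right_inv hw
    simp only [legendreCoord, h]
    rw [legendreOf, c.momCoord_legendreAt (c.tot.map_target hw)]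

theorem legendreChart_symm_trans_source (c c' : FibChart n m π) :
    (c.legendreChart.symm.trans c'.legendreChart).source = overlap c c' _ := rfl

theorem contDiffOn_legendreTransition (c c' : FibChart n m π) :
    ContDiffOn ℝ ∞ (c.legendreChart.symm.trans c'.legendreChart)
      (c.legendreChart.symm.trans c'.legendreChart).source := by
  rw [legendreChart_symm_trans_source]
  have h0 : ContDiffOn ℝ ∞ (fun w : Euc n × Euc m × ((Euc n →L[ℝ] Euc m) →L[ℝ] ℝ) =>
      (c'.tot ∘ c.tot.symm) (w.1, w.2.1)) (overlap c c' _) :=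
    (c.tot_smooth.contDiffOn_transition c'.tot_smooth).comp
      (f := fun w : Euc n × Euc m × _ => (w.1, w.2.1)) (by fun_prop) (fun w hw => hw)
  have hA : ContDiffOn ℝ ∞ (fun w : Euc n × Euc m × ((Euc n →L[ℝ] Euc m) →L[ℝ] ℝ) =>
      fderiv ℝ (c.tot ∘ c'.tot.symm) ((c'.tot ∘ c.tot.symm) (w.1, w.2.1))) (overlap c c' _) := by
    refine (c'.tot_smooth.contDiffOn_fderiv_transition c.tot_smooth).comp h0 ?_
    rintro w ⟨hw1, hw2⟩
    have hw2 : c.tot.symm (w.1, w.2.1) ∈ c'.tot.source := hw2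
    refine ⟨c'.tot.map_source hw2, ?_⟩
    change c'.tot.symm (c'.tot (c.tot.symm (w.1, w.2.1))) ∈ c.tot.source
    rw [c'.tot.left_inv hw2]
    exact c.tot.map_target hw1
  have hG : ContDiffOn ℝ ∞ (fun w : Euc n × Euc m × ((Euc n →L[ℝ] Euc m) →L[ℝ] ℝ) =>
      fderiv ℝ (c'.base ∘ c.base.symm) w.1) (overlap c c' _) := by
    refine (c.base_smooth.contDiffOn_fderiv_transition c'.base_smooth).comp
      contDiff_fst.contDiffOn ?_
    rintro w ⟨hw1, hw2⟩
    have hw1 : (w.1, w.2.1) ∈ c.tot.target := hw1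
    have hw2 : c.tot.symm (w.1, w.2.1) ∈ c'.tot.source := hw2
    have := base_mem_overlap hw2 (c.tot.map_target hw1)
    rwa [c.base_proj _ (c.tot.map_target hw1), c.tot.right_inv hw1] at this
  have hD := contDiffOn_baseDeriv c c' ((Euc n →L[ℝ] Euc m) →L[ℝ] ℝ)
  have hV : ContDiffOn ℝ ∞ (fun w : Euc n × Euc m × ((Euc n →L[ℝ] Euc m) →L[ℝ] ℝ) =>
      stdVol n fun l => fderiv ℝ (c.base ∘ c'.base.symm) ((c'.tot ∘ c.tot.symm) (w.1, w.2.1)).1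
        (EuclideanSpace.single l 1)) (overlap c c' _) :=
    (stdVol n).toContinuousMultilinearMap.contDiff.comp_contDiffOn
      (contDiffOn_pi.2 fun l => hD.clm_apply contDiffOn_const)
  have hP : ContDiffOn ℝ ∞ (fun w : Euc n × Euc m × ((Euc n →L[ℝ] Euc m) →L[ℝ] ℝ) =>
      (ContinuousLinearMap.mul ℝ ℝ (stdVol n fun l =>
        fderiv ℝ (c.base ∘ c'.base.symm) ((c'.tot ∘ c.tot.symm) (w.1, w.2.1)).1
        (EuclideanSpace.single l 1))).comp (w.2.2.comp
        (((ContinuousLinearMap.compL ℝ (Euc n) (Euc n) (Euc m)).flip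
          (fderiv ℝ (c'.base ∘ c.base.symm) w.1)).comp
        (ContinuousLinearMap.compL ℝ (Euc n) (Euc m) (Euc m)
          ((ContinuousLinearMap.snd ℝ (Euc n) (Euc m)).comp
            ((fderiv ℝ (c.tot ∘ c'.tot.symm) ((c'.tot ∘ c.tot.symm) (w.1, w.2.1))).comp
              (ContinuousLinearMap.inr ℝ (Euc n) (Euc m)))))))) (overlap c c' _) := by
    refine ContDiffOn.clm_comp ((ContinuousLinearMap.contDiff _).comp_contDiffOn hV)
      (ContDiffOn.clm_comp (contDiff_snd.comp contDiff_snd).contDiffOn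
      (ContDiffOn.clm_comp ?_ ?_))
    · exact (ContinuousLinearMap.contDiff _).comp_contDiffOn hG
    · exact (ContinuousLinearMap.contDiff _).comp_contDiffOn
        (contDiffOn_const.clm_comp (hA.clm_comp contDiffOn_const))
  refine ((contDiff_fst.comp_contDiffOn h0).prodMk
    ((contDiff_snd.comp_contDiffOn h0).prodMk hP)).congr ?_
  rintro w ⟨hw1, hw2⟩
  have hw1 : (w.1, w.2.1) ∈ c.tot.target := hw1
  have hw2 : c.tot.symm (w.1, w.2.1) ∈ c'.tot.source := hw2
  have hs := c.tot.map_target hw1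
  have e1 := c'.tot_smooth.transition c.tot_smooth hw2 hs
  have e2 := c'.base_smooth.transition c.base_smooth (c'.mapsTo _ hw2) (c.mapsTo _ hs)
  have e3 := c.base_smooth.transition c'.base_smooth (c.mapsTo _ hs) (c'.mapsTo _ hw2)
  rw [c'.base_proj _ hw2] at e2
  rw [c.base_proj _ hs, c.tot.right_inv hw1] at e3
  refine Prod.ext rfl (Prod.ext rfl ?_)
  simp only [Function.comp_apply] at e1 e2 e3 ⊢
  rw [← e1, ← e2, ← e3]
  refine ContinuousLinearMap.ext fun v => ?_
  set y := c.tot.symm (w.1, w.2.1) with hy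
  have k1 : c.vertVel y (c'.vertOf y v) = ((ContinuousLinearMap.snd ℝ (Euc n) (Euc m)).comp
      (((c.dtot y).comp (c'.dtot y).inverse).comp
        (ContinuousLinearMap.inr ℝ (Euc n) (Euc m)))).comp
      (v.comp ((c'.dbase (π y)).comp (c.dbase (π y)).inverse)) := by
    refine ContinuousLinearMap.ext fun u => ?_
    rw [vertVel_apply, vertOf_apply, c'.coe_vertIncl hw2]
    rfl
  change w.2.2 (c.vertVel y (c'.vertOf y v)) * c.vol (π y) (c'.frame (π y)) = _
  rw [k1, mul_comm]
  rfl

/-- A chosen fibred chart around a point of a smooth fibre bundle. -/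
def chosen (n m : ℕ) {X : Type*} [TopologicalSpace X]
    [ChartedSpace (Euc n) X] [IsManifold (𝓡 n) ∞ X] {Q : Type u} [TopologicalSpace Q]
    [ChartedSpace (Euc (n + m)) Q] (π : Q → X)
    [SmoothFiberBundle (𝓡 (n + m)) (𝓡 n) m π] (y : Q) : FibChart n m π :=
  (exists_fibChart π y).choose

theorem mem_chosen [IsManifold (𝓡 n) ∞ X] (π : Q → X)
    [SmoothFiberBundle (𝓡 (n + m)) (𝓡 n) m π] (y : Q) :
    y ∈ (FibChart.chosen n m π y).tot.source :=
  (exists_fibChart π y).choose_spec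

end FibChart

section manifolds
variable [IsManifold (𝓡 n) ∞ X] (π : Q → X) [SmoothFiberBundle (𝓡 (n + m)) (𝓡 n) m π]

/-- The atlas of the jet manifold, with the coordinates `(x^μ, y^i, y^i_μ)`. -/
def jetCore : ChartedSpaceCore (Euc n × Euc m × (Euc n →L[ℝ] Euc m)) (Jet n m π) where
  atlas := {e | ∃ (c : FibChart n m π) (z₀ : Jet n m π), e = c.jetChart z₀}
  chartAt z := (FibChart.chosen n m π z.pt).jetChart z
  mem_chart_source z := FibChart.mem_chosen π z.pt
  chart_mem_atlas z := ⟨_, _, rfl⟩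
  open_source := by
    rintro _ _ ⟨c, z₀, rfl⟩ ⟨c', z₁, rfl⟩
    rw [FibChart.jetChart_symm_trans_source]
    exact FibChart.isOpen_overlap c c' _
  continuousOn_toFun := by
    rintro _ _ ⟨c, z₀, rfl⟩ ⟨c', z₁, rfl⟩
    exact (FibChart.contDiffOn_jetTransition c c' z₀ z₁).continuousOn

instance jetTopology : TopologicalSpace (Jet n m π) := (jetCore π).toTopologicalSpace

instance jetCharted : ChartedSpace (Euc n × Euc m × (Euc n →L[ℝ] Euc m)) (Jet n m π) :=
  (jetCore π).toChartedSpace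

instance jetManifold : IsManifold 𝓘(ℝ, Euc n × Euc m × (Euc n →L[ℝ] Euc m)) ∞ (Jet n m π) := by
  refine isManifold_of_contDiffOn _ _ _ ?_
  intro e e' he he'
  obtain ⟨_, ⟨a, rfl⟩, _, ⟨ha, rfl⟩, he⟩ := he
  obtain ⟨_, ⟨a', rfl⟩, _, ⟨ha', rfl⟩, he'⟩ := he'
  obtain ⟨c, z₀, rfl⟩ := ha
  obtain ⟨c', z₁, rfl⟩ := ha'
  subst he he'
  have := FibChart.contDiffOn_jetTransition c c' z₀ z₁
  simp only [modelWithCornersSelf_coe, modelWithCornersSelf_coe_symm, Set.range_id,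
    Set.preimage_id, Set.inter_univ, Function.id_comp, Function.comp_id]
  exact this

/-- The atlas of the Legendre bundle, with the coordinates `(x^μ, y^i, p^μ_i)`. -/
def legendreCore : ChartedSpaceCore (Euc n × Euc m × ((Euc n →L[ℝ] Euc m) →L[ℝ] ℝ))
    (Legendre n m π) where
  atlas := {e | ∃ c : FibChart n m π, e = c.legendreChart}
  chartAt z := (FibChart.chosen n m π z.pt).legendreChart
  mem_chart_source z := FibChart.mem_chosen π z.pt
  chart_mem_atlas z := ⟨_, rfl⟩
  open_source := by
    rintro _ _ ⟨c, rfl⟩ ⟨c', rfl⟩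
    exact FibChart.isOpen_overlap c c' _
  continuousOn_toFun := by
    rintro _ _ ⟨c, rfl⟩ ⟨c', rfl⟩
    exact (FibChart.contDiffOn_legendreTransition c c').continuousOn

instance legendreTopology : TopologicalSpace (Legendre n m π) := (legendreCore π).toTopologicalSpace

instance legendreCharted : ChartedSpace (Euc n × Euc m × ((Euc n →L[ℝ] Euc m) →L[ℝ] ℝ)) (Legendre n m π) :=
  (legendreCore π).toChartedSpace

instance legendreManifold : IsManifold 𝓘(ℝ, Euc n × Euc m × ((Euc n →L[ℝ] Euc m) →L[ℝ] ℝ)) ∞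
    (Legendre n m π) := by
  refine isManifold_of_contDiffOn _ _ _ ?_
  intro e e' he he'
  obtain ⟨_, ⟨a, rfl⟩, _, ⟨ha, rfl⟩, he⟩ := he
  obtain ⟨_, ⟨a', rfl⟩, _, ⟨ha', rfl⟩, he'⟩ := he'
  obtain ⟨c, rfl⟩ := ha
  obtain ⟨c', rfl⟩ := ha'
  subst he he'
  have := FibChart.contDiffOn_legendreTransition c c'
  simp only [modelWithCornersSelf_coe, modelWithCornersSelf_coe_symm, Set.range_id,
    Set.preimage_id, Set.inter_univ, Function.id_comp, Function.comp_id]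
  exact this

end manifolds

/-! ### Lagrangians -/

/-- The model space of `J¹Q`. -/
abbrev JetModel (n m : ℕ) : Type := Euc n × Euc m × (Euc n →L[ℝ] Euc m)

/-- The model space of the Legendre bundle. -/
abbrev LegendreModel (n m : ℕ) : Type := Euc n × Euc m × ((Euc n →L[ℝ] Euc m) →L[ℝ] ℝ)

/-- Horizontal densities `J¹Q → ⋀ⁿT*X` over `X`, without any regularity. -/
abbrev JetDensity (n m : ℕ) {X : Type*} [TopologicalSpace X] [ChartedSpace (Euc n) X]
    {Q : Type*} [TopologicalSpace Q] [ChartedSpace (Euc (n + m)) Q] (π : Q → X) : Type _ :=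
  (z : Jet n m π) → Density n (π z.pt)

open Classical in
/-- The coordinate expression `𝓛(x^μ, y^i, y^i_μ)` of `L = 𝓛 dx¹ ∧ ⋯ ∧ dxⁿ`, that is, the value of
`L` at the frame `∂₁, …, ∂ₙ`; zero outside the range of the coordinates. -/
def FibChart.localLagrangian {π : Q → X} (c : FibChart n m π) (L : JetDensity n m π)
    (w : JetModel n m) : ℝ :=
  if hw : (w.1, w.2.1) ∈ c.tot.target then
    L (c.jetOf w hw) (c.frame (π (c.jetOf w hw).pt))
  else 0

/-- `L` is a (smooth, first order) Lagrangian. -/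
def IsLagrangian {π : Q → X} (L : JetDensity n m π) : Prop :=
  ∀ c : FibChart n m π,
    ContDiffOn ℝ ∞ (c.localLagrangian L) {w | (w.1, w.2.1) ∈ c.tot.target}

/-- The coordinate velocity `dx^l ⊗ ∂_i`. -/
def velUnit {n m : ℕ} (l : Fin n) (i : Fin m) : Euc n →L[ℝ] Euc m :=
  (EuclideanSpace.proj l : Euc n →L[ℝ] ℝ).smulRight (EuclideanSpace.single i 1)

/-- The coordinate momentum dual to `velUnit l i`, that is, the linear form `v ↦ v^i_l`. -/
def momUnit {n m : ℕ} (l : Fin n) (i : Fin m) : (Euc n →L[ℝ] Euc m) →L[ℝ] ℝ :=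
  (EuclideanSpace.proj i : Euc m →L[ℝ] ℝ).comp
    (ContinuousLinearMap.apply ℝ (Euc m) (EuclideanSpace.single l (1 : ℝ)))

/-- The partial derivative `∂_i = ∂/∂y^i`. -/
def dY {n m : ℕ} (f : JetModel n m → ℝ) (i : Fin m) (w : JetModel n m) : ℝ :=
  fderiv ℝ f w (0, EuclideanSpace.single i 1, 0)

/-- The partial derivative `∂^l_i = ∂/∂y^i_l`. -/
def dV {n m : ℕ} (f : JetModel n m → ℝ) (l : Fin n) (i : Fin m) (w : JetModel n m) : ℝ :=
  fderiv ℝ f w (0, 0, velUnit l i)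

/-- The partial derivative `∂_l = ∂/∂x^l` of a function on `ℝⁿ`. -/
def dX {n : ℕ} (f : Euc n → ℝ) (l : Fin n) (ξ : Euc n) : ℝ :=
  fderiv ℝ f ξ (EuclideanSpace.single l 1)

/-- The coordinate expression `s^i(x)` of a section `s`. -/
def FibChart.localSection {π : Q → X} (c : FibChart n m π) (s : X → Q) (ξ : Euc n) : Euc m :=
  (c.tot (s (c.base.symm ξ))).2

/-- The coordinate expression `(x^μ, s^i, ∂_μ s^i)` of the jet prolongation of a section. -/
def FibChart.localProlongation {π : Q → X} (c : FibChart n m π) (s : X → Q) (ξ : Euc n) :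
    JetModel n m :=
  (ξ, c.localSection s ξ, fderiv ℝ (c.localSection s) ξ)

/-- `s` is a (smooth, global) section of `π` that solves the Euler–Lagrange equations
`∂_i 𝓛 - d_l ∂^l_i 𝓛 = 0`. The total derivative `d_l` of a function on `J¹Q`, evaluated on the second
jet prolongation of `s`, is the derivative `∂/∂x^l` of the function composed with the first jet
prolongation of `s`. -/
structure IsEulerLagrangeSolution {π : Q → X} (L : JetDensity n m π) (s : X → Q) : Prop where
  smooth : ContMDiff (𝓡 n) (𝓡 (n + m)) ∞ s
  isSection : ∀ x, π (s x) = x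
  equation : ∀ (c : FibChart n m π) (x : X), s x ∈ c.tot.source → ∀ i : Fin m,
    dY (c.localLagrangian L) i (c.localProlongation s (c.base x)) -
      ∑ l, dX (fun ξ => dV (c.localLagrangian L) l i (c.localProlongation s ξ)) l (c.base x) = 0

/-- The sum of a jet `z` and an element of `T*X ⊗ VQ`: `J¹Q → Q` is an affine bundle. -/
def Jet.translate {π : Q → X} (z : Jet n m π)
    (B : TangentSpace (𝓡 n) (π z.pt) →L[ℝ] Vert n m π z.pt) : Jet n m π where
  pt := z.pt
  lin := z.lin + (Vert n m π z.pt).subtypeL.comp B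
  right_inv := by
    rw [ContinuousLinearMap.comp_add, z.right_inv]
    ext v
    simp

/-- The Legendre map `L̂ : J¹Q → Π`, `p^l_i ∘ L̂ = ∂^l_i 𝓛`: the derivative of `L` along the fibres of
`J¹Q → Q`. -/
def legendreMap {π : Q → X} (L : JetDensity n m π) (z : Jet n m π) : Legendre n m π where
  pt := z.pt
  mom := fderiv ℝ (fun B => L (z.translate B)) 0

/-- The Lagrangian constraint space `N_L = L̂(J¹Q)`. -/
def constraintSpace {π : Q → X} (L : JetDensity n m π) : Set (Legendre n m π) :=
  Set.range (legendreMap L)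

/-- The Legendre map as a map onto the Lagrangian constraint space. -/
def legendreMapOnto {π : Q → X} (L : JetDensity n m π) (z : Jet n m π) : constraintSpace L :=
  ⟨legendreMap L z, z, rfl⟩

section
variable [IsManifold (𝓡 n) ∞ X] {π : Q → X} [SmoothFiberBundle (𝓡 (n + m)) (𝓡 n) m π]

/-- A smooth (global) section of `J¹Q → X`. -/
structure IsJetSection (s : X → Jet n m π) : Prop where
  smooth : ContMDiff (𝓡 n) 𝓘(ℝ, JetModel n m) ∞ s
  isSection : ∀ x, π (s x).pt = x

/-- The component `∂_l s^j - s^j_l` of the section `s = (s^j, s^j_l)` of `J¹Q → X`. -/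
def FibChart.defect (c : FibChart n m π) (s : X → Jet n m π) (l : Fin n) (j : Fin m) (ξ : Euc n) :
    ℝ :=
  dX (fun ζ => (c.tot (s (c.base.symm ζ)).pt).2 j) l ξ -
    c.vel (s (c.base.symm ξ)) (EuclideanSpace.single l 1) j

/-- `s` is a section of `J¹Q → X` that solves the Cartan equations
`(ȳ^j_μ - y^j_μ) ∂^l_i ∂^μ_j 𝓛 = 0`,
`∂_i 𝓛 - d̄_l ∂^l_i 𝓛 + (ȳ^j_μ - y^j_μ) ∂_i ∂^μ_j 𝓛 = 0`.
On the jet prolongation of `s` one has `ȳ^j_μ = ∂_μ s^j`, and `d̄_l f` is the derivative `∂/∂x^l` of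
`f ∘ s`. -/
structure IsCartanSolution (L : JetDensity n m π) (s : X → Jet n m π) : Prop
    extends IsJetSection s where
  equation₁ : ∀ (c : FibChart n m π) (x : X), (s x).pt ∈ c.tot.source →
    ∀ (l : Fin n) (i : Fin m),
      ∑ μ, ∑ j, c.defect s μ j (c.base x) *
        dV (dV (c.localLagrangian L) μ j) l i (c.jetCoord (s x)) = 0
  equation₂ : ∀ (c : FibChart n m π) (x : X), (s x).pt ∈ c.tot.source → ∀ i : Fin m,
    dY (c.localLagrangian L) i (c.jetCoord (s x)) -
      ∑ l, dX (fun ξ => dV (c.localLagrangian L) l i (c.jetCoord (s (c.base.symm ξ)))) l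
        (c.base x) +
      ∑ μ, ∑ j, c.defect s μ j (c.base x) *
        dY (dV (c.localLagrangian L) μ j) i (c.jetCoord (s x)) = 0

/-- `L` is almost-regular: `N_L`, with the given smooth structure, is a closed imbedded subbundle of
the Legendre bundle over `Q`, and `L̂ : J¹Q → N_L` is a submersion with connected fibres. -/
structure IsAlmostRegular (k : ℕ) (L : JetDensity n m π)
    [ChartedSpace (Euc (n + k)) (constraintSpace L)] : Prop where
  isClosed : IsClosed (constraintSpace L)
  embedding : Manifold.IsSmoothEmbedding (𝓡 (n + k)) 𝓘(ℝ, LegendreModel n m) ∞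
    (Subtype.val : constraintSpace L → Legendre n m π)
  subbundle : ∃ j : ℕ, SmoothFiberBundle (𝓡 (n + k)) (𝓡 (n + m)) j
    (fun q : constraintSpace L => q.1.pt)
  submersion : Manifold.IsSubmersion 𝓘(ℝ, JetModel n m) (𝓡 (n + k)) ∞ (legendreMapOnto L)
  connected : ∀ q ∈ constraintSpace L, IsConnected (legendreMap L ⁻¹' {q})

/-! ### Hamiltonians -/

/-- The coordinate expression `𝓗(x^μ, y^i, p^μ_i)` of a map `q ↦ 𝓗(q) ∈ ⋀ⁿT*_yQ`, where
`𝓗(q) = p^l_i dy^i ∧ ω_l - 𝓗 ω`: minus the value at the frame `∂₁, …, ∂ₙ` of the coordinates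
`(x^μ, y^i)`. -/
def FibChart.localHamiltonian (c : FibChart n m π)
    (F : (q : Legendre n m π) → TangentSpace (𝓡 (n + m)) q.pt [⋀^Fin n]→L[ℝ] ℝ)
    (w : LegendreModel n m) : ℝ :=
  -F (c.legendreOf w) fun l =>
    (c.dtot (c.legendreOf w).pt).inverse (EuclideanSpace.single l 1, 0)

variable (n m π) in
/-- A Hamiltonian: a smooth section of the bundle `Z = T*Q ∧ (⋀ⁿ⁻¹T*X) → Π`. The fibre of `Z` at `y`
consists of the `n`-forms on `T_yQ` that vanish whenever two of their arguments are vertical; such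
a form `ζ` lies over the element of `Π` given by the linear part of the affine map
`J¹_yQ → ⋀ⁿT*_xX`, `A ↦ A*ζ`. -/
structure Hamiltonian where
  /-- The section. -/
  form : (q : Legendre n m π) → TangentSpace (𝓡 (n + m)) q.pt [⋀^Fin n]→L[ℝ] ℝ
  form_vertical : ∀ (q : Legendre n m π) (w : Fin n → TangentSpace (𝓡 (n + m)) q.pt)
    (a b : Fin n), a ≠ b → w a ∈ Vert n m π q.pt → w b ∈ Vert n m π q.pt → form q w = 0
  form_over : ∀ (q : Legendre n m π)
    (A : TangentSpace (𝓡 n) (π q.pt) →L[ℝ] TangentSpace (𝓡 (n + m)) q.pt),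
    (mfderiv (𝓡 (n + m)) (𝓡 n) π q.pt).comp A = ContinuousLinearMap.id ℝ _ →
    ∀ B : TangentSpace (𝓡 n) (π q.pt) →L[ℝ] Vert n m π q.pt,
      (form q).compContinuousLinearMap (A + (Vert n m π q.pt).subtypeL.comp B) =
        (form q).compContinuousLinearMap A + q.mom B
  smooth : ∀ c : FibChart n m π,
    ContDiffOn ℝ ∞ (c.localHamiltonian form) {w | (w.1, w.2.1) ∈ c.tot.target}

/-- The Hamiltonian map `Ĥ : Π → J¹Q`, `y^i_l ∘ Ĥ = ∂𝓗/∂p^l_i`; the coordinates used over `y` are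
those of the chosen fibred chart at `y`. -/
def Hamiltonian.map (H : Hamiltonian n m π) (q : Legendre n m π) : Jet n m π :=
  (FibChart.chosen n m π q.pt).jetAt q.pt (FibChart.mem_chosen π q.pt)
    (∑ l, ∑ i, fderiv ℝ ((FibChart.chosen n m π q.pt).localHamiltonian H.form)
      ((FibChart.chosen n m π q.pt).legendreCoord q) (0, 0, momUnit l i) • velUnit l i)

/-- The Hamiltonian form on `Π`: the pull-back by the section `H` of the tautological form of `Z`. -/
def Hamiltonian.hamiltonianForm (H : Hamiltonian n m π) (q : Legendre n m π) :
    TangentSpace 𝓘(ℝ, LegendreModel n m) q [⋀^Fin n]→L[ℝ] ℝ :=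
  (H.form q).compContinuousLinearMap
    (mfderiv 𝓘(ℝ, LegendreModel n m) (𝓡 (n + m)) (Legendre.pt : Legendre n m π → Q) q)

/-- `H` is associated to `L`: `L̂ ∘ Ĥ ∘ L̂ = L̂`, and `p^l_i ∂^i_l 𝓗 - 𝓗 = 𝓛(x, y, ∂𝓗)` on `N_L`. The left
hand side of the second relation is the pull-back of `H(q) = p^l_i dy^i ∧ ω_l - 𝓗 ω` by the jet
`Ĥ(q) : T_xX → T_yQ`. -/
structure IsAssociated (L : JetDensity n m π) (H : Hamiltonian n m π) : Prop where
  legendre_comp : ∀ z : Jet n m π, legendreMap L (H.map (legendreMap L z)) = legendreMap L z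
  lagrangian_eq : ∀ q ∈ constraintSpace L,
    (H.form q).compContinuousLinearMap (H.map q).lin = L (H.map q)

end

/-! ### The constrained system -/

/-- The operator `h₀`, `dy^i ↦ y^i_l dx^l`, from `n`-forms on `Q` to horizontal densities on `J¹Q`. -/
def horizontalization {π : Q → X}
    (α : (q : Q) → TangentSpace (𝓡 (n + m)) q [⋀^Fin n]→L[ℝ] ℝ) : JetDensity n m π :=
  fun z => (α z.pt).compContinuousLinearMap z.lin

section
variable [IsManifold (𝓡 n) ∞ X] {π : Q → X} [SmoothFiberBundle (𝓡 (n + m)) (𝓡 n) m π]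

/-- The projection `N_L → X`. -/
def constraintProj (L : JetDensity n m π) (q : constraintSpace L) : X :=
  π q.1.pt

/-- The constrained Hamiltonian form: the pull-back of the Hamiltonian form to `N_L`. -/
def constrainedForm (k : ℕ) (L : JetDensity n m π)
    [ChartedSpace (Euc (n + k)) (constraintSpace L)] (H : Hamiltonian n m π)
    (q : constraintSpace L) : TangentSpace (𝓡 (n + k)) q [⋀^Fin n]→L[ℝ] ℝ :=
  (H.hamiltonianForm q.1).compContinuousLinearMap
    (mfderiv (𝓡 (n + k)) 𝓘(ℝ, LegendreModel n m)
      (Subtype.val : constraintSpace L → Legendre n m π) q)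

/-- The constrained Lagrangian `L_N = h₀(H_N)` on `J¹N_L`. -/
def constrainedLagrangian (k : ℕ) (L : JetDensity n m π)
    [ChartedSpace (Euc (n + k)) (constraintSpace L)] (H : Hamiltonian n m π) :
    JetDensity n k (constraintProj L) :=
  horizontalization (constrainedForm k L H)

/-- `r` is a section of `N_L → X` that solves the constrained Hamilton equations: the
Euler–Lagrange equations of the constrained Lagrangian. -/
def IsConstrainedHamiltonSolution (k : ℕ) (L : JetDensity n m π)
    [ChartedSpace (Euc (n + k)) (constraintSpace L)] (H : Hamiltonian n m π)
    (r : X → constraintSpace L) : Prop :=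
  IsEulerLagrangeSolution (constrainedLagrangian k L H) r

end

end CovariantField

end

open CovariantField

noncomputable section

namespace CovariantField

section

/-! Everything is local. Take fibred charts of the configuration bundle and of `N_L → X` over the
same base chart. Let `u = (x, q)` be the coordinates on `N_L`, let `Y(u)` and `P(u)` be the `y`- and
`p`-components of the inclusion into the Legendre bundle, and let `K(u)` be the Hamiltonian
restricted to `N_L`. The constrained Lagrangian is then `P (DY ∘ (id, v)) - K`. It is affine in the
velocities `v`, so its Euler–Lagrange expression along a section is of first order: the second
derivatives of `Y` cancel by symmetry. What remains is a linear form on coordinate vectors,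
`constrainedOperator` (`eulerLagrange_eq_constrainedOperator`).

Let `ψ` be the coordinate form of the Legendre map onto `N_L`. It satisfies `Y ∘ ψ = y`, `P ∘ ψ =
∂𝓛/∂v` and `K ∘ ψ = E`, with `E = v · ∂𝓛/∂v - 𝓛` the energy. By the chain rule the pull-back of
`constrainedOperator` along `Dψ` is `cartanOperator`, whose values on vertical coordinate vectors
are the left-hand sides of the Cartan equations (`constrainedOperator_eq_cartanOperator`). Since `ψ`
is a submersion over the base, vertical vectors of `N_L` are exactly the images of vertical vectors
of the jet space, so one operator vanishes on vertical vectors if and only if the other does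
(`eulerLagrange_iff_cartan`).

Association to `L` enters the equivalence only through `K ∘ ψ = E` (`localHamiltonian_legendreMap`).
By itself it gives this identity only at jets `Ĥ(q)`. But `dE` vanishes on vectors killed by the
differential of the Legendre map, and the fibres of that map are connected, so `E` is constant on
them (`energy_eq_of_legendreMap_eq`). Hence `K` is the same for all associated Hamiltonians.

The last assertion follows from the equivalence because `L̂ ∘ Ĥ` is the identity on `N_L` and `Ĥ` is
smooth. Smoothness rests on the independence of `∂𝓗/∂p` of the chart
(`FibChart.vel_jetAt_hamiltonianVel`). -/

theorem two_le_infty : (2 : WithTop ℕ∞) ≤ ∞ := WithTop.coe_le_coe.2 le_top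

/-! ### Coordinate bases and fibre derivatives. -/

theorem sum_smul_single {m : ℕ} (u : Euc m) :
    ∑ i, u i • (EuclideanSpace.single i 1 : Euc m) = u := by
  ext i
  simp [Finset.sum_apply, Pi.single_apply]

/-- A linear map is the sum of its columns. -/
theorem sum_proj_smulRight {n : ℕ} {F : Type*} [NormedAddCommGroup F] [NormedSpace ℝ F]
    (A : Euc n →L[ℝ] F) :
    ∑ l, (EuclideanSpace.proj l : Euc n →L[ℝ] ℝ).smulRight (A (EuclideanSpace.single l 1)) = A := by
  refine ContinuousLinearMap.ext fun v => ?_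
  rw [sum_apply]
  change ∑ l, v l • A (EuclideanSpace.single l 1) = A v
  simp only [← map_smul, ← map_sum, sum_smul_single]

theorem sum_smul_velUnit {n m : ℕ} (A : Euc n →L[ℝ] Euc m) :
    ∑ l, ∑ i, A (EuclideanSpace.single l 1) i • velUnit l i = A := by
  conv_rhs => rw [← sum_proj_smulRight A]
  refine Finset.sum_congr rfl fun l _ => ?_
  conv_rhs => rw [← sum_smul_single (A (EuclideanSpace.single l 1))]
  refine ContinuousLinearMap.ext fun v => ?_
  simp [velUnit, Finset.smul_sum, smul_comm (v l)]

/-- The derivative of a function on the jet space along the fibres of `J¹Q → Q`. -/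
def fibreDeriv {n m : ℕ} (f : JetModel n m → ℝ) (w : JetModel n m) :
    (Euc n →L[ℝ] Euc m) →L[ℝ] ℝ :=
  (fderiv ℝ f w).comp ((ContinuousLinearMap.inr ℝ (Euc n) (Euc m × (Euc n →L[ℝ] Euc m))).comp
    (ContinuousLinearMap.inr ℝ (Euc m) (Euc n →L[ℝ] Euc m)))

theorem fibreDeriv_apply {n m : ℕ} (f : JetModel n m → ℝ) (w : JetModel n m)
    (a : Euc n →L[ℝ] Euc m) : fibreDeriv f w a = fderiv ℝ f w (0, 0, a) := rfl

theorem contDiffAt_fibreDeriv {n m : ℕ} {f : JetModel n m → ℝ} {w : JetModel n m}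
    (hf : ContDiffAt ℝ ∞ f w) : ContDiffAt ℝ ∞ (fibreDeriv f) w :=
  (hf.fderiv_right (m := ∞) (by simp)).clm_comp contDiffAt_const

/-- Evaluation at `velUnit l i` is linear and commutes with differentiation. All second derivatives
in the Cartan equations thereby become values of the single derivative of `fibreDeriv f`. -/
theorem fderiv_fibreDeriv_apply {n m : ℕ} {f : JetModel n m → ℝ} {w : JetModel n m}
    (hf : ContDiffAt ℝ ∞ f w) (l : Fin n) (i : Fin m) (δ : JetModel n m) :
    fderiv ℝ (dV f l i) w δ = fderiv ℝ (fibreDeriv f) w δ (velUnit l i) := by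
  have h := ((contDiffAt_fibreDeriv hf).differentiableAt (by simp)).hasFDerivAt
  refine (congrArg (fun T => T δ) (h.clm_apply (hasFDerivAt_const (velUnit l i) w)).fderiv).trans ?_
  simp

/-! ### Euler–Lagrange expression of a Lagrangian affine in the velocities. -/

section eulerLagrange
variable {n m k : ℕ} {Λ : JetModel n k → ℝ} {Y : Euc n × Euc k → Euc m}
  {P : Euc n × Euc k → (Euc n →L[ℝ] Euc m) →L[ℝ] ℝ} {K : Euc n × Euc k → ℝ}

/-- Product rule for `P (DY ∘ (id, v)) - K`. The order is the finite number 2 because being `C²` at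
a point passes to nearby points, and the formula is needed on a neighbourhood before it is
differentiated again. -/
theorem fderiv_constrained_apply {w : JetModel n k}
    (hY : ContDiffAt ℝ 2 Y (w.1, w.2.1)) (hP : ContDiffAt ℝ 2 P (w.1, w.2.1))
    (hK : ContDiffAt ℝ 2 K (w.1, w.2.1))
    (hΛ : ∀ᶠ u in 𝓝 (w.1, w.2.1), ∀ v, Λ (u.1, u.2, v) =
      P u ((fderiv ℝ Y u).comp ((ContinuousLinearMap.id ℝ (Euc n)).prod v)) - K u)
    (δ : JetModel n k) :
    fderiv ℝ Λ w δ =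
      fderiv ℝ P (w.1, w.2.1) (δ.1, δ.2.1) ((fderiv ℝ Y (w.1, w.2.1)).comp
        ((ContinuousLinearMap.id ℝ (Euc n)).prod w.2.2)) +
      P (w.1, w.2.1) ((fderiv ℝ (fderiv ℝ Y) (w.1, w.2.1) (δ.1, δ.2.1)).comp
        ((ContinuousLinearMap.id ℝ (Euc n)).prod w.2.2) +
        (fderiv ℝ Y (w.1, w.2.1)).comp
          ((ContinuousLinearMap.inr ℝ (Euc n) (Euc k)).comp δ.2.2)) -
      fderiv ℝ K (w.1, w.2.1) (δ.1, δ.2.1) := by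
  set τ : JetModel n k →L[ℝ] Euc n × Euc k := (ContinuousLinearMap.fst ℝ _ _).prod
    ((ContinuousLinearMap.fst ℝ _ _).comp (ContinuousLinearMap.snd ℝ _ _)) with hτ
  have hτw : τ w = (w.1, w.2.1) := rfl
  have hτδ : τ δ = (δ.1, δ.2.1) := rfl
  set κ : JetModel n k →L[ℝ] (Euc n →L[ℝ] Euc k) :=
    (ContinuousLinearMap.snd ℝ _ _).comp (ContinuousLinearMap.snd ℝ _ _) with hκ
  have hev : Λ =ᶠ[𝓝 w] fun w' => P (τ w') ((fderiv ℝ Y (τ w')).comp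
      (ContinuousLinearMap.inl ℝ (Euc n) (Euc k) +
        (ContinuousLinearMap.inr ℝ (Euc n) (Euc k)).comp (κ w'))) - K (τ w') := by
    filter_upwards [(τ.continuous.tendsto w).eventually hΛ] with w' hw'
    rw [show Λ w' = _ from hw' w'.2.2]
    congr 3
    ext v i <;> simp [hκ]
  rw [← hτw] at hY hP hK ⊢
  rw [← hτδ, hev.fderiv_eq]
  have dP := (hP.differentiableAt (by simp)).hasFDerivAt.comp w τ.hasFDerivAt
  have dK := (hK.differentiableAt (by simp)).hasFDerivAt.comp w τ.hasFDerivAt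
  have dDY := ((hY.fderiv_right (m := 1) (by norm_num)).differentiableAt
    (by simp)).hasFDerivAt.comp w τ.hasFDerivAt
  have dV : HasFDerivAt (fun w' => ContinuousLinearMap.inl ℝ (Euc n) (Euc k) +
        (ContinuousLinearMap.inr ℝ (Euc n) (Euc k)).comp (κ w')) _ w :=
    ((hasFDerivAt_const (ContinuousLinearMap.inr ℝ (Euc n) (Euc k)) w).clm_comp
      κ.hasFDerivAt).const_add _
  have h := (dP.clm_apply (dDY.clm_comp dV)).sub dK
  refine (congrArg (fun T => T δ) h.fderiv).trans ?_
  have e : ContinuousLinearMap.inl ℝ (Euc n) (Euc k) +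
        (ContinuousLinearMap.inr ℝ (Euc n) (Euc k)).comp (κ w) =
        (ContinuousLinearMap.id ℝ (Euc n)).prod w.2.2 := by
    ext v i <;> simp [hκ]
  have e2 : κ δ = δ.2.2 := rfl
  simp [e, e2]
  ring

/-- The Euler–Lagrange operator of the Lagrangian `P (DY ∘ (id, v)) - K`. -/
def constrainedOperator (Y : Euc n × Euc k → Euc m)
    (P : Euc n × Euc k → (Euc n →L[ℝ] Euc m) →L[ℝ] ℝ) (K : Euc n × Euc k → ℝ)
    (u : Euc n × Euc k) (v : Euc n →L[ℝ] Euc k) : Euc n × Euc k →L[ℝ] ℝ :=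
  (ContinuousLinearMap.apply ℝ ℝ ((fderiv ℝ Y u).comp
    ((ContinuousLinearMap.id ℝ (Euc n)).prod v))).comp (fderiv ℝ P u) - fderiv ℝ K u -
    ∑ l, (fderiv ℝ P u (EuclideanSpace.single l 1, v (EuclideanSpace.single l 1))).comp
      ((ContinuousLinearMap.smulRightL ℝ (Euc n) (Euc m) (EuclideanSpace.proj l)).comp
        (fderiv ℝ Y u))

theorem constrainedOperator_apply (u : Euc n × Euc k) (v : Euc n →L[ℝ] Euc k)
    (b : Euc n × Euc k) : constrainedOperator Y P K u v b =
  fderiv ℝ P u b ((fderiv ℝ Y u).comp ((ContinuousLinearMap.id ℝ (Euc n)).prod v)) -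
    fderiv ℝ K u b -
    ∑ l, fderiv ℝ P u (EuclideanSpace.single l 1, v (EuclideanSpace.single l 1))
      ((EuclideanSpace.proj l : Euc n →L[ℝ] ℝ).smulRight (fderiv ℝ Y u b)) := by
  rw [constrainedOperator, sub_apply, sub_apply, sum_apply]
  rfl

/-- Since the Lagrangian is affine in `v`, its velocity derivatives `P (dx^l ⊗ ∂_i Y)` depend on
`(x, q)` alone, and no second derivative of `ρ` survives. Their total derivatives contribute the sum
over `l` of `P (dx^l ⊗ D²Y(D e_l, ∂_i))`, which cancels the `D²Y` term of `∂_i Λ`. -/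
theorem eulerLagrange_eq_constrainedOperator {ρ : Euc n → Euc k} {ξ : Euc n}
    (hρ : ContDiffAt ℝ ∞ ρ ξ)
    (hY : ContDiffAt ℝ ∞ Y (ξ, ρ ξ)) (hP : ContDiffAt ℝ ∞ P (ξ, ρ ξ))
    (hK : ContDiffAt ℝ ∞ K (ξ, ρ ξ))
    (hΛ : ∀ᶠ u in 𝓝 (ξ, ρ ξ), ∀ v, Λ (u.1, u.2, v) =
      P u ((fderiv ℝ Y u).comp ((ContinuousLinearMap.id ℝ (Euc n)).prod v)) - K u) (i : Fin k) :
    dY Λ i (ξ, ρ ξ, fderiv ℝ ρ ξ) -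
      ∑ l, dX (fun ζ => dV Λ l i (ζ, ρ ζ, fderiv ℝ ρ ζ)) l ξ =
    constrainedOperator Y P K (ξ, ρ ξ) (fderiv ℝ ρ ξ) (0, EuclideanSpace.single i 1) := by
  set β : Euc n × Euc k := (0, EuclideanSpace.single i 1) with hβ
  set D := (ContinuousLinearMap.id ℝ (Euc n)).prod (fderiv ℝ ρ ξ) with hD
  have hY2 : ContDiffAt ℝ 2 Y (ξ, ρ ξ) := hY.of_le (two_le_infty)
  have hP2 : ContDiffAt ℝ 2 P (ξ, ρ ξ) := hP.of_le (two_le_infty)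
  have hK2 : ContDiffAt ℝ 2 K (ξ, ρ ξ) := hK.of_le (two_le_infty)
  have dσ : HasFDerivAt (fun ζ => (ζ, ρ ζ)) D ξ :=
    (hasFDerivAt_id ξ).prodMk (hρ.differentiableAt (by simp)).hasFDerivAt
  have key : ∀ l, dX (fun ζ => dV Λ l i (ζ, ρ ζ, fderiv ℝ ρ ζ)) l ξ =
      fderiv ℝ P (ξ, ρ ξ) (D (EuclideanSpace.single l 1))
        ((EuclideanSpace.proj l : Euc n →L[ℝ] ℝ).smulRight (fderiv ℝ Y (ξ, ρ ξ) β)) +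
      P (ξ, ρ ξ) ((EuclideanSpace.proj l : Euc n →L[ℝ] ℝ).smulRight
        (fderiv ℝ (fderiv ℝ Y) (ξ, ρ ξ) (D (EuclideanSpace.single l 1)) β)) := by
    intro l
    -- Along `(0, 0, velUnit l i)` only the velocity slot moves, so `P` and `K` are not
    -- differentiated. The identity is needed for all `ζ` near `ξ`, as it is differentiated in the
    -- next step.
    have hev : (fun ζ => dV Λ l i (ζ, ρ ζ, fderiv ℝ ρ ζ)) =ᶠ[𝓝 ξ] fun ζ =>
        P (ζ, ρ ζ) (ContinuousLinearMap.smulRightL ℝ (Euc n) (Euc m) (EuclideanSpace.proj l)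
          (fderiv ℝ Y (ζ, ρ ζ) β)) := by
      have c := dσ.continuousAt
      filter_upwards [c.eventually (hY2.eventually (by simp)),
        c.eventually (hP2.eventually (by simp)), c.eventually (hK2.eventually (by simp)),
        c.eventually hΛ.eventually_nhds] with ζ h1 h2 h3 h4
      rw [dV, fderiv_constrained_apply (w := (ζ, ρ ζ, fderiv ℝ ρ ζ)) h1 h2 h3 h4]
      have e : (fderiv ℝ Y (ζ, ρ ζ)).comp ((ContinuousLinearMap.inr ℝ (Euc n) (Euc k)).comp
          (velUnit l i)) = (EuclideanSpace.proj l : Euc n →L[ℝ] ℝ).smulRight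
            (fderiv ℝ Y (ζ, ρ ζ) β) := by
        refine ContinuousLinearMap.ext fun v => ?_
        change fderiv ℝ Y (ζ, ρ ζ) (0, v l • EuclideanSpace.single i 1) =
          v l • fderiv ℝ Y (ζ, ρ ζ) (0, EuclideanSpace.single i 1)
        rw [← map_smul, Prod.smul_mk, smul_zero]
      have e0 : (((0, 0, velUnit l i) : JetModel n k).1, ((0, 0, velUnit l i) : JetModel n k).2.1) =
        (0 : Euc n × Euc k) := rfl
      rw [e0]
      simp only [map_zero, zero_apply, ContinuousLinearMap.zero_comp, zero_add,
        sub_zero, e]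
      rfl
    rw [dX, hev.fderiv_eq]
    have dP := (hP.differentiableAt (by simp)).hasFDerivAt.comp ξ dσ
    have dDY := ((hY.fderiv_right (m := ∞) (by simp)).differentiableAt
      (by simp)).hasFDerivAt.comp ξ dσ
    have h := dP.clm_apply ((ContinuousLinearMap.smulRightL ℝ (Euc n) (Euc m)
      (EuclideanSpace.proj l)).hasFDerivAt.comp ξ (dDY.clm_apply (hasFDerivAt_const β ξ)))
    refine (congrArg (fun T => T (EuclideanSpace.single l 1)) h.fderiv).trans ?_
    rw [add_comm]
    simp
  rw [Finset.sum_congr rfl fun l _ => key l, dY, Finset.sum_add_distrib, ← map_sum,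
    fderiv_constrained_apply (w := (ξ, ρ ξ, fderiv ℝ ρ ξ)) hY2 hP2 hK2 hΛ]
  have hsymm : ∀ a b, fderiv ℝ (fderiv ℝ Y) (ξ, ρ ξ) a b = fderiv ℝ (fderiv ℝ Y) (ξ, ρ ξ) b a :=
    fun a b => (hY2.isSymmSndFDerivAt (by simp)).eq a b
  -- After the symmetry swap, the vectors `D²Y(β, D e_l)` are the columns of one linear map. Their
  -- sum is that map, and it cancels in the final `ring`.
  have e := sum_proj_smulRight ((fderiv ℝ (fderiv ℝ Y) (ξ, ρ ξ) β).comp D)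
  simp only [ContinuousLinearMap.comp_apply] at e
  simp only [fun l => hsymm (D (EuclideanSpace.single l 1)) β, e]
  simp only [constrainedOperator_apply, ContinuousLinearMap.comp_zero, add_zero]
  change _ + P (ξ, ρ ξ) ((fderiv ℝ (fderiv ℝ Y) (ξ, ρ ξ) β).comp D) - fderiv ℝ K (ξ, ρ ξ) β -
    (_ + P (ξ, ρ ξ) ((fderiv ℝ (fderiv ℝ Y) (ξ, ρ ξ) β).comp D)) = _
  simp only [hD, ContinuousLinearMap.prod_apply, ContinuousLinearMap.id_apply]
  ring

end eulerLagrange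

end

/-! ### The Cartan operator and its relation to the constrained operator. -/

section

section cartan
variable {n m k : ℕ} {l : JetModel n m → ℝ} {Y : Euc n × Euc k → Euc m}
  {P : Euc n × Euc k → (Euc n →L[ℝ] Euc m) →L[ℝ] ℝ} {K : Euc n × Euc k → ℝ}

/-- The Cartan operator of the Lagrangian `l` along a section `s` of the jet bundle. -/
def cartanOperator (l : JetModel n m → ℝ) (s : Euc n → JetModel n m) (ξ : Euc n) :
    JetModel n m →L[ℝ] ℝ :=
  (ContinuousLinearMap.apply ℝ ℝ (fderiv ℝ (fun ζ => (s ζ).2.1) ξ - (s ξ).2.2)).comp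
      (fderiv ℝ (fibreDeriv l) (s ξ)) +
    (fderiv ℝ l (s ξ)).comp ((ContinuousLinearMap.fst ℝ _ _).prod
      (((ContinuousLinearMap.fst ℝ _ _).comp (ContinuousLinearMap.snd ℝ _ _)).prod 0)) -
    ∑ μ, (fderiv ℝ (fibreDeriv l) (s ξ) (fderiv ℝ s ξ (EuclideanSpace.single μ 1))).comp
      ((ContinuousLinearMap.smulRightL ℝ (Euc n) (Euc m) (EuclideanSpace.proj μ)).comp
        ((ContinuousLinearMap.fst ℝ _ _).comp (ContinuousLinearMap.snd ℝ _ _)))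

/-- The velocity part of `δ` occurs in the first term only; it accounts for the first group of
Cartan equations. The base part `δ.1` is kept, although the equations concern `δ.1 = 0`, because the
pull-back identity holds for every `δ`. -/
theorem cartanOperator_apply (s : Euc n → JetModel n m) (ξ : Euc n) (δ : JetModel n m) :
    cartanOperator l s ξ δ =
  fderiv ℝ (fibreDeriv l) (s ξ) δ (fderiv ℝ (fun ζ => (s ζ).2.1) ξ - (s ξ).2.2) +
    fderiv ℝ l (s ξ) (δ.1, δ.2.1, 0) -
    ∑ μ, fderiv ℝ (fibreDeriv l) (s ξ) (fderiv ℝ s ξ (EuclideanSpace.single μ 1))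
      ((EuclideanSpace.proj μ : Euc n →L[ℝ] ℝ).smulRight δ.2.1) := by
  rw [cartanOperator, sub_apply, add_apply, sum_apply]
  rfl

/-- The Cartan operator vanishes on vertical vectors if and only if it vanishes on the coordinate
vectors. -/
theorem cartanOperator_vertical_eq_zero_iff (s : Euc n → JetModel n m) (ξ : Euc n) :
    (∀ (b : Euc m) (a : Euc n →L[ℝ] Euc m), cartanOperator l s ξ (0, b, a) = 0) ↔
      (∀ μ i, cartanOperator l s ξ (0, 0, velUnit μ i) = 0) ∧
      ∀ i, cartanOperator l s ξ (0, EuclideanSpace.single i 1, 0) = 0 := by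
  refine ⟨fun h => ⟨fun μ i => h _ _, fun i => h _ _⟩, fun ⟨h1, h2⟩ b a => ?_⟩
  have e : ((0, b, a) : JetModel n m) =
      (∑ i, b i • ((ContinuousLinearMap.inr ℝ (Euc n) (Euc m × (Euc n →L[ℝ] Euc m))).comp
        (ContinuousLinearMap.inl ℝ (Euc m) (Euc n →L[ℝ] Euc m))) (EuclideanSpace.single i 1)) +
      ∑ μ, ∑ i, a (EuclideanSpace.single μ 1) i •
        ((ContinuousLinearMap.inr ℝ (Euc n) (Euc m × (Euc n →L[ℝ] Euc m))).comp
        (ContinuousLinearMap.inr ℝ (Euc m) (Euc n →L[ℝ] Euc m))) (velUnit μ i) := by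
    simp only [← map_smul, ← map_sum, sum_smul_single, sum_smul_velUnit]
    simp
  rw [e]
  simp only [map_add, map_sum, map_smul]
  change ∑ i, b i • cartanOperator l s ξ (0, EuclideanSpace.single i 1, 0) + ∑ μ, ∑ i,
    a (EuclideanSpace.single μ 1) i • cartanOperator l s ξ (0, 0, velUnit μ i) = 0
  simp only [h1, h2, smul_zero, Finset.sum_const_zero, add_zero]

/-- The double sums over the defect in the Cartan equations are expansions, in the basis `velUnit ν
j`, of a linear form evaluated at `∂s - v`. -/
theorem sum_defect_mul {s : Euc n → JetModel n m} {ξ : Euc n} (hs : DifferentiableAt ℝ s ξ)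
    (p : (Euc n →L[ℝ] Euc m) →L[ℝ] ℝ) :
    ∑ ν, ∑ j, (dX (fun ζ => (s ζ).2.1 j) ν ξ - (s ξ).2.2 (EuclideanSpace.single ν 1) j) *
      p (velUnit ν j) = p (fderiv ℝ (fun ζ => (s ζ).2.1) ξ - (s ξ).2.2) := by
  conv_rhs => rw [← sum_smul_velUnit (fderiv ℝ (fun ζ => (s ζ).2.1) ξ - (s ξ).2.2)]
  simp only [map_sum, map_smul, smul_eq_mul]
  refine Finset.sum_congr rfl fun ν _ => Finset.sum_congr rfl fun j _ => ?_
  have h : HasFDerivAt (fun ζ => (s ζ).2.1 j) ((EuclideanSpace.proj j : Euc m →L[ℝ] ℝ).comp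
      (fderiv ℝ (fun ζ => (s ζ).2.1) ξ)) ξ :=
    (EuclideanSpace.proj j : Euc m →L[ℝ] ℝ).hasFDerivAt.comp ξ hs.snd.fst.hasFDerivAt
  rw [dX, h.fderiv]
  rfl

/-- Components of the first group of Cartan equations. -/
theorem cartanOperator_velUnit {s : Euc n → JetModel n m} {ξ : Euc n}
    (hl : ContDiffAt ℝ ∞ l (s ξ)) (hs : DifferentiableAt ℝ s ξ) (μ : Fin n) (i : Fin m) :
    cartanOperator l s ξ (0, 0, velUnit μ i) =
    ∑ ν, ∑ j, (dX (fun ζ => (s ζ).2.1 j) ν ξ - (s ξ).2.2 (EuclideanSpace.single ν 1) j) *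
      dV (dV l ν j) μ i (s ξ) := by
  simp only [dV.eq_1 (dV l _ _), fderiv_fibreDeriv_apply hl, sum_defect_mul hs]
  have e : ∀ ν : Fin n, (EuclideanSpace.proj ν : Euc n →L[ℝ] ℝ).smulRight (0 : Euc m) = 0 :=
    fun ν => by ext v i; simp
  rw [cartanOperator_apply, show (((0, 0, velUnit μ i) : JetModel n m).1,
    ((0, 0, velUnit μ i) : JetModel n m).2.1, (0 : Euc n →L[ℝ] Euc m)) = 0 from rfl]
  simp only [e, map_zero, Finset.sum_const_zero, add_zero, sub_zero]

theorem cartanOperator_single {s : Euc n → JetModel n m} {ξ : Euc n}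
    (hl : ContDiffAt ℝ ∞ l (s ξ)) (hs : DifferentiableAt ℝ s ξ) (i : Fin m) :
    cartanOperator l s ξ (0, EuclideanSpace.single i 1, 0) =
    dY l i (s ξ) - ∑ μ, dX (fun ζ => dV l μ i (s ζ)) μ ξ +
    ∑ ν, ∑ j, (dX (fun ζ => (s ζ).2.1 j) ν ξ - (s ξ).2.2 (EuclideanSpace.single ν 1) j) *
      dY (dV l ν j) i (s ξ) := by
  simp only [dY.eq_1 (dV l _ _), fderiv_fibreDeriv_apply hl, sum_defect_mul hs]
  have e : ∀ μ, dX (fun ζ => dV l μ i (s ζ)) μ ξ = fderiv ℝ (fibreDeriv l) (s ξ)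
      (fderiv ℝ s ξ (EuclideanSpace.single μ 1)) (velUnit μ i) := fun μ => by
    have dF := ((contDiffAt_fibreDeriv hl).differentiableAt (by simp)).hasFDerivAt
    have h := (dF.comp ξ hs.hasFDerivAt).clm_apply (hasFDerivAt_const (velUnit μ i) ξ)
    refine (congrArg (fun T => T (EuclideanSpace.single μ 1)) h.fderiv).trans ?_
    simp
  simp only [cartanOperator_apply, e]
  rw [dY]
  simp only [velUnit]
  ring

/-- The energy function `y^i_μ ∂^μ_i 𝓛 - 𝓛`. -/
def energy (l : JetModel n m → ℝ) (w : JetModel n m) : ℝ :=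
  fibreDeriv l w w.2.2 - l w

theorem contDiffAt_energy {w : JetModel n m} (hl : ContDiffAt ℝ ∞ l w) :
    ContDiffAt ℝ ∞ (energy l) w :=
  ((contDiffAt_fibreDeriv hl).clm_apply contDiffAt_snd.snd).sub hl

/-- The contribution `∂𝓛/∂v · δ_v` of the product rule cancels the velocity part of `d𝓛`. So the
velocity part of `δ` is felt only through `d(∂𝓛/∂v)`. This is behind both the constancy of the
energy on Legendre fibres and the appearance of the Cartan operator. -/
theorem fderiv_energy_apply {w : JetModel n m} (hl : ContDiffAt ℝ ∞ l w) (δ : JetModel n m) :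
    fderiv ℝ (energy l) w δ =
      fderiv ℝ (fibreDeriv l) w δ w.2.2 - fderiv ℝ l w (δ.1, δ.2.1, 0) := by
  have dv : HasFDerivAt (fun w : JetModel n m => w.2.2) ((ContinuousLinearMap.snd ℝ _ _).comp
      (ContinuousLinearMap.snd ℝ (Euc n) (Euc m × (Euc n →L[ℝ] Euc m)))) w :=
    ContinuousLinearMap.hasFDerivAt ((ContinuousLinearMap.snd ℝ _ _).comp
      (ContinuousLinearMap.snd ℝ (Euc n) (Euc m × (Euc n →L[ℝ] Euc m))))
  have dF := ((contDiffAt_fibreDeriv hl).differentiableAt (by simp)).hasFDerivAt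
  have h := (dF.clm_apply dv).sub (hl.differentiableAt (by simp)).hasFDerivAt
  refine (congrArg (fun A => A δ) h.fderiv).trans ?_
  have : fderiv ℝ l w δ = fderiv ℝ l w (δ.1, δ.2.1, 0) + fibreDeriv l w δ.2.2 := by
    rw [fibreDeriv_apply, ← map_add]
    simp
  change fibreDeriv l w δ.2.2 + fderiv ℝ (fibreDeriv l) w δ w.2.2 - fderiv ℝ l w δ = _
  rw [this]
  ring

set_option maxHeartbeats 800000 in
/-- Pull-back of the constrained operator by the Legendre map. -/
theorem constrainedOperator_eq_cartanOperator {s : Euc n → JetModel n m} {ξ : Euc n}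
    {ρ : Euc n → Euc k} {ψ : JetModel n m → Euc n × Euc k}
    (hl : ContDiffAt ℝ ∞ l (s ξ)) (hs : DifferentiableAt ℝ s ξ)
    (hρ : DifferentiableAt ℝ ρ ξ) (hY : DifferentiableAt ℝ Y (ξ, ρ ξ))
    (hP : DifferentiableAt ℝ P (ξ, ρ ξ)) (hK : DifferentiableAt ℝ K (ξ, ρ ξ))
    (hψ : DifferentiableAt ℝ ψ (s ξ))
    (hψs : ∀ᶠ ζ in 𝓝 ξ, ψ (s ζ) = (ζ, ρ ζ))
    (hYψ : ∀ᶠ w in 𝓝 (s ξ), Y (ψ w) = w.2.1)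
    (hPψ : ∀ᶠ w in 𝓝 (s ξ), P (ψ w) = fibreDeriv l w)
    (hKψ : ∀ᶠ w in 𝓝 (s ξ), K (ψ w) = energy l w)
    (δ : JetModel n m) :
    constrainedOperator Y P K (ξ, ρ ξ) (fderiv ℝ ρ ξ) (fderiv ℝ ψ (s ξ) δ) =
      cartanOperator l s ξ δ := by
  set T := fderiv ℝ ψ (s ξ) with hT
  have hψξ : ψ (s ξ) = (ξ, ρ ξ) := hψs.self_of_nhds
  rw [← hψξ] at hY hP hK
  have dσ : HasFDerivAt (fun ζ => (ζ, ρ ζ))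
      ((ContinuousLinearMap.id ℝ (Euc n)).prod (fderiv ℝ ρ ξ)) ξ :=
    (hasFDerivAt_id ξ).prodMk hρ.hasFDerivAt
  -- Derivative of `ψ ∘ s = (id, ρ)`. The relations for `Y`, `P` and `K` are differentiated in the
  -- same way below.
  have eσ : T.comp (fderiv ℝ s ξ) =
      (ContinuousLinearMap.id ℝ (Euc n)).prod (fderiv ℝ ρ ξ) := by
    refine (hψ.hasFDerivAt.comp ξ hs.hasFDerivAt).unique (dσ.congr_of_eventuallyEq ?_)
    exact hψs
  have dy : HasFDerivAt (fun w : JetModel n m => w.2.1) ((ContinuousLinearMap.fst ℝ _ _).comp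
      (ContinuousLinearMap.snd ℝ (Euc n) (Euc m × (Euc n →L[ℝ] Euc m)))) (s ξ) :=
    ContinuousLinearMap.hasFDerivAt ((ContinuousLinearMap.fst ℝ _ _).comp
      (ContinuousLinearMap.snd ℝ (Euc n) (Euc m × (Euc n →L[ℝ] Euc m))))
  have eY : (fderiv ℝ Y (ψ (s ξ))).comp T = _ :=
    (hY.hasFDerivAt.comp (s ξ) hψ.hasFDerivAt).unique (dy.congr_of_eventuallyEq hYψ)
  have dF := ((contDiffAt_fibreDeriv hl).differentiableAt (by simp)).hasFDerivAt
  have eP : (fderiv ℝ P (ψ (s ξ))).comp T = fderiv ℝ (fibreDeriv l) (s ξ) :=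
    (hP.hasFDerivAt.comp (s ξ) hψ.hasFDerivAt).unique (dF.congr_of_eventuallyEq hPψ)
  have eK : (fderiv ℝ K (ψ (s ξ))).comp T = fderiv ℝ (energy l) (s ξ) :=
    (hK.hasFDerivAt.comp (s ξ) hψ.hasFDerivAt).unique
      (((contDiffAt_energy hl).differentiableAt (by simp)).hasFDerivAt.congr_of_eventuallyEq hKψ)
  -- Together with `eσ`, this identifies the velocity `DY ∘ (id, Dρ)` occurring in the constrained
  -- operator with the derivative of the `y`-part of `s`.
  have eys : fderiv ℝ (fun ζ => (s ζ).2.1) ξ = (fderiv ℝ Y (ψ (s ξ))).comp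
      (T.comp (fderiv ℝ s ξ)) := by
    rw [← ContinuousLinearMap.comp_assoc, eY]
    exact (dy.comp ξ hs.hasFDerivAt).fderiv
  have pY : ∀ δ, fderiv ℝ Y (ψ (s ξ)) (T δ) = δ.2.1 := fun δ => congrArg (fun A => A δ) eY
  have pP : ∀ δ, fderiv ℝ P (ψ (s ξ)) (T δ) = fderiv ℝ (fibreDeriv l) (s ξ) δ :=
    fun δ => congrArg (fun A => A δ) eP
  have pK : fderiv ℝ K (ψ (s ξ)) (T δ) = fderiv ℝ (fibreDeriv l) (s ξ) δ (s ξ).2.2 -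
      fderiv ℝ l (s ξ) (δ.1, δ.2.1, 0) := by
    exact (congrArg (fun A => A δ) eK).trans (fderiv_energy_apply hl δ)
  have eσ' : ∀ μ : Fin n, (EuclideanSpace.single μ (1 : ℝ),
      fderiv ℝ ρ ξ (EuclideanSpace.single μ 1)) = T (fderiv ℝ s ξ (EuclideanSpace.single μ 1)) :=
    fun μ => (congrArg (fun A => A (EuclideanSpace.single μ 1)) eσ).symm
  -- The `dP` term pairs `d(∂𝓛/∂v)(δ)` with `∂s`, and `-dK` pairs it with `-v`. Together they
  -- produce the defect `∂s - v` and leave `d𝓛(δ_x, δ_y, 0)`.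
  rw [constrainedOperator_apply, cartanOperator_apply, ← hψξ, ← eσ, ← eys, pK, pY, pP, map_sub]
  simp only [eσ', pP]
  ring

/-- If the map `ψ` expressing the Legendre map is a submersion, then the Euler–Lagrange
equations of the constrained Lagrangian are equivalent to the Cartan equations. -/
theorem eulerLagrange_iff_cartan {Λ : JetModel n k → ℝ} {s : Euc n → JetModel n m} {ξ : Euc n}
    {ρ : Euc n → Euc k} {ψ : JetModel n m → Euc n × Euc k}
    (hl : ContDiffAt ℝ ∞ l (s ξ)) (hs : DifferentiableAt ℝ s ξ)
    (hρ : ContDiffAt ℝ ∞ ρ ξ) (hY : ContDiffAt ℝ ∞ Y (ξ, ρ ξ))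
    (hP : ContDiffAt ℝ ∞ P (ξ, ρ ξ)) (hK : ContDiffAt ℝ ∞ K (ξ, ρ ξ))
    (hΛ : ∀ᶠ u in 𝓝 (ξ, ρ ξ), ∀ v, Λ (u.1, u.2, v) =
      P u ((fderiv ℝ Y u).comp ((ContinuousLinearMap.id ℝ (Euc n)).prod v)) - K u)
    (hψ : DifferentiableAt ℝ ψ (s ξ))
    (hsurj : Function.Surjective (fderiv ℝ ψ (s ξ)))
    (hψs : ∀ᶠ ζ in 𝓝 ξ, ψ (s ζ) = (ζ, ρ ζ))
    (hxψ : ∀ᶠ w in 𝓝 (s ξ), (ψ w).1 = w.1)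
    (hYψ : ∀ᶠ w in 𝓝 (s ξ), Y (ψ w) = w.2.1)
    (hPψ : ∀ᶠ w in 𝓝 (s ξ), P (ψ w) = fibreDeriv l w)
    (hKψ : ∀ᶠ w in 𝓝 (s ξ), K (ψ w) = energy l w) :
    (∀ i, dY Λ i (ξ, ρ ξ, fderiv ℝ ρ ξ) -
      ∑ l, dX (fun ζ => dV Λ l i (ζ, ρ ζ, fderiv ℝ ρ ζ)) l ξ = 0) ↔
    (∀ μ i, ∑ ν, ∑ j, (dX (fun ζ => (s ζ).2.1 j) ν ξ -
      (s ξ).2.2 (EuclideanSpace.single ν 1) j) * dV (dV l ν j) μ i (s ξ) = 0) ∧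
    ∀ i, dY l i (s ξ) - ∑ μ, dX (fun ζ => dV l μ i (s ζ)) μ ξ +
      ∑ ν, ∑ j, (dX (fun ζ => (s ζ).2.1 j) ν ξ - (s ξ).2.2 (EuclideanSpace.single ν 1) j) *
        dY (dV l ν j) i (s ξ) = 0 := by
  simp only [eulerLagrange_eq_constrainedOperator hρ hY hP hK hΛ, ← cartanOperator_velUnit hl hs,
    ← cartanOperator_single hl hs]
  rw [← cartanOperator_vertical_eq_zero_iff]
  have key := constrainedOperator_eq_cartanOperator hl hs
    (hρ.differentiableAt (by simp)) (hY.differentiableAt (by simp)) (hP.differentiableAt (by simp))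
    (hK.differentiableAt (by simp)) hψ hψs hYψ hPψ hKψ
  -- `ψ` preserves the base coordinates, so `Dψ` maps vertical vectors to vertical vectors and any
  -- preimage of a vertical vector is vertical.
  have e1 : ∀ δ, (fderiv ℝ ψ (s ξ) δ).1 = δ.1 := fun δ =>
    congrArg (fun A => A δ) ((hasFDerivAt_fst.comp (s ξ) hψ.hasFDerivAt).unique
      (hasFDerivAt_fst.congr_of_eventuallyEq hxψ))
  constructor
  · intro h b a
    rw [← key (0, b, a)]
    have e : fderiv ℝ ψ (s ξ) (0, b, a) = ∑ i, (fderiv ℝ ψ (s ξ) (0, b, a)).2 i •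
        ContinuousLinearMap.inr ℝ (Euc n) (Euc k) (EuclideanSpace.single i 1) := by
      simp only [← map_smul, ← map_sum, sum_smul_single]
      exact Prod.ext (e1 _) rfl
    rw [e]
    simp only [map_sum, map_smul]
    refine Finset.sum_eq_zero fun i _ => ?_
    rw [ContinuousLinearMap.inr_apply, h i, smul_zero]
  · intro h i
    obtain ⟨δ, hδ⟩ := hsurj (0, EuclideanSpace.single i 1)
    have h0 : δ.1 = 0 := by rw [← e1, hδ]
    rw [← hδ, key δ]
    obtain ⟨x, b, a⟩ := δ
    obtain rfl : x = 0 := h0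
    exact h b a

end cartan

end

/-! ### Submersions, and smoothness of the induced charts. -/

section

section submersion
variable {E F : Type*} [NormedAddCommGroup E] [NormedSpace ℝ E] [NormedAddCommGroup F]
  [NormedSpace ℝ F] {M N : Type*} [TopologicalSpace M] [ChartedSpace E M]
  [TopologicalSpace N] [ChartedSpace F N]
  {f : M → N} {x : M}

/-- A submersion is a linear projection in suitable charts. -/
theorem exists_charts_of_isSubmersionAt (h : Manifold.IsSubmersionAt 𝓘(ℝ, E) 𝓘(ℝ, F) ∞ f x) :
    ∃ (φ : OpenPartialHomeomorph M E) (χ : OpenPartialHomeomorph N F) (A : E →L[ℝ] F)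
      (B : F →L[ℝ] E), x ∈ φ.source ∧ (∀ z ∈ φ.source, f z ∈ χ.source) ∧
      ContMDiffOn 𝓘(ℝ, E) 𝓘(ℝ, E) ∞ φ φ.source ∧
      ContMDiffOn 𝓘(ℝ, E) 𝓘(ℝ, E) ∞ φ.symm φ.target ∧
      ContMDiffOn 𝓘(ℝ, F) 𝓘(ℝ, F) ∞ χ χ.source ∧ (∀ v, A (B v) = v) ∧
      ∀ u ∈ φ.target, χ (f (φ.symm u)) = A u := by
  have h' := h.isSubmersionAtOfComplement_complement
  refine ⟨h'.domChart, h'.codChart, (ContinuousLinearMap.fst ℝ F h.complement).comp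
    (h'.equiv : E →L[ℝ] F × h.complement), (h'.equiv.symm : F × h.complement →L[ℝ] E).comp
    (ContinuousLinearMap.inl ℝ F h.complement), h'.mem_domChart_source,
    fun z hz => h'.source_subset_preimage_source hz,
    contMDiffOn_of_mem_maximalAtlas h'.domChart_mem_maximalAtlas,
    contMDiffOn_symm_of_mem_maximalAtlas h'.domChart_mem_maximalAtlas,
    contMDiffOn_of_mem_maximalAtlas h'.codChart_mem_maximalAtlas, fun v => by simp, ?_⟩
  intro u hu
  have hu' : u ∈ (h'.domChart.extend 𝓘(ℝ, E)).target := by simpa using hu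
  simpa using h'.writtenInCharts hu'

/-- A submersion has smooth local sections. -/
theorem exists_localSection_of_isSubmersionAt
    (h : Manifold.IsSubmersionAt 𝓘(ℝ, E) 𝓘(ℝ, F) ∞ f x) :
    ∃ σ : N → M, ContMDiffAt 𝓘(ℝ, F) 𝓘(ℝ, E) ∞ σ (f x) ∧ σ (f x) = x ∧
      ∀ᶠ y in 𝓝 (f x), f (σ y) = y := by
  obtain ⟨φ, χ, A, B, hx, hf, hφ, hφ', hχ, hAB, hA⟩ := exists_charts_of_isSubmersionAt h
  -- In these charts `f` is the linear map `A` with right inverse `B`, so `τ` is the affine section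
  -- through `φ x`: `A (τ y) = χ y`.
  set τ : N → E := fun y => φ x + B (χ y - χ (f x)) with hτ
  have hτx : τ (f x) = φ x := by simp [hτ]
  have hχx : ContMDiffAt 𝓘(ℝ, F) 𝓘(ℝ, F) ∞ χ (f x) :=
    hχ.contMDiffAt (χ.open_source.mem_nhds (hf x hx))
  have hτs : ContMDiffAt 𝓘(ℝ, F) 𝓘(ℝ, E) ∞ τ (f x) := by
    have h1 : ContDiff ℝ ∞ fun v : F => φ x + B (v - χ (f x)) := by fun_prop
    exact h1.contMDiff.contMDiffAt.comp (f x) hχx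
  refine ⟨fun y => φ.symm (τ y), ?_, by simp [hτx, hx], ?_⟩
  · refine ContMDiffAt.comp (I' := 𝓘(ℝ, E)) (f x) (g := φ.symm) ?_ hτs
    rw [hτx]
    exact hφ'.contMDiffAt (φ.open_target.mem_nhds (φ.map_source hx))
  · have ht : ∀ᶠ y in 𝓝 (f x), τ y ∈ φ.target :=
      hτs.continuousAt.eventually (by
        rw [hτx]; exact φ.open_target.mem_nhds (φ.map_source hx))
    filter_upwards [ht, χ.open_source.mem_nhds (hf x hx)] with y hy hy'
    refine χ.injOn (hf _ (φ.map_target hy)) hy' ?_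
    rw [hA _ hy]
    have := hA _ (φ.map_source hx)
    rw [φ.left_inv hx] at this
    simp [hτ, hAB, this]

/-- Nearby points in a fibre of a submersion can be joined by a smooth curve in that fibre. -/
theorem exists_curve_of_isSubmersionAt (h : Manifold.IsSubmersionAt 𝓘(ℝ, E) 𝓘(ℝ, F) ∞ f x) :
    ∀ᶠ z in 𝓝 x, f z = f x → ∃ (T : Set ℝ) (γ : ℝ → M), IsOpen T ∧ IsPreconnected T ∧ 0 ∈ T ∧
      1 ∈ T ∧ γ 0 = x ∧ γ 1 = z ∧ ContMDiffOn 𝓘(ℝ, ℝ) 𝓘(ℝ, E) ∞ γ T ∧ ∀ t ∈ T, f (γ t) = f x := by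
  obtain ⟨φ, χ, A, B, hx, hf, hφ, hφ', hχ, hAB, hA⟩ := exists_charts_of_isSubmersionAt h
  obtain ⟨r, hr, hball⟩ := Metric.isOpen_iff.1 φ.open_target _ (φ.map_source hx)
  have hev : ∀ᶠ z in 𝓝 x, φ z ∈ Metric.ball (φ x) r :=
    (φ.continuousAt hx).eventually (Metric.ball_mem_nhds _ hr)
  filter_upwards [hev, φ.open_source.mem_nhds hx] with z hz hzs hfz
  have hc : Continuous fun t : ℝ => AffineMap.lineMap (φ x) (φ z) t :=
    AffineMap.lineMap_continuous
  -- The curve is a straight line in the chart; `A` agrees at its endpoints and hence is constant on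
  -- it. Taking the preimage of a ball gives an open interval containing 0 and 1, so the curve can
  -- be differentiated at its endpoints.
  refine ⟨AffineMap.lineMap (φ x) (φ z) ⁻¹' Metric.ball (φ x) r,
    fun t => φ.symm (AffineMap.lineMap (φ x) (φ z) t), Metric.isOpen_ball.preimage hc,
    ((convex_ball (φ x) r).affine_preimage _).isPreconnected, by simp [hr], by simpa using hz,
    by simp [hx], by simp [hzs], ?_, ?_⟩
  · have h1 : ContDiff ℝ ∞ fun t : ℝ => AffineMap.lineMap (φ x) (φ z) t := by
      simp only [AffineMap.lineMap_apply, vsub_eq_sub, vadd_eq_add]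
      fun_prop
    exact (hφ'.mono hball).comp h1.contMDiff.contMDiffOn fun t ht => ht
  · intro t ht
    refine χ.injOn (hf _ (φ.map_target (hball ht))) (hf x hx) ?_
    rw [hA _ (hball ht)]
    have e1 := hA _ (φ.map_source hx)
    have e2 := hA _ (φ.map_source hzs)
    rw [φ.left_inv hx] at e1
    rw [φ.left_inv hzs, hfz] at e2
    simp [AffineMap.lineMap_apply, ← e1, ← e2]

end submersion

universe u
variable {n m : ℕ} {X : Type*} [TopologicalSpace X] [ChartedSpace (Euc n) X]
  {Q : Type u} [TopologicalSpace Q] [ChartedSpace (Euc (n + m)) Q]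
  {π : Q → X}

theorem FibChart.isOpen_target_prod (c : FibChart n m π) {F : Type*} [TopologicalSpace F] :
    IsOpen {w : Euc n × Euc m × F | (w.1, w.2.1) ∈ c.tot.target} :=
  c.tot.open_target.preimage (by fun_prop)

variable [IsManifold (𝓡 n) ∞ X] [SmoothFiberBundle (𝓡 (n + m)) (𝓡 n) m π]

namespace FibChart
variable (c : FibChart n m π)

/-- Any fibred chart may be used for coordinates on the jet manifold, not only the chosen ones that
make up `chartAt`. -/
theorem jetChart_mem_maximalAtlas (z₀ : Jet n m π) :
    (jetCore π).openPartialHomeomorph (c.jetChart z₀) ⟨c, z₀, rfl⟩ ∈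
      IsManifold.maximalAtlas 𝓘(ℝ, JetModel n m) ∞ (Jet n m π) :=
  IsManifold.subset_maximalAtlas (Set.mem_iUnion₂.2 ⟨_, ⟨c, z₀, rfl⟩, rfl⟩)

theorem legendreChart_mem_maximalAtlas :
    (legendreCore π).openPartialHomeomorph c.legendreChart ⟨c, rfl⟩ ∈
      IsManifold.maximalAtlas 𝓘(ℝ, LegendreModel n m) ∞ (Legendre n m π) :=
  IsManifold.subset_maximalAtlas (Set.mem_iUnion₂.2 ⟨_, ⟨c, rfl⟩, rfl⟩)

theorem contMDiffAt_jetCoord {z : Jet n m π} (hz : z.pt ∈ c.tot.source) :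
    ContMDiffAt 𝓘(ℝ, JetModel n m) 𝓘(ℝ, JetModel n m) ∞ c.jetCoord z :=
  contMDiffAt_of_mem_maximalAtlas (c.jetChart_mem_maximalAtlas z) hz

theorem contMDiffAt_jetChart_symm (z₀ : Jet n m π) {w : JetModel n m}
    (hw : (w.1, w.2.1) ∈ c.tot.target) :
    ContMDiffAt 𝓘(ℝ, JetModel n m) 𝓘(ℝ, JetModel n m) ∞ (c.jetChart z₀).symm w :=
  contMDiffAt_symm_of_mem_maximalAtlas (c.jetChart_mem_maximalAtlas z₀) hw

theorem contMDiffAt_legendreCoord {q : Legendre n m π} (hq : q.pt ∈ c.tot.source) :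
    ContMDiffAt 𝓘(ℝ, LegendreModel n m) 𝓘(ℝ, LegendreModel n m) ∞ c.legendreCoord q :=
  contMDiffAt_of_mem_maximalAtlas c.legendreChart_mem_maximalAtlas hq

theorem isOpen_jet_source : IsOpen {z : Jet n m π | z.pt ∈ c.tot.source} := by
  -- `jetChart` needs a jet as its default value, so an empty jet space is treated apart.
  rcases isEmpty_or_nonempty (Jet n m π) with h | ⟨⟨z₀⟩⟩
  · rw [Set.eq_empty_of_isEmpty {z : Jet n m π | z.pt ∈ c.tot.source}]
    exact isOpen_empty
  · exact ((jetCore π).openPartialHomeomorph (c.jetChart z₀) ⟨c, z₀, rfl⟩).open_source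

theorem isOpen_legendre_source : IsOpen {q : Legendre n m π | q.pt ∈ c.tot.source} :=
  ((legendreCore π).openPartialHomeomorph c.legendreChart ⟨c, rfl⟩).open_source

end FibChart

theorem contMDiff_legendre_pt : ContMDiff 𝓘(ℝ, LegendreModel n m) (𝓡 (n + m)) ∞
    (Legendre.pt : Legendre n m π → Q) := by
  intro q
  obtain ⟨c, hc⟩ := exists_fibChart (n := n) (m := m) π q.pt
  have h1 : ContMDiffAt 𝓘(ℝ, LegendreModel n m) 𝓘(ℝ, Euc n × Euc m) ∞
      (fun q' => ((c.legendreCoord q').1, (c.legendreCoord q').2.1)) q :=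
    (contDiff_fst.prodMk contDiff_snd.fst).contMDiff.contMDiffAt.comp q
      (c.contMDiffAt_legendreCoord hc)
  have h2 : ContMDiffAt 𝓘(ℝ, Euc n × Euc m) (𝓡 (n + m)) ∞ c.tot.symm (c.tot q.pt) :=
    c.tot_smooth.symm_smooth.contMDiffAt (c.tot.open_target.mem_nhds (c.tot.map_source hc))
  refine (h2.comp q h1).congr_of_eventuallyEq ?_
  filter_upwards [c.isOpen_legendre_source.mem_nhds hc] with q' hq'
  exact (c.tot.left_inv hq').symm

end

/-! ### The Legendre map and the Hamiltonian form in coordinates. -/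

section

/-- The derivative of `B ↦ g (a + T B) • θ`, where `T` is linear. -/
theorem fderiv_comp_add_smul {E G W : Type*} [NormedAddCommGroup E] [NormedSpace ℝ E]
    [NormedAddCommGroup G] [NormedSpace ℝ G] (V : Submodule ℝ G) [NormedAddCommGroup W]
    [NormedSpace ℝ W] {d : ℕ} (T : (E →L[ℝ] V) →L[ℝ] W) (θ : E [⋀^Fin d]→L[ℝ] ℝ)
    {g : W → ℝ} {g' : W →L[ℝ] ℝ} {a : W} (hg : HasFDerivAt g g' a)
    {f : (E →L[ℝ] V) → E [⋀^Fin d]→L[ℝ] ℝ} (hf : ∀ B, f B = g (a + T B) • θ) :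
    fderiv ℝ f 0 = (g'.comp T).smulRight θ := by
  obtain rfl : f = fun B => g (a + T B) • θ := funext hf
  have h0 : a + T 0 = a := by simp
  rw [← h0] at hg
  exact ((hg.comp (0 : E →L[ℝ] V) (T.hasFDerivAt.const_add a)).smul_const θ).fderiv

universe u
variable {n m : ℕ} {X : Type*} [TopologicalSpace X] [ChartedSpace (Euc n) X]
  {Q : Type u} [TopologicalSpace Q] [ChartedSpace (Euc (n + m)) Q] {π : Q → X}

namespace FibChart
variable (c : FibChart n m π)

theorem localLagrangian_jetCoord (L : JetDensity n m π) {z : Jet n m π}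
    (hz : z.pt ∈ c.tot.source) :
    c.localLagrangian L (c.jetCoord z) = L z (c.frame (π z.pt)) := by
  have hw : ((c.jetCoord z).1, (c.jetCoord z).2.1) ∈ c.tot.target := c.tot.map_source hz
  -- The type of `L z` depends on `z`, so the equality `jetOf (jetCoord z) = z` is transported
  -- through a variable `z'` instead of being rewritten.
  have h : ∀ z', z' = z → L z' (c.frame (π z'.pt)) = L z (c.frame (π z.pt)) := by
    rintro _ rfl; rfl
  rw [localLagrangian, dif_pos hw]
  exact h _ (c.jetOf_jetCoord z hz hw)

theorem contDiffAt_localLagrangian {L : JetDensity n m π} (hL : IsLagrangian L) {w : JetModel n m}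
    (hw : (w.1, w.2.1) ∈ c.tot.target) : ContDiffAt ℝ ∞ (c.localLagrangian L) w :=
  (hL c).contDiffAt (c.isOpen_target_prod.mem_nhds hw)

theorem vel_translate (z : Jet n m π)
    (B : TangentSpace (𝓡 n) (π z.pt) →L[ℝ] Vert n m π z.pt) :
    c.vel (z.translate B) = c.vel z + c.vertVel z.pt B := by
  refine ContinuousLinearMap.ext fun v => ?_
  change (c.dtot z.pt (z.lin ((c.dbase (π z.pt)).inverse v) +
    (B ((c.dbase (π z.pt)).inverse v) : TangentSpace (𝓡 (n + m)) z.pt))).2 = _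
  rw [map_add]
  rfl

theorem jetCoord_translate (z : Jet n m π)
    (B : TangentSpace (𝓡 n) (π z.pt) →L[ℝ] Vert n m π z.pt) :
    c.jetCoord (z.translate B) =
      ((c.tot z.pt).1, (c.tot z.pt).2, c.vel z + c.vertVel z.pt B) := by
  rw [← c.vel_translate]
  rfl

/-- The Legendre map in coordinates: `p^l_i ∘ L̂ = ∂^l_i 𝓛`. -/
theorem legendreMap_eq {L : JetDensity n m π} (hL : IsLagrangian L) {z : Jet n m π}
    (hz : z.pt ∈ c.tot.source) :
    legendreMap L z = c.legendreAt z.pt (fibreDeriv (c.localLagrangian L) (c.jetCoord z)) := by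
  have hw : ((c.jetCoord z).1, (c.jetCoord z).2.1) ∈ c.tot.target := c.tot.map_source hz
  have hl := ((c.contDiffAt_localLagrangian hL hw).differentiableAt (by simp)).hasFDerivAt
  have hg : HasFDerivAt (fun v => c.localLagrangian L ((c.tot z.pt).1, (c.tot z.pt).2, v))
      (fibreDeriv (c.localLagrangian L) (c.jetCoord z)) (c.vel z) := by
    refine HasFDerivAt.comp (c.vel z) (f := fun v => ((c.tot z.pt).1, (c.tot z.pt).2, v)) hl ?_
    exact (hasFDerivAt_prodMk_right (c.tot z.pt).1 ((c.tot z.pt).2, c.vel z)).comp (c.vel z)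
      (hasFDerivAt_prodMk_right (c.tot z.pt).2 (c.vel z))
  -- Translation does not move the base point, so the fixed form `c.vol` carries the density and
  -- only a scalar function of the velocities is left to differentiate.
  have hf : ∀ B : TangentSpace (𝓡 n) (π z.pt) →L[ℝ] Vert n m π z.pt, L (z.translate B) =
      c.localLagrangian L ((c.tot z.pt).1, (c.tot z.pt).2, c.vel z + c.vertVel z.pt B) •
        c.vol (π z.pt) := by
    intro B
    rw [← c.jetCoord_translate, c.localLagrangian_jetCoord L (z := z.translate B) hz]
    exact c.eq_smul_vol (c.mapsTo _ hz) (L (z.translate B))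
  have := fderiv_comp_add_smul (E := Euc n) (G := Euc (n + m)) (Vert n m π z.pt)
    (c.vertVel z.pt) (c.vol (π z.pt)) hg hf
  exact congrArg (Legendre.mk z.pt) this

theorem legendreCoord_legendreMap {L : JetDensity n m π} (hL : IsLagrangian L) {z : Jet n m π}
    (hz : z.pt ∈ c.tot.source) :
    c.legendreCoord (legendreMap L z) =
      ((c.tot z.pt).1, (c.tot z.pt).2, fibreDeriv (c.localLagrangian L) (c.jetCoord z)) := by
  rw [c.legendreMap_eq hL hz]
  refine Prod.ext rfl (Prod.ext rfl ?_)
  exact c.momCoord_legendreAt hz _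

/-- The linear map `T_xX → T_yQ` with velocity coordinates `v`. -/
def linAt (y : Q) (v : Euc n →L[ℝ] Euc m) :
    TangentSpace (𝓡 n) (π y) →L[ℝ] TangentSpace (𝓡 (n + m)) y :=
  (c.dtot y).inverse.comp (((ContinuousLinearMap.id ℝ (Euc n)).prod v).comp (c.dbase (π y)))

/-- Jets over `y` form an affine space, and the zero-velocity jet of the chart serves as origin.
This puts a jet in the shape required by `form_over`. -/
theorem linAt_eq_add {y : Q} (hy : y ∈ c.tot.source) (v : Euc n →L[ℝ] Euc m) :
    c.linAt y v = c.linAt y 0 + (Vert n m π y).subtypeL.comp (c.vertOf y v) := by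
  refine ContinuousLinearMap.ext fun u => ?_
  change (c.dtot y).inverse (c.dbase (π y) u, v (c.dbase (π y) u)) =
    (c.dtot y).inverse (c.dbase (π y) u, 0) +
      (c.vertIncl y (v (c.dbase (π y) u)) : TangentSpace (𝓡 (n + m)) y)
  rw [c.coe_vertIncl hy, ← map_add]
  simp

theorem eq_linAt_vel (z : Jet n m π) (hz : z.pt ∈ c.tot.source) :
    z.lin = c.linAt z.pt (c.vel z) := by
  obtain ⟨y, A, hA⟩ := z
  have := c.jetAt_vel ⟨y, A, hA⟩ hz
  simp only [jetAt, Jet.mk.injEq, true_and] at this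
  exact this.symm

theorem lin_eq_add {y : Q} (hy : y ∈ c.tot.source)
    (A : TangentSpace (𝓡 n) (π y) →L[ℝ] TangentSpace (𝓡 (n + m)) y)
    (hA : (mfderiv (𝓡 (n + m)) (𝓡 n) π y).comp A = ContinuousLinearMap.id ℝ _) :
    A = c.linAt y 0 + (Vert n m π y).subtypeL.comp (c.vertOf y (c.vel ⟨y, A, hA⟩)) := by
  rw [← c.linAt_eq_add hy]
  exact c.eq_linAt_vel ⟨y, A, hA⟩ hy

theorem legendreOf_legendreCoord {q : Legendre n m π} (hq : q.pt ∈ c.tot.source) :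
    c.legendreOf (c.legendreCoord q) = q :=
  c.legendreChart.left_inv hq

end FibChart

theorem FibChart.contDiffAt_localHamiltonian (c : FibChart n m π) (H : Hamiltonian n m π)
    {w : LegendreModel n m} (hw : (w.1, w.2.1) ∈ c.tot.target) :
    ContDiffAt ℝ ∞ (c.localHamiltonian H.form) w :=
  (H.smooth c).contDiffAt (c.isOpen_target_prod.mem_nhds hw)

/-- The Hamiltonian form in coordinates: `A*(p^l_i dy^i ∧ ω_l - 𝓗 ω) = (p^l_i A^i_l - 𝓗) ω`. -/
theorem Hamiltonian.form_frame (H : Hamiltonian n m π) (c : FibChart n m π) (q : Legendre n m π)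
    (hq : q.pt ∈ c.tot.source)
    (A : TangentSpace (𝓡 n) (π q.pt) →L[ℝ] TangentSpace (𝓡 (n + m)) q.pt)
    (hA : (mfderiv (𝓡 (n + m)) (𝓡 n) π q.pt).comp A = ContinuousLinearMap.id ℝ _) :
    H.form q (fun l => A (c.frame (π q.pt) l)) = c.momCoord q (c.vel ⟨q.pt, A, hA⟩) -
      c.localHamiltonian H.form (c.legendreCoord q) := by
  -- At the zero-velocity jet the form takes the value `-𝓗` by definition of `localHamiltonian`. The
  -- vertical remainder contributes the momentum paired with the velocity.
  have h := H.form_over q (c.linAt q.pt 0) (c.jetAt q.pt hq 0).right_inv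
    (c.vertOf q.pt (c.vel ⟨q.pt, A, hA⟩))
  rw [← c.lin_eq_add hq A hA] at h
  have h1 := congrArg (fun a : Density n (π q.pt) => a (c.frame (π q.pt))) h
  have h2 : c.localHamiltonian H.form (c.legendreCoord q) =
      -H.form q (fun l => (c.dtot q.pt).inverse (EuclideanSpace.single l 1, 0)) := by
    have : ∀ q', q' = q → -H.form q' (fun l => (c.dtot q'.pt).inverse
        (EuclideanSpace.single l 1, 0)) = -H.form q (fun l => (c.dtot q.pt).inverse
        (EuclideanSpace.single l 1, 0)) := by
      rintro _ rfl; rfl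
    exact this _ (c.legendreOf_legendreCoord hq)
  have h3 : (fun l => c.linAt q.pt 0 (c.frame (π q.pt) l)) =
      fun l => (c.dtot q.pt).inverse (EuclideanSpace.single l 1, 0) := by
    funext l
    have hb : c.dbase (π q.pt) (c.frame (π q.pt) l) = EuclideanSpace.single l 1 :=
      congrArg (fun f : Euc n →L[ℝ] Euc n => f (EuclideanSpace.single l 1))
        (c.base_smooth.comp_inverse (c.mapsTo _ hq))
    change (c.dtot q.pt).inverse (c.dbase (π q.pt) (c.frame (π q.pt) l), 0) = _
    rw [hb]
  rw [h2, sub_neg_eq_add, ← h3]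
  exact h1.trans (add_comm _ _)

end

/-! ### Chart independence and smoothness of the Hamiltonian map. -/

section

theorem momUnit_apply {n m : ℕ} (l : Fin n) (i : Fin m) (v : Euc n →L[ℝ] Euc m) :
    momUnit l i v = v (EuclideanSpace.single l 1) i := rfl

theorem sum_smul_momUnit {n m : ℕ} (p : (Euc n →L[ℝ] Euc m) →L[ℝ] ℝ) :
    ∑ l, ∑ i, p (velUnit l i) • momUnit l i = p := by
  refine ContinuousLinearMap.ext fun v => ?_
  conv_rhs => rw [← sum_smul_velUnit v]
  simp [map_sum, momUnit_apply, mul_comm]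

/-- The partial derivative with respect to the last of three variables. -/
theorem hasFDerivAt_comp_prodMk {A B W : Type*} [NormedAddCommGroup A] [NormedSpace ℝ A]
    [NormedAddCommGroup B] [NormedSpace ℝ B] [NormedAddCommGroup W] [NormedSpace ℝ W]
    {g : A × B × W → ℝ} {a : A} {b : B} {p : W} (hg : DifferentiableAt ℝ g (a, b, p)) :
    HasFDerivAt (fun p => g (a, b, p)) ((fderiv ℝ g (a, b, p)).comp
      ((ContinuousLinearMap.inr ℝ A (B × W)).comp (ContinuousLinearMap.inr ℝ B W))) p :=
  HasFDerivAt.comp p (f := fun p => (a, b, p)) hg.hasFDerivAt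
    ((hasFDerivAt_prodMk_right a (b, p)).comp p (hasFDerivAt_prodMk_right b p))

/-- Differentiation of a relation `α - g = κ (α' - g')` between functions that are related by a
linear change of the last variable. -/
theorem sub_fderiv_eq_of_linear_change {A B W A' B' W' : Type*}
    [NormedAddCommGroup A] [NormedSpace ℝ A] [NormedAddCommGroup B] [NormedSpace ℝ B]
    [NormedAddCommGroup W] [NormedSpace ℝ W] [NormedAddCommGroup A'] [NormedSpace ℝ A']
    [NormedAddCommGroup B'] [NormedSpace ℝ B'] [NormedAddCommGroup W'] [NormedSpace ℝ W']
    {g : A × B × W → ℝ} {g' : A' × B' × W' → ℝ} {a : A} {b : B} {a' : A'} {b' : B'} {p₀ : W}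
    (T : W →L[ℝ] W') (α : W →L[ℝ] ℝ) (α' : W' →L[ℝ] ℝ) {κ : ℝ}
    (hg : DifferentiableAt ℝ g (a, b, p₀)) (hg' : DifferentiableAt ℝ g' (a', b', T p₀))
    (h : ∀ p, α p - g (a, b, p) = (α' (T p) - g' (a', b', T p)) * κ) (p : W) :
    α p - fderiv ℝ g (a, b, p₀) (0, 0, p) =
      κ * (α' (T p) - fderiv ℝ g' (a', b', T p₀) (0, 0, T p)) := by
  have d1 := (α.hasFDerivAt (x := p₀)).sub (hasFDerivAt_comp_prodMk hg)
  have d2 := (((α'.hasFDerivAt (x := T p₀)).sub (hasFDerivAt_comp_prodMk hg')).comp p₀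
    T.hasFDerivAt).mul_const κ
  exact congrArg (fun f => f p)
    (d1.unique (d2.congr_of_eventuallyEq (Filter.Eventually.of_forall h)))

theorem apply_sub_fderiv_eq_of_linear_change {A B V : Type*}
    [NormedAddCommGroup A] [NormedSpace ℝ A] [NormedAddCommGroup B] [NormedSpace ℝ B]
    [NormedAddCommGroup V] [NormedSpace ℝ V] {g g' : A × B × (V →L[ℝ] ℝ) → ℝ}
    {y y' : A × B} {p₀ : V →L[ℝ] ℝ} (T : (V →L[ℝ] ℝ) →L[ℝ] (V →L[ℝ] ℝ)) (v v' : V) {κ : ℝ}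
    (hg : DifferentiableAt ℝ g (y.1, y.2, p₀))
    (hg' : DifferentiableAt ℝ g' (y'.1, y'.2, T p₀))
    (h : ∀ p, p v - g (y.1, y.2, p) = (T p v' - g' (y'.1, y'.2, T p)) * κ) (p : V →L[ℝ] ℝ) :
    p v - fderiv ℝ g (y.1, y.2, p₀) (0, 0, p) =
      κ * (T p v' - fderiv ℝ g' (y'.1, y'.2, T p₀) (0, 0, T p)) :=
  sub_fderiv_eq_of_linear_change T (ContinuousLinearMap.apply ℝ ℝ v)
    (ContinuousLinearMap.apply ℝ ℝ v') hg hg' h p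

universe u
variable {n m : ℕ} {X : Type*} [TopologicalSpace X] [ChartedSpace (Euc n) X]
  {Q : Type u} [TopologicalSpace Q] [ChartedSpace (Euc (n + m)) Q] {π : Q → X}

/-- The velocity `∂𝓗/∂p^l_i` in coordinates. -/
def FibChart.hamiltonianVel (c : FibChart n m π) (H : Hamiltonian n m π) (w : LegendreModel n m) :
    Euc n →L[ℝ] Euc m :=
  ∑ l, ∑ i, fderiv ℝ (c.localHamiltonian H.form) w (0, 0, momUnit l i) • velUnit l i

/-- The derivative of a Hamiltonian with respect to the momenta, as a linear form. -/
theorem FibChart.apply_hamiltonianVel (c : FibChart n m π) (H : Hamiltonian n m π)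
    (w : LegendreModel n m) (p : (Euc n →L[ℝ] Euc m) →L[ℝ] ℝ) :
    p (c.hamiltonianVel H w) = fderiv ℝ (c.localHamiltonian H.form) w (0, 0, p) := by
  have e : ((0, 0, p) : LegendreModel n m) = ∑ l, ∑ i, p (velUnit l i) •
      ((ContinuousLinearMap.inr ℝ (Euc n) (Euc m × ((Euc n →L[ℝ] Euc m) →L[ℝ] ℝ))).comp
        (ContinuousLinearMap.inr ℝ (Euc m) ((Euc n →L[ℝ] Euc m) →L[ℝ] ℝ))) (momUnit l i) := by
    simp only [← map_smul, ← map_sum, sum_smul_momUnit]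
    rfl
  rw [e]
  simp only [hamiltonianVel, map_sum, map_smul, smul_eq_mul]
  refine Finset.sum_congr rfl fun l _ => Finset.sum_congr rfl fun i _ => ?_
  exact mul_comm _ _

/-- The coordinate momenta `momUnit l i` separate velocities. The resulting basis-free
characterization of `∂𝓗/∂p` is suited to a linear change of momenta. -/
theorem FibChart.eq_hamiltonianVel_iff (c : FibChart n m π) (H : Hamiltonian n m π)
    (w : LegendreModel n m) (v : Euc n →L[ℝ] Euc m) :
    v = c.hamiltonianVel H w ↔
      ∀ p, p v = fderiv ℝ (c.localHamiltonian H.form) w (0, 0, p) := by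
  refine ⟨fun h p => h ▸ c.apply_hamiltonianVel H w p, fun h => ?_⟩
  rw [← sum_smul_velUnit v, hamiltonianVel]
  refine Finset.sum_congr rfl fun l _ => Finset.sum_congr rfl fun i _ => ?_
  rw [← h, momUnit_apply]

/-- Here the jet stays fixed while the momenta vary, so the identity can be differentiated in `p`.
-/
theorem Hamiltonian.form_frame_legendreAt (H : Hamiltonian n m π) (c : FibChart n m π) {y : Q}
    (hy : y ∈ c.tot.source) (p : (Euc n →L[ℝ] Euc m) →L[ℝ] ℝ)
    (A : TangentSpace (𝓡 n) (π y) →L[ℝ] TangentSpace (𝓡 (n + m)) y)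
    (hA : (mfderiv (𝓡 (n + m)) (𝓡 n) π y).comp A = ContinuousLinearMap.id ℝ _) :
    H.form (c.legendreAt y p) (fun l => A (c.frame (π y) l)) = p (c.vel ⟨y, A, hA⟩) -
      c.localHamiltonian H.form ((c.tot y).1, (c.tot y).2, p) := by
  have h := H.form_frame c (c.legendreAt y p) hy A hA
  have e : c.legendreCoord (c.legendreAt y p) = ((c.tot y).1, (c.tot y).2, p) :=
    Prod.ext rfl (Prod.ext rfl (c.momCoord_legendreAt hy p))
  rw [e, c.momCoord_legendreAt hy] at h
  exact h

/-- The linear change of momenta over `y` between two fibred charts. -/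
def FibChart.momChange (c c' : FibChart n m π) (y : Q) :
    ((Euc n →L[ℝ] Euc m) →L[ℝ] ℝ) →L[ℝ] ((Euc n →L[ℝ] Euc m) →L[ℝ] ℝ) :=
  c.vol (π y) (c'.frame (π y)) •
    (ContinuousLinearMap.precomp ℝ ((c.vertVel y).comp (c'.vertOf y)))

theorem FibChart.momCoord_legendreAt' (c c' : FibChart n m π) (y : Q)
    (p : (Euc n →L[ℝ] Euc m) →L[ℝ] ℝ) :
    c'.momCoord (c.legendreAt y p) = c.momChange c' y p := by
  refine ContinuousLinearMap.ext fun v => ?_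
  exact mul_comm _ _

/-- The velocity `∂𝓗/∂p` does not depend on the fibred chart. -/
theorem FibChart.vel_jetAt_hamiltonianVel (H : Hamiltonian n m π) (c c' : FibChart n m π)
    (q : Legendre n m π) (hq : q.pt ∈ c.tot.source) (hq' : q.pt ∈ c'.tot.source) :
    c.vel (c'.jetAt q.pt hq' (c'.hamiltonianVel H (c'.legendreCoord q))) =
      c.hamiltonianVel H (c.legendreCoord q) := by
  set v' := c'.hamiltonianVel H (c'.legendreCoord q) with hv'
  set z := c'.jetAt q.pt hq' v' with hz
  have hz' : c'.vel z = v' := c'.vel_jetAt _ _ _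
  rw [c.eq_hamiltonianVel_iff]
  intro p
  set κ := c'.vol (π q.pt) (c.frame (π q.pt)) with hκ
  -- For the fixed jet `z` both charts compute the same `n`-form, so `p · v - 𝓗` changes by the
  -- factor `κ` between the two frames. Differentiated at the momenta of `q`, the right side
  -- vanishes since `v'` is the derivative of the Hamiltonian in `c'`; hence so does the left.
  have hident : ∀ p, p (c.vel z) - c.localHamiltonian H.form ((c.tot q.pt).1, (c.tot q.pt).2, p) =
      (c.momChange c' q.pt p v' - c'.localHamiltonian H.form ((c'.tot q.pt).1, (c'.tot q.pt).2,
        c.momChange c' q.pt p)) * κ := by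
    intro p
    rw [← c.momCoord_legendreAt' c']
    have h1 := H.form_frame_legendreAt c hq p z.lin z.right_inv
    have h2 := H.form_frame c' (c.legendreAt q.pt p) hq' z.lin z.right_inv
    have h3 := congrArg (fun a : Density n (π q.pt) => a (c.frame (π q.pt)))
      (c'.eq_smul_vol (c'.mapsTo _ hq')
        ((H.form (c.legendreAt q.pt p)).compContinuousLinearMap z.lin))
    rw [← hz']
    exact h1.symm.trans (h3.trans (congrArg (· * κ) h2))
  have e0 : c.momChange c' q.pt (c.momCoord q) = c'.momCoord q := by
    rw [← c.momCoord_legendreAt', c.legendreAt_momCoord q hq]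
  set p₀ := c.momCoord q with hp₀
  have hp2 := apply_sub_fderiv_eq_of_linear_change (g := c.localHamiltonian H.form)
    (g' := c'.localHamiltonian H.form) (y := c.tot q.pt) (y' := c'.tot q.pt) (p₀ := p₀)
    (c.momChange c' q.pt) (c.vel z) v'
    ((c.contDiffAt_localHamiltonian H (c.tot.map_source hq)).differentiableAt (by simp))
    ((c'.contDiffAt_localHamiltonian H (c'.tot.map_source hq')).differentiableAt (by simp))
    hident p
  have h0 := c'.apply_hamiltonianVel H (c'.legendreCoord q) (c.momChange c' q.pt p)
  rw [← hv'] at h0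
  rw [e0] at hp2
  have h5 : c.momChange c' q.pt p v' - fderiv ℝ (c'.localHamiltonian H.form)
      ((c'.tot q.pt).1, (c'.tot q.pt).2, c'.momCoord q) (0, 0, c.momChange c' q.pt p) = 0 :=
    sub_eq_zero.2 h0
  exact sub_eq_zero.1 (hp2.trans ((congrArg (κ * ·) h5).trans (mul_zero κ)))

variable [IsManifold (𝓡 n) ∞ X] [SmoothFiberBundle (𝓡 (n + m)) (𝓡 n) m π]

/-- `H.map` is defined with a chart chosen separately at each point, with no continuity in the
choice. By chart independence one formula in a fixed chart describes it on the whole chart domain.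
-/
theorem Hamiltonian.jetCoord_map (H : Hamiltonian n m π) (c : FibChart n m π) (q : Legendre n m π)
    (hq : q.pt ∈ c.tot.source) :
    c.jetCoord (H.map q) = ((c.tot q.pt).1, (c.tot q.pt).2,
      c.hamiltonianVel H (c.legendreCoord q)) := by
  rw [← FibChart.vel_jetAt_hamiltonianVel H c (FibChart.chosen n m π q.pt) q hq
    (FibChart.mem_chosen π q.pt)]
  rfl

/-- The Hamiltonian map is smooth. -/
theorem Hamiltonian.contMDiff_map (H : Hamiltonian n m π) :
    ContMDiff 𝓘(ℝ, LegendreModel n m) 𝓘(ℝ, JetModel n m) ∞ H.map := by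
  intro q
  obtain ⟨c, hc⟩ := exists_fibChart (n := n) (m := m) π q.pt
  have hw : ((c.legendreCoord q).1, (c.legendreCoord q).2.1) ∈ c.tot.target :=
    c.tot.map_source hc
  have h1 : ContDiffAt ℝ ∞ (c.hamiltonianVel H) (c.legendreCoord q) := by
    have hd := (c.contDiffAt_localHamiltonian H hw).fderiv_right (m := ∞) (by simp)
    exact ContDiffAt.sum fun l _ => ContDiffAt.sum fun i _ =>
      (hd.clm_apply contDiffAt_const).smul contDiffAt_const
  have h2 : ContDiffAt ℝ ∞ (fun w : LegendreModel n m => (w.1, w.2.1, c.hamiltonianVel H w))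
      (c.legendreCoord q) := contDiffAt_fst.prodMk (contDiffAt_snd.fst.prodMk h1)
  have h3 := c.contMDiffAt_jetChart_symm (H.map q)
    (w := (fun w : LegendreModel n m => (w.1, w.2.1, c.hamiltonianVel H w)) (c.legendreCoord q)) hw
  refine ((h3.comp (c.legendreCoord q) h2.contMDiffAt).comp q
    (c.contMDiffAt_legendreCoord hc)).congr_of_eventuallyEq ?_
  filter_upwards [c.isOpen_legendre_source.mem_nhds hc] with q' hq'
  have h4 := (c.jetChart (H.map q)).left_inv
    (show H.map q' ∈ (c.jetChart (H.map q)).source from hq')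
  refine h4.symm.trans (congrArg (c.jetChart (H.map q)).symm ?_)
  exact H.jetCoord_map c q' hq'

end

/-! ### Fibred charts with a prescribed base, and charts of composite bundles. -/

section

section charts
variable {E H F F' : Type*} [NormedAddCommGroup E] [NormedSpace ℝ E]
    [TopologicalSpace H] {I : ModelWithCorners ℝ E H} [NormedAddCommGroup F] [NormedSpace ℝ F]
    [NormedAddCommGroup F'] [NormedSpace ℝ F']
    {M : Type*} [TopologicalSpace M] [ChartedSpace H M] {e : OpenPartialHomeomorph M F}

theorem IsSmoothChart.trans (he : IsSmoothChart I e) (f : OpenPartialHomeomorph F F')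
    (hf : ContDiffOn ℝ ∞ f f.source) (hf' : ContDiffOn ℝ ∞ f.symm f.target) :
    IsSmoothChart I (e.trans f) := by
  constructor
  · exact hf.contMDiffOn.comp (he.smooth.mono fun x hx => hx.1) fun x hx => hx.2
  · exact he.symm_smooth.comp (hf'.contMDiffOn.mono fun x hx => hx.1) fun x hx => hx.2

end charts

universe u
variable {n m : ℕ} {X : Type*} [TopologicalSpace X] [ChartedSpace (Euc n) X]
  {Q : Type u} [TopologicalSpace Q] [ChartedSpace (Euc (n + m)) Q] {π : Q → X}

/-- The fibred chart with the same fibre coordinates and another chart of the base. -/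
def FibChart.withBase (c : FibChart n m π) (b : OpenPartialHomeomorph X (Euc n))
    (hb : IsSmoothChart (𝓡 n) b) : FibChart n m π where
  tot := c.tot.trans ((c.base.symm.trans b).prod (OpenPartialHomeomorph.refl (Euc m)))
  base := b
  tot_smooth := by
    refine c.tot_smooth.trans _ ?_ ?_
    · exact ((c.base_smooth.contDiffOn_transition hb).comp contDiff_fst.contDiffOn
        fun w hw => hw.1).prodMk contDiff_snd.contDiffOn
    · refine ContDiffOn.prodMk ?_ contDiff_snd.contDiffOn
      refine (hb.contDiffOn_transition c.base_smooth).comp contDiff_fst.contDiffOn ?_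
      intro w hw
      simpa using hw.1
  base_smooth := hb
  mapsTo y hy := by
    have h2 : c.base.symm (c.tot y).1 ∈ b.source := hy.2.1.2
    rwa [← c.base_proj y hy.1, c.base.left_inv (c.mapsTo y hy.1)] at h2
  base_proj y hy := by
    change b (π y) = b (c.base.symm (c.tot y).1)
    rw [← c.base_proj y hy.1, c.base.left_inv (c.mapsTo y hy.1)]

theorem FibChart.mem_withBase_source (c : FibChart n m π) {b : OpenPartialHomeomorph X (Euc n)}
    (hb : IsSmoothChart (𝓡 n) b) {y : Q} (hy : y ∈ c.tot.source) (hy' : π y ∈ b.source) :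
    y ∈ (c.withBase b hb).tot.source := by
  refine ⟨hy, ⟨?_, ?_⟩, trivial⟩
  · change (c.tot y).1 ∈ c.base.target
    rw [← c.base_proj y hy]
    exact c.base.map_source (c.mapsTo y hy)
  · change c.base.symm (c.tot y).1 ∈ b.source
    rwa [← c.base_proj y hy, c.base.left_inv (c.mapsTo y hy)]

/-- Fibred charts of the total space of a fibre bundle `p` over the total space of `π`, fibred
over the base of `π`. -/
theorem exists_fibChart_comp [IsManifold (𝓡 n) ∞ X] [SmoothFiberBundle (𝓡 (n + m)) (𝓡 n) m π]
    {k j : ℕ} {N : Type*} [TopologicalSpace N] [ChartedSpace (Euc (n + k)) N] (p : N → Q)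
    [h : SmoothFiberBundle (𝓡 (n + k)) (𝓡 (n + m)) j p] (q : N) :
    ∃ d : FibChart n k (fun q => π (p q)), q ∈ d.tot.source := by
  obtain ⟨M, _, _, _, hM⟩ := h.exists_trivialization
  obtain ⟨e, hb, he, he'⟩ := hM (p q)
  obtain ⟨c, hc⟩ := exists_fibChart (n := n) (m := m) π (p q)
  have hq : q ∈ e.source := by rw [e.source_eq]; exact hb
  have h2 := isSmoothChart_chartAt j (e q).2
  set f : OpenPartialHomeomorph N ((Euc n × Euc m) × Euc j) := e.toOpenPartialHomeomorph.trans
    (c.tot.prod (chartAt (Euc j) (e q).2)) with hf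
  have hs : ∀ z ∈ f.source, z ∈ e.source ∧ (e z).1 ∈ c.tot.source ∧
      (e z).2 ∈ (chartAt (Euc j) (e q).2).source := fun z hz => by simpa [hf] using hz
  have hfs : IsSmoothChart (𝓡 (n + k)) f := by
    constructor
    · have he0 := he.mono (fun z hz => (hs z hz).1)
      exact (c.tot_smooth.smooth.comp (contMDiff_fst.comp_contMDiffOn he0)
          (fun z hz => (hs z hz).2.1)).prodMk_space
        (h2.smooth.comp (contMDiff_snd.comp_contMDiffOn he0) (fun z hz => (hs z hz).2.2))
    · have hs' : ∀ w ∈ f.target, (w.1 ∈ c.tot.target ∧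
          w.2 ∈ (chartAt (Euc j) (e q).2).target) ∧
          (c.tot.symm w.1, (chartAt (Euc j) (e q).2).symm w.2) ∈ e.target :=
        fun w hw => by simpa [hf] using hw
      refine he'.comp ((c.tot_smooth.symm_smooth.comp contDiff_fst.contMDiff.contMDiffOn
        (fun w hw => (hs' w hw).1.1)).prodMk
        (h2.symm_smooth.comp contDiff_snd.contMDiff.contMDiffOn (fun w hw => (hs' w hw).1.2)))
        (fun w hw => (hs' w hw).2)
  have hqf : q ∈ f.source := by simp [hf, hq, hc]
  -- The chart built so far has fibre coordinates in `Euc m × Euc j`. Its differential is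
  -- invertible, so `n + k = n + m + j`, and a linear isomorphism turns these coordinates into `Euc
  -- k`.
  have hdim : Module.finrank ℝ (Euc m × Euc j) = Module.finrank ℝ (Euc k) := by
    have := (hfs.mdiff.mfderiv hqf).toLinearEquiv.finrank_eq
    have h3 : Module.finrank ℝ (Euc (n + k)) = Module.finrank ℝ ((Euc n × Euc m) × Euc j) := this
    simp at h3 ⊢
    omega
  set A : (Euc m × Euc j) ≃L[ℝ] Euc k := ContinuousLinearEquiv.ofFinrankEq hdim
  set B : ((Euc n × Euc m) × Euc j) ≃L[ℝ] Euc n × Euc k :=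
    (ContinuousLinearEquiv.prodAssoc ℝ (Euc n) (Euc m) (Euc j)).trans
      ((ContinuousLinearEquiv.refl ℝ (Euc n)).prodCongr A) with hB
  refine ⟨⟨f.trans B.toHomeomorph.toOpenPartialHomeomorph, c.base,
    hfs.trans _ B.contDiff.contDiffOn B.symm.contDiff.contDiffOn, c.base_smooth, ?_, ?_⟩, ?_⟩
  · intro z hz
    have := hs z hz.1
    rw [e.coe_fst this.1] at this
    exact c.mapsTo _ this.2.1
  · intro z hz
    have := hs z hz.1
    rw [e.coe_fst this.1] at this
    rw [c.base_proj _ this.2.1, ← e.coe_fst this.1]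
    rfl
  · exact ⟨hqf, trivial⟩

variable [IsManifold (𝓡 n) ∞ X] [SmoothFiberBundle (𝓡 (n + m)) (𝓡 n) m π]

/-! ### The energy on the fibres of the Legendre map. -/

/-- The energy is constant along a curve in the jet space on which the Legendre map is constant. -/
theorem energy_eq_of_curve {l : JetModel n m → ℝ} {T : Set ℝ} (hT : IsOpen T)
    (hT' : IsPreconnected T) {w : ℝ → JetModel n m} (hw : DifferentiableOn ℝ w T)
    (hl : ∀ t ∈ T, ContDiffAt ℝ ∞ l (w t)) {a : LegendreModel n m}
    (ha : ∀ t ∈ T, ((w t).1, (w t).2.1, fibreDeriv l (w t)) = a) {t₀ t₁ : ℝ} (h₀ : t₀ ∈ T)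
    (h₁ : t₁ ∈ T) : energy l (w t₀) = energy l (w t₁) := by
  have hd : ∀ t ∈ T, HasDerivAt (fun t => energy l (w t)) 0 t := by
    intro t ht
    have hwt := (hw.differentiableAt (hT.mem_nhds ht)).hasFDerivAt
    set δ := fderiv ℝ w t 1 with hδ
    have ev : ∀ᶠ t in 𝓝 t, ((w t).1, (w t).2.1, fibreDeriv l (w t)) = a := by
      filter_upwards [hT.mem_nhds ht] with t ht using ha t ht
    have e1 : δ.1 = 0 := by
      have h1 := (hwt.fst).unique ((hasFDerivAt_const a.1 t).congr_of_eventuallyEq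
        (by filter_upwards [ev] with t ht; rw [← ht]))
      exact congrArg (fun f => f 1) h1
    have e2 : δ.2.1 = 0 := by
      have h1 := (hwt.snd.fst).unique ((hasFDerivAt_const a.2.1 t).congr_of_eventuallyEq
        (by filter_upwards [ev] with t ht; rw [← ht]))
      exact congrArg (fun f => f 1) h1
    have e3 : fderiv ℝ (fibreDeriv l) (w t) δ = 0 := by
      have dF := ((contDiffAt_fibreDeriv (hl t ht)).differentiableAt (by simp)).hasFDerivAt
      have h1 := (HasFDerivAt.comp t dF hwt).unique
        ((hasFDerivAt_const a.2.2 t).congr_of_eventuallyEq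
          (by filter_upwards [ev] with t ht; rw [← ht]; rfl))
      exact congrArg (fun f => f 1) h1
    have dE := ((contDiffAt_energy (hl t ht)).differentiableAt (by simp)).hasFDerivAt
    have h := (dE.comp t hwt).hasDerivAt
    -- The tangent `δ` has no base or `y` part and is killed by the derivative of `fibreDeriv l`. By
    -- `fderiv_energy_apply` nothing is left.
    have e : fderiv ℝ (energy l) (w t) δ = 0 := by
      rw [fderiv_energy_apply (hl t ht), e1, e2, e3,
        show ((0, 0, 0) : JetModel n m) = 0 from rfl]
      simp
    exact e ▸ h
  exact hT.is_const_of_deriv_eq_zero hT'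
    (fun t ht => (hd t ht).differentiableAt.differentiableWithinAt)
    (fun t ht => (hd t ht).deriv) h₀ h₁

/-- The energy is constant on the fibres of the Legendre map. -/
theorem energy_eq_of_legendreMap_eq {k : ℕ} {L : JetDensity n m π} (hL : IsLagrangian L)
    [ChartedSpace (Euc (n + k)) (constraintSpace L)] (hreg : IsAlmostRegular k L)
    (c : FibChart n m π) {z z' : Jet n m π} (hz : z.pt ∈ c.tot.source)
    (h : legendreMap L z = legendreMap L z') :
    energy (c.localLagrangian L) (c.jetCoord z) = energy (c.localLagrangian L) (c.jetCoord z') := by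
  have hconn := (hreg.connected (legendreMap L z') ⟨z', rfl⟩).isPreconnected
  -- On a connected set a transitive and symmetric relation need only be checked between each point
  -- and the nearby ones. These are joined by a smooth curve inside the fibre, because the Legendre
  -- map is a submersion.
  refine hconn.induction₂ (fun z z' => energy (c.localLagrangian L) (c.jetCoord z) =
    energy (c.localLagrangian L) (c.jetCoord z')) ?_ (fun _ _ _ _ _ _ h h' => h.trans h')
    (fun _ _ _ _ h => h.symm) h rfl
  intro z₀ hz₀
  have hz₀ : legendreMap L z₀ = legendreMap L z' := hz₀
  have hs : ∀ w, legendreMap L w = legendreMap L z' → w.pt ∈ c.tot.source := by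
    intro w hw
    have e1 : w.pt = z'.pt := congrArg Legendre.pt hw
    have e2 : z.pt = z'.pt := congrArg Legendre.pt h
    rwa [e1, ← e2]
  rw [eventually_nhdsWithin_iff]
  filter_upwards [exists_curve_of_isSubmersionAt (hreg.submersion.isSubmersionAt z₀)] with z₁ h₁ hz₁
  have hz₁ : legendreMap L z₁ = legendreMap L z' := hz₁
  obtain ⟨T, γ, hT, hT', h0T, h1T, rfl, rfl, hγ, hconst⟩ :=
    h₁ (Subtype.ext (hz₁.trans hz₀.symm))
  have hconst' : ∀ t ∈ T, legendreMap L (γ t) = legendreMap L z' := fun t ht =>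
    (congrArg Subtype.val (hconst t ht)).trans hz₀
  refine energy_eq_of_curve hT hT' (w := fun t => c.jetCoord (γ t)) ?_ ?_
    (a := c.legendreCoord (legendreMap L z')) ?_ h0T h1T
  · intro t ht
    have := (c.contMDiffAt_jetCoord (hs _ (hconst' t ht))).comp t (hγ.contMDiffAt (hT.mem_nhds ht))
    exact (this.contDiffAt.differentiableAt (by simp)).differentiableWithinAt
  · intro t ht
    exact c.contDiffAt_localLagrangian hL (c.tot.map_source (hs _ (hconst' t ht)))
  · intro t ht
    rw [← hconst' t ht, c.legendreCoord_legendreMap hL (hs _ (hconst' t ht))]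
    rfl

/-- On the constraint space an associated Hamiltonian is the energy. -/
theorem localHamiltonian_legendreMap {k : ℕ} {L : JetDensity n m π} (hL : IsLagrangian L)
    [ChartedSpace (Euc (n + k)) (constraintSpace L)] (hreg : IsAlmostRegular k L)
    {H : Hamiltonian n m π} (hH : IsAssociated L H)
    (c : FibChart n m π) {z : Jet n m π} (hz : z.pt ∈ c.tot.source) :
    c.localHamiltonian H.form (c.legendreCoord (legendreMap L z)) =
      energy (c.localLagrangian L) (c.jetCoord z) := by
  set q := legendreMap L z with hq
  have h1 : legendreMap L (H.map q) = q := hH.legendre_comp z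
  have hpt : (H.map q).pt ∈ c.tot.source := hz
  -- The jets `z` and `Ĥ(q)` lie in the same Legendre fibre, so `z` may be replaced by `Ĥ(q)`. There
  -- the second association relation reads `p · v - 𝓗 = 𝓛`.
  rw [energy_eq_of_legendreMap_eq hL hreg c hz (z' := H.map q) (hq ▸ h1.symm)]
  have h2 := congrArg (fun a : Density n (π q.pt) => a (c.frame (π q.pt)))
    (hH.lagrangian_eq q ⟨z, rfl⟩)
  have h3 := H.form_frame c q hz (H.map q).lin (H.map q).right_inv
  have h4 := c.localLagrangian_jetCoord L hpt
  have h5 : c.momCoord q = fibreDeriv (c.localLagrangian L) (c.jetCoord (H.map q)) := by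
    have := congrArg (fun w => w.2.2) (c.legendreCoord_legendreMap hL hpt)
    rw [h1] at this
    exact this
  have h6 : c.momCoord q (c.vel (H.map q)) -
      c.localHamiltonian H.form (c.legendreCoord q) =
      c.localLagrangian L (c.jetCoord (H.map q)) := h3.symm.trans (h2.trans h4.symm)
  rw [energy, ← h5, ← h6]
  change _ = c.momCoord q (c.vel (H.map q)) - _
  ring

end

/-! ### The constrained Lagrangian in coordinates. -/

section

/-- The derivative of a map between manifolds, in charts. -/
theorem IsSmoothChart.fderiv_comp {E H F E' H' F' : Type*} [NormedAddCommGroup E]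
    [NormedSpace ℝ E] [TopologicalSpace H] {I : ModelWithCorners ℝ E H} [NormedAddCommGroup F]
    [NormedSpace ℝ F] [NormedAddCommGroup E'] [NormedSpace ℝ E'] [TopologicalSpace H']
    {I' : ModelWithCorners ℝ E' H'} [NormedAddCommGroup F'] [NormedSpace ℝ F']
    {M M' : Type*} [TopologicalSpace M] [ChartedSpace H M] [TopologicalSpace M']
    [ChartedSpace H' M'] {e : OpenPartialHomeomorph M F} {e' : OpenPartialHomeomorph M' F'}
    (he : IsSmoothChart I e) (he' : IsSmoothChart I' e') {g : M → M'} {x : M}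
    (hg : MDifferentiableAt I I' g x) (hx : x ∈ e.source) (hx' : g x ∈ e'.source) :
    fderiv ℝ (fun u => e' (g (e.symm u))) (e x) =
      (chartDeriv I' e' (g x)).comp ((mfderiv I I' g x).comp (chartDeriv I e x).inverse) := by
  have h1 := he.mdiff.mdifferentiableAt_symm (e.map_source hx)
  have h2 : HasMFDerivAt I I' g (e.symm (e x)) (mfderiv I I' g x) := by
    rw [e.left_inv hx]; exact hg.hasMFDerivAt
  have h3 : HasMFDerivAt I' 𝓘(ℝ, F') e' (g (e.symm (e x))) (chartDeriv I' e' (g x)) := by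
    rw [e.left_inv hx]; exact (he'.mdiff.mdifferentiableAt hx').hasMFDerivAt
  rw [he.inverse_eq hx, ← mfderiv_eq_fderiv]
  exact (h3.comp (e x) (h2.comp (e x) h1.hasMFDerivAt)).mfderiv

theorem fderiv_snd_fst {W A B C : Type*} [NormedAddCommGroup W] [NormedSpace ℝ W]
    [NormedAddCommGroup A] [NormedSpace ℝ A] [NormedAddCommGroup B] [NormedSpace ℝ B]
    [NormedAddCommGroup C] [NormedSpace ℝ C] {f : W → A × B × C} {g : W → A × B} {u : W}
    (hf : DifferentiableAt ℝ f u) (hg : ∀ u, g u = ((f u).1, (f u).2.1)) :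
    fderiv ℝ (fun u => (f u).2.1) u = (ContinuousLinearMap.snd ℝ A B).comp (fderiv ℝ g u) := by
  obtain rfl : g = fun u => ((f u).1, (f u).2.1) := funext hg
  have h : DifferentiableAt ℝ (fun u => ((f u).1, (f u).2.1)) u := hf.fst.prodMk hf.snd.fst
  exact (hasFDerivAt_snd.comp u h.hasFDerivAt).fderiv

universe u
variable {n m k : ℕ} {X : Type*} [TopologicalSpace X] [ChartedSpace (Euc n) X]
  {Q : Type u} [TopologicalSpace Q] [ChartedSpace (Euc (n + m)) Q] {π : Q → X}
  [IsManifold (𝓡 n) ∞ X] [SmoothFiberBundle (𝓡 (n + m)) (𝓡 n) m π]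
  {L : JetDensity n m π} [ChartedSpace (Euc (n + k)) (constraintSpace L)]

theorem IsAlmostRegular.contMDiff_val (hreg : IsAlmostRegular k L) :
    ContMDiff (𝓡 (n + k)) 𝓘(ℝ, LegendreModel n m) ∞
      (Subtype.val : constraintSpace L → Legendre n m π) :=
  hreg.embedding.contMDiff

theorem IsAlmostRegular.contMDiff_pt (hreg : IsAlmostRegular k L) :
    ContMDiff (𝓡 (n + k)) (𝓡 (n + m)) ∞ (fun q : constraintSpace L => q.1.pt) :=
  contMDiff_legendre_pt.comp hreg.contMDiff_val

/-- The constrained Lagrangian in coordinates: `L_N = p^l_i y^i_l - 𝓗`. -/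
theorem constrainedLagrangian_frame (hreg : IsAlmostRegular k L) (H : Hamiltonian n m π)
    (c : FibChart n m π) (d : FibChart n k (constraintProj L)) (hbase : d.base = c.base)
    (z : Jet n k (constraintProj L)) (hz : z.pt ∈ d.tot.source) (hz' : z.pt.1.pt ∈ c.tot.source) :
    constrainedLagrangian k L H z (d.frame (constraintProj L z.pt)) =
      c.momCoord z.pt.1 (((ContinuousLinearMap.snd ℝ (Euc n) (Euc m)).comp
        (fderiv ℝ (fun u => c.tot (d.tot.symm u).1.pt) (d.tot z.pt))).comp
          ((ContinuousLinearMap.id ℝ (Euc n)).prod (d.vel z))) -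
      c.localHamiltonian H.form (c.legendreCoord z.pt.1) := by
  have hpt : MDifferentiableAt (𝓡 (n + k)) (𝓡 (n + m)) (fun q : constraintSpace L => q.1.pt)
    z.pt := (hreg.contMDiff_pt z.pt).mdifferentiableAt (by simp)
  have hcomp : mfderiv (𝓡 (n + k)) (𝓡 (n + m)) (fun q : constraintSpace L => q.1.pt) z.pt =
      (mfderiv 𝓘(ℝ, LegendreModel n m) (𝓡 (n + m)) (Legendre.pt : Legendre n m π → Q) z.pt.1).comp
      (mfderiv (𝓡 (n + k)) 𝓘(ℝ, LegendreModel n m)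
        (Subtype.val : constraintSpace L → Legendre n m π) z.pt) :=
    mfderiv_comp z.pt ((contMDiff_legendre_pt z.pt.1).mdifferentiableAt (by simp))
      ((hreg.contMDiff_val z.pt).mdifferentiableAt (by simp))
  -- A jet of `N_L → X` followed by the differential of `N_L → Q` is a jet of `π`. The constrained
  -- form on `z` is thus the Hamiltonian form on `A`, to which `form_frame` applies.
  set A : TangentSpace (𝓡 n) (π z.pt.1.pt) →L[ℝ] TangentSpace (𝓡 (n + m)) z.pt.1.pt :=
    (mfderiv (𝓡 (n + k)) (𝓡 (n + m)) (fun q : constraintSpace L => q.1.pt) z.pt).comp z.lin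
    with hAdef
  have hproj : mfderiv (𝓡 (n + k)) (𝓡 n) (constraintProj L) z.pt =
      (mfderiv (𝓡 (n + m)) (𝓡 n) π z.pt.1.pt).comp
      (mfderiv (𝓡 (n + k)) (𝓡 (n + m)) (fun q : constraintSpace L => q.1.pt) z.pt) :=
    mfderiv_comp z.pt (c.mdifferentiableAt_proj hz') hpt
  have hA : (mfderiv (𝓡 (n + m)) (𝓡 n) π z.pt.1.pt).comp A = ContinuousLinearMap.id ℝ _ := by
    have := z.right_inv
    rw [hproj] at this
    exact this
  have hform := H.form_frame c z.pt.1 hz' A hA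
  have hframe : d.frame (constraintProj L z.pt) = c.frame (π z.pt.1.pt) := by
    unfold FibChart.frame FibChart.dbase
    rw [hbase]
    rfl
  have hlhs : constrainedLagrangian k L H z (d.frame (constraintProj L z.pt)) =
      H.form z.pt.1 (fun l => A (c.frame (π z.pt.1.pt) l)) := by
    rw [hframe, hAdef, hcomp]
    rfl
  rw [hlhs, hform]
  congr 2
  have hder := d.tot_smooth.fderiv_comp c.tot_smooth hpt hz hz'
  have hlin := d.eq_linAt_vel z hz
  have hb := d.base_smooth.comp_inverse (d.mapsTo _ hz)
  have hdb : (c.dbase (π z.pt.1.pt)).inverse = (d.dbase (constraintProj L z.pt)).inverse := by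
    unfold FibChart.dbase
    rw [hbase]
    rfl
  rw [hder]
  calc c.vel ⟨z.pt.1.pt, A, hA⟩ = (ContinuousLinearMap.snd ℝ (Euc n) (Euc m)).comp
        ((c.dtot z.pt.1.pt).comp (A.comp (c.dbase (π z.pt.1.pt)).inverse)) := rfl
    _ = (ContinuousLinearMap.snd ℝ (Euc n) (Euc m)).comp ((c.dtot z.pt.1.pt).comp
        ((mfderiv (𝓡 (n + k)) (𝓡 (n + m)) (fun q : constraintSpace L => q.1.pt) z.pt).comp
          ((d.linAt z.pt (d.vel z)).comp (d.dbase (constraintProj L z.pt)).inverse))) := by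
        rw [hdb, hAdef, ← hlin]; rfl
    _ = (ContinuousLinearMap.snd ℝ (Euc n) (Euc m)).comp ((c.dtot z.pt.1.pt).comp
        ((mfderiv (𝓡 (n + k)) (𝓡 (n + m)) (fun q : constraintSpace L => q.1.pt) z.pt).comp
          ((d.dtot z.pt).inverse.comp (((ContinuousLinearMap.id ℝ (Euc n)).prod (d.vel z)).comp
            ((d.dbase (constraintProj L z.pt)).comp
              (d.dbase (constraintProj L z.pt)).inverse))))) := rfl
    _ = _ := by rw [hb]; rfl

/-- The coordinates of `N_L → X`, followed by the inclusion into the Legendre bundle. -/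
def constraintCoord (c : FibChart n m π) (d : FibChart n k (constraintProj L))
    (u : Euc n × Euc k) : LegendreModel n m :=
  c.legendreCoord (d.tot.symm u).1

theorem contDiffAt_constraintCoord (hreg : IsAlmostRegular k L) (c : FibChart n m π)
    (d : FibChart n k (constraintProj L)) {q : constraintSpace L} (hq : q ∈ d.tot.source)
    (hq' : q.1.pt ∈ c.tot.source) : ContDiffAt ℝ ∞ (constraintCoord c d) (d.tot q) := by
  rw [← contMDiffAt_iff_contDiffAt]
  have h1 : ContMDiffAt 𝓘(ℝ, Euc n × Euc k) (𝓡 (n + k)) ∞ d.tot.symm (d.tot q) :=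
    d.tot_smooth.symm_smooth.contMDiffAt (d.tot.open_target.mem_nhds (d.tot.map_source hq))
  have h2 : ContMDiffAt (𝓡 (n + k)) 𝓘(ℝ, LegendreModel n m) ∞
      (fun q : constraintSpace L => c.legendreCoord q.1) q :=
    (c.contMDiffAt_legendreCoord hq').comp q (hreg.contMDiff_val q)
  rw [← d.tot.left_inv hq] at h2
  exact h2.comp (d.tot q) h1

/-- Provides the hypothesis `hΛ` of `eulerLagrange_iff_cartan`: `Y` and `P` are the last two
components of `constraintCoord`, and `K` is the Hamiltonian along it. -/
theorem eventually_localLagrangian_constrained (hreg : IsAlmostRegular k L)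
    (H : Hamiltonian n m π) (c : FibChart n m π) (d : FibChart n k (constraintProj L))
    (hbase : d.base = c.base) {q : constraintSpace L} (hq : q ∈ d.tot.source)
    (hq' : q.1.pt ∈ c.tot.source) :
    ∀ᶠ u in 𝓝 (d.tot q), ∀ v, d.localLagrangian (constrainedLagrangian k L H) (u.1, u.2, v) =
      (constraintCoord c d u).2.2 ((fderiv ℝ (fun u => (constraintCoord c d u).2.1) u).comp
        ((ContinuousLinearMap.id ℝ (Euc n)).prod v)) -
      c.localHamiltonian H.form (constraintCoord c d u) := by
  have hc : ContinuousAt (fun u => (d.tot.symm u).1.pt) (d.tot q) := by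
    refine ContinuousAt.comp (g := fun q : constraintSpace L => q.1.pt) ?_
      (d.tot.continuousAt_symm (d.tot.map_source hq))
    exact hreg.contMDiff_pt.continuous.continuousAt
  have hopen : ∀ᶠ u in 𝓝 (d.tot q), (d.tot.symm u).1.pt ∈ c.tot.source := by
    refine hc.eventually (c.tot.open_source.mem_nhds ?_)
    change (d.tot.symm (d.tot q)).1.pt ∈ c.tot.source
    rwa [d.tot.left_inv hq]
  filter_upwards [hopen, d.tot.open_target.mem_nhds (d.tot.map_source hq)] with u hu hut v
  have hw : (((u.1, u.2, v) : JetModel n k).1, ((u.1, u.2, v) : JetModel n k).2.1) ∈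
    d.tot.target := hut
  set z := d.jetOf (u.1, u.2, v) hw with hz
  have hzpt : z.pt = d.tot.symm u := rfl
  have hzs : z.pt ∈ d.tot.source := d.tot.map_target hut
  have hzc : d.jetCoord z = (u.1, u.2, v) := d.jetCoord_jetOf _ hw
  rw [← hzc, d.localLagrangian_jetCoord _ hzs,
    constrainedLagrangian_frame hreg H c d hbase z hzs hu]
  have hv : d.vel z = v := congrArg (fun w => w.2.2) hzc
  have hu' : d.tot z.pt = u := d.tot.right_inv hut
  have hder : fderiv ℝ (fun u => (constraintCoord c d u).2.1) u =
      (ContinuousLinearMap.snd ℝ (Euc n) (Euc m)).comp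
        (fderiv ℝ (fun u => c.tot (d.tot.symm u).1.pt) u) := by
    have := contDiffAt_constraintCoord hreg c d hzs hu
    rw [hu'] at this
    exact fderiv_snd_fst (this.differentiableAt (by simp)) fun _ => rfl
  rw [hder, hv, hu']
  rfl

end

/-! ### The Legendre map in charts of `N_L`, and the equivalence. -/

section

universe u
variable {n m k : ℕ} {X : Type*} [TopologicalSpace X] [ChartedSpace (Euc n) X]
  {Q : Type u} [TopologicalSpace Q] [ChartedSpace (Euc (n + m)) Q] {π : Q → X}

theorem jetChart_symm_jetCoord (c : FibChart n m π) (z₀ : Jet n m π) {z : Jet n m π}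
    (hz : z.pt ∈ c.tot.source) : (c.jetChart z₀).symm (c.jetCoord z) = z :=
  (c.jetChart z₀).left_inv hz

theorem jetCoord_jetChart_symm (c : FibChart n m π) (z₀ : Jet n m π) {w : JetModel n m}
    (hw : (w.1, w.2.1) ∈ c.tot.target) : c.jetCoord ((c.jetChart z₀).symm w) = w :=
  (c.jetChart z₀).right_inv hw

theorem jetChart_symm_pt (c : FibChart n m π) (z₀ : Jet n m π) {w : JetModel n m}
    (hw : (w.1, w.2.1) ∈ c.tot.target) : ((c.jetChart z₀).symm w).pt ∈ c.tot.source :=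
  (c.jetChart z₀).map_target hw

variable [IsManifold (𝓡 n) ∞ X] [SmoothFiberBundle (𝓡 (n + m)) (𝓡 n) m π]
  {L : JetDensity n m π} [ChartedSpace (Euc (n + k)) (constraintSpace L)]

/-- The coordinate expression of the Legendre map `J¹Q → N_L`; `z₀` is a junk value. -/
def legendreCoordMap (c : FibChart n m π) (d : FibChart n k (constraintProj L)) (z₀ : Jet n m π)
    (w : JetModel n m) : Euc n × Euc k :=
  d.tot (legendreMapOnto L ((c.jetChart z₀).symm w))

theorem contDiffAt_legendreCoordMap (hreg : IsAlmostRegular k L) (c : FibChart n m π)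
    (d : FibChart n k (constraintProj L)) (z₀ : Jet n m π) {z : Jet n m π}
    (hz : z.pt ∈ c.tot.source) (hz' : legendreMapOnto L z ∈ d.tot.source) :
    ContDiffAt ℝ ∞ (legendreCoordMap c d z₀) (c.jetCoord z) := by
  rw [← contMDiffAt_iff_contDiffAt]
  have h1 := c.contMDiffAt_jetChart_symm z₀ (w := c.jetCoord z) (c.tot.map_source hz)
  have h2 : ContMDiffAt (𝓡 (n + k)) 𝓘(ℝ, Euc n × Euc k) ∞ d.tot (legendreMapOnto L z) :=
    d.tot_smooth.smooth.contMDiffAt (d.tot.open_source.mem_nhds hz')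
  have h3 := h2.comp z (hreg.submersion.contMDiff z)
  rw [← jetChart_symm_jetCoord c z₀ hz] at h3
  exact h3.comp (c.jetCoord z) h1

theorem eventually_mem_source_legendreCoordMap (hreg : IsAlmostRegular k L) (c : FibChart n m π)
    (d : FibChart n k (constraintProj L)) (z₀ : Jet n m π) {z : Jet n m π}
    (hz : z.pt ∈ c.tot.source) (hz' : legendreMapOnto L z ∈ d.tot.source) :
    ∀ᶠ w in 𝓝 (c.jetCoord z), (w.1, w.2.1) ∈ c.tot.target ∧
      legendreMapOnto L ((c.jetChart z₀).symm w) ∈ d.tot.source := by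
  have h1 := (c.contMDiffAt_jetChart_symm z₀ (w := c.jetCoord z)
    (c.tot.map_source hz)).continuousAt
  have h2 : ContinuousAt (fun w => legendreMapOnto L ((c.jetChart z₀).symm w)) (c.jetCoord z) :=
    ContinuousAt.comp hreg.submersion.contMDiff.continuous.continuousAt h1
  refine Filter.Eventually.and ?_ (h2.eventually (d.tot.open_source.mem_nhds ?_))
  · exact c.isOpen_target_prod.mem_nhds (c.tot.map_source hz)
  · change legendreMapOnto L ((c.jetChart z₀).symm (c.jetCoord z)) ∈ d.tot.source
    rwa [jetChart_symm_jetCoord c z₀ hz]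

/-- A submersion has a smooth local section through `z`; its derivative in coordinates is a right
inverse of the derivative of the Legendre map. -/
theorem surjective_fderiv_legendreCoordMap (hreg : IsAlmostRegular k L) (c : FibChart n m π)
    (d : FibChart n k (constraintProj L)) (z₀ : Jet n m π) {z : Jet n m π}
    (hz : z.pt ∈ c.tot.source) (hz' : legendreMapOnto L z ∈ d.tot.source) :
    Function.Surjective (fderiv ℝ (legendreCoordMap c d z₀) (c.jetCoord z)) := by
  obtain ⟨σ, hσ, hσz, hσ'⟩ :=
    exists_localSection_of_isSubmersionAt (hreg.submersion.isSubmersionAt z)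
  set u := d.tot (legendreMapOnto L z) with hu
  have hsymm : d.tot.symm u = legendreMapOnto L z := d.tot.left_inv hz'
  have h1 : ContMDiffAt 𝓘(ℝ, Euc n × Euc k) (𝓡 (n + k)) ∞ d.tot.symm u :=
    d.tot_smooth.symm_smooth.contMDiffAt (d.tot.open_target.mem_nhds (d.tot.map_source hz'))
  have h2 : ContMDiffAt 𝓘(ℝ, Euc n × Euc k) 𝓘(ℝ, JetModel n m) ∞ (fun u => σ (d.tot.symm u)) u := by
    rw [← hsymm] at hσ
    exact hσ.comp u h1
  have h2u : σ (d.tot.symm u) = z := by rw [hsymm, hσz]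
  have h3 : ContMDiffAt 𝓘(ℝ, Euc n × Euc k) 𝓘(ℝ, JetModel n m) ∞
      (fun u => c.jetCoord (σ (d.tot.symm u))) u := by
    have h4 := c.contMDiffAt_jetCoord hz
    rw [← h2u] at h4
    exact h4.comp u h2
  have hd := (h3.contDiffAt.differentiableAt (by simp)).hasFDerivAt
  have hψ : HasFDerivAt (legendreCoordMap c d z₀)
      (fderiv ℝ (legendreCoordMap c d z₀) (c.jetCoord z)) (c.jetCoord (σ (d.tot.symm u))) := by
    rw [h2u]
    exact ((contDiffAt_legendreCoordMap hreg c d z₀ hz hz').differentiableAt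
      (by simp)).hasFDerivAt
  have hid : legendreCoordMap c d z₀ ∘ (fun u => c.jetCoord (σ (d.tot.symm u))) =ᶠ[𝓝 u] id := by
    have e1 : ∀ᶠ u' in 𝓝 u, legendreMapOnto L (σ (d.tot.symm u')) = d.tot.symm u' := by
      rw [← hsymm] at hσ'
      exact h1.continuousAt.eventually hσ'
    have e2 : ∀ᶠ u' in 𝓝 u, (σ (d.tot.symm u')).pt ∈ c.tot.source := by
      refine h2.continuousAt.eventually (c.isOpen_jet_source.mem_nhds ?_)
      change (σ (d.tot.symm u)).pt ∈ c.tot.source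
      rwa [h2u]
    filter_upwards [e1, e2, d.tot.open_target.mem_nhds (d.tot.map_source hz')] with u' h1 h2 h3
    rw [Function.comp_apply, legendreCoordMap, jetChart_symm_jetCoord c z₀ h2, h1,
      d.tot.right_inv h3]
    rfl
  have h := (HasFDerivAt.comp u hψ hd).unique ((hasFDerivAt_id u).congr_of_eventuallyEq hid)
  intro b
  exact ⟨_, congrArg (fun f => f b) h⟩

/-- Over one point, in charts with the same base coordinates, the Cartan equations are equivalent
to the constrained Hamilton equations. -/
theorem eulerLagrange_constrained_iff_cartan (hL : IsLagrangian L) (hreg : IsAlmostRegular k L)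
    {H : Hamiltonian n m π} (hH : IsAssociated L H) {s : X → Jet n m π} (hs : IsJetSection s)
    (c : FibChart n m π) (d : FibChart n k (constraintProj L)) (hbase : d.base = c.base) {x : X}
    (hc : (s x).pt ∈ c.tot.source) (hd : legendreMapOnto L (s x) ∈ d.tot.source) :
    (∀ i, dY (d.localLagrangian (constrainedLagrangian k L H)) i
        (d.localProlongation (legendreMapOnto L ∘ s) (d.base x)) -
      ∑ l, dX (fun ξ => dV (d.localLagrangian (constrainedLagrangian k L H)) l i
        (d.localProlongation (legendreMapOnto L ∘ s) ξ)) l (d.base x) = 0) ↔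
    (∀ l i, ∑ μ, ∑ j, c.defect s μ j (c.base x) *
        dV (dV (c.localLagrangian L) μ j) l i (c.jetCoord (s x)) = 0) ∧
    ∀ i, dY (c.localLagrangian L) i (c.jetCoord (s x)) -
      ∑ l, dX (fun ξ => dV (c.localLagrangian L) l i (c.jetCoord (s (c.base.symm ξ)))) l
        (c.base x) +
      ∑ μ, ∑ j, c.defect s μ j (c.base x) *
        dY (dV (c.localLagrangian L) μ j) i (c.jetCoord (s x)) = 0 := by
  have hx : x ∈ c.base.source := by
    have := c.mapsTo _ hc
    rwa [hs.isSection] at this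
  set ξ := c.base x with hξ
  have hxξ : c.base.symm ξ = x := c.base.left_inv hx
  have hdξ : d.base x = ξ := by rw [hbase]
  have hbsymm : ContMDiffAt (𝓡 n) (𝓡 n) ∞ c.base.symm ξ :=
    c.base_smooth.symm_smooth.contMDiffAt (c.base.open_target.mem_nhds (c.base.map_source hx))
  have hsx : ContMDiffAt (𝓡 n) 𝓘(ℝ, JetModel n m) ∞ (fun ζ => s (c.base.symm ζ)) ξ :=
    (hs.smooth _).comp ξ hbsymm
  have hloc : c.jetCoord (s (c.base.symm ξ)) = c.jetCoord (s x) := by rw [hxξ]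
  have hsC : ContDiffAt ℝ ∞ (fun ζ => c.jetCoord (s (c.base.symm ζ))) ξ := by
    rw [← contMDiffAt_iff_contDiffAt]
    refine ContMDiffAt.comp ξ (g := c.jetCoord) ?_ hsx
    rw [hxξ]
    exact c.contMDiffAt_jetCoord hc
  have hρu : (ξ, d.localSection (legendreMapOnto L ∘ s) ξ) = d.tot (legendreMapOnto L (s x)) := by
    refine Prod.ext ?_ ?_
    · rw [← d.base_proj _ hd, ← hdξ]
      exact congrArg d.base (hs.isSection x).symm
    · change (d.tot (legendreMapOnto L (s (d.base.symm ξ)))).2 = _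
      rw [hbase, hxξ]
  have hρ : ContDiffAt ℝ ∞ (d.localSection (legendreMapOnto L ∘ s)) ξ := by
    rw [← contMDiffAt_iff_contDiffAt]
    have h1 : ContMDiffAt (𝓡 (n + k)) 𝓘(ℝ, Euc n × Euc k) ∞ d.tot
        (legendreMapOnto L (s (c.base.symm ξ))) := by
      rw [hxξ]
      exact d.tot_smooth.smooth.contMDiffAt (d.tot.open_source.mem_nhds hd)
    have h2 : ContMDiffAt (𝓡 n) (𝓡 (n + k)) ∞ (fun ζ => legendreMapOnto L (s (c.base.symm ζ))) ξ :=
      (hreg.submersion.contMDiff _).comp ξ hsx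
    have h3 := contDiff_snd.contMDiff.contMDiffAt.comp ξ (h1.comp ξ h2)
    have e : d.localSection (legendreMapOnto L ∘ s) =
        fun ζ => (d.tot (legendreMapOnto L (s (c.base.symm ζ)))).2 := by
      unfold FibChart.localSection
      rw [hbase]
      rfl
    rw [e]
    exact h3
  have hφ := contDiffAt_constraintCoord hreg c d hd (q := legendreMapOnto L (s x)) hc
  rw [← hρu] at hφ
  have hφw : ((constraintCoord c d (ξ, d.localSection (legendreMapOnto L ∘ s) ξ)).1,
      (constraintCoord c d (ξ, d.localSection (legendreMapOnto L ∘ s) ξ)).2.1) ∈ c.tot.target := by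
    rw [hρu, constraintCoord, d.tot.left_inv hd]
    exact c.tot.map_source hc
  have hK : ContDiffAt ℝ ∞ (fun u => c.localHamiltonian H.form (constraintCoord c d u))
      (ξ, d.localSection (legendreMapOnto L ∘ s) ξ) :=
    (c.contDiffAt_localHamiltonian H hφw).comp _ hφ
  have hΛ := eventually_localLagrangian_constrained hreg H c d hbase hd hc
  rw [← hρu] at hΛ
  have hev := eventually_mem_source_legendreCoordMap hreg c d (s x) hc hd
  -- The relations between `ψ` and the data on `N_L`: base coordinates are preserved, `Y ∘ ψ = y`
  -- and `P ∘ ψ = ∂𝓛/∂v`, and `K ∘ ψ` is the energy. Only the last needs an associated Hamiltonian.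
  have hmain : ∀ᶠ w in 𝓝 (c.jetCoord (s x)), (legendreCoordMap c d (s x) w).1 = w.1 ∧
      constraintCoord c d (legendreCoordMap c d (s x) w) =
        (w.1, w.2.1, fibreDeriv (c.localLagrangian L) w) ∧
      c.localHamiltonian H.form (constraintCoord c d (legendreCoordMap c d (s x) w)) =
        energy (c.localLagrangian L) w := by
    filter_upwards [hev] with w hw
    set z := (c.jetChart (s x)).symm w with hz
    have hzs : z.pt ∈ c.tot.source := jetChart_symm_pt c (s x) hw.1
    have hzw : c.jetCoord z = w := jetCoord_jetChart_symm c (s x) hw.1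
    have e1 : constraintCoord c d (legendreCoordMap c d (s x) w) =
        c.legendreCoord (legendreMap L z) := by
      rw [constraintCoord, legendreCoordMap, ← hz, d.tot.left_inv hw.2]
      rfl
    refine ⟨?_, ?_, ?_⟩
    · rw [legendreCoordMap, ← hz, ← d.base_proj _ hw.2, hbase]
      refine (c.base_proj _ hzs).trans ?_
      exact congrArg Prod.fst hzw
    · rw [e1, c.legendreCoord_legendreMap hL hzs, hzw]
      exact Prod.ext (congrArg (fun w => w.1) hzw)
        (Prod.ext (congrArg (fun w => w.2.1) hzw) rfl)
    · rw [e1, localHamiltonian_legendreMap hL hreg hH c hzs, hzw]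
  have hψs : ∀ᶠ ζ in 𝓝 ξ, legendreCoordMap c d (s x) (c.jetCoord (s (c.base.symm ζ))) =
      (ζ, d.localSection (legendreMapOnto L ∘ s) ζ) := by
    have e1 : ∀ᶠ ζ in 𝓝 ξ, (s (c.base.symm ζ)).pt ∈ c.tot.source := by
      refine hsx.continuousAt.eventually (c.isOpen_jet_source.mem_nhds ?_)
      change (s (c.base.symm ξ)).pt ∈ c.tot.source
      rwa [hxξ]
    have e2 : ∀ᶠ ζ in 𝓝 ξ, legendreMapOnto L (s (c.base.symm ζ)) ∈ d.tot.source := by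
      have : ContinuousAt (fun ζ => legendreMapOnto L (s (c.base.symm ζ))) ξ :=
        ContinuousAt.comp hreg.submersion.contMDiff.continuous.continuousAt hsx.continuousAt
      refine this.eventually (d.tot.open_source.mem_nhds ?_)
      change legendreMapOnto L (s (c.base.symm ξ)) ∈ d.tot.source
      rwa [hxξ]
    filter_upwards [e1, e2, c.base.open_target.mem_nhds (c.base.map_source hx)] with ζ h1 h2 h3
    rw [legendreCoordMap, jetChart_symm_jetCoord c (s x) h1]
    refine Prod.ext ?_ ?_
    · rw [← d.base_proj _ h2, hbase]
      refine (congrArg c.base (hs.isSection (c.base.symm ζ))).trans ?_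
      exact c.base.right_inv h3
    · rw [FibChart.localSection, hbase]
      rfl
  have key := eulerLagrange_iff_cartan (l := c.localLagrangian L)
    (Λ := d.localLagrangian (constrainedLagrangian k L H))
    (Y := fun u => (constraintCoord c d u).2.1) (P := fun u => (constraintCoord c d u).2.2)
    (K := fun u => c.localHamiltonian H.form (constraintCoord c d u))
    (s := fun ζ => c.jetCoord (s (c.base.symm ζ))) (ξ := ξ)
    (ρ := d.localSection (legendreMapOnto L ∘ s)) (ψ := legendreCoordMap c d (s x))
    (by rw [hloc]; exact c.contDiffAt_localLagrangian hL (c.tot.map_source hc))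
    (hsC.differentiableAt (by simp)) hρ hφ.snd.fst hφ.snd.snd hK hΛ
    (by rw [hloc]; exact (contDiffAt_legendreCoordMap hreg c d _ hc hd).differentiableAt (by simp))
    (by rw [hloc]; exact surjective_fderiv_legendreCoordMap hreg c d _ hc hd) hψs
    (by rw [hloc]; filter_upwards [hmain] with w hw using hw.1)
    (by rw [hloc]; filter_upwards [hmain] with w hw; rw [hw.2.1])
    (by rw [hloc]; filter_upwards [hmain] with w hw; rw [hw.2.1])
    (by rw [hloc]; filter_upwards [hmain] with w hw using hw.2.2)
  rw [hdξ]
  -- `s x` and `s (c.base.symm (c.base x))` are equal only propositionally. All occurrences are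
  -- brought to one form on both sides.
  simp only [hloc] at key
  rw [← hloc] at key ⊢
  exact key

/-- Almost-regularity makes `N_L` a bundle over `Q`; charts fibred over `X` come from the composite
`N_L → Q → X`. -/
theorem IsAlmostRegular.exists_fibChart (hreg : IsAlmostRegular k L) (q : constraintSpace L) :
    ∃ d : FibChart n k (constraintProj L), q ∈ d.tot.source := by
  obtain ⟨j, hj⟩ := hreg.subbundle
  exact exists_fibChart_comp (n := n) (m := m) (k := k) (j := j) (π := π)
    (fun q : constraintSpace L => q.1.pt) q

/-- One system is tested in all fibred charts of `Q`, the other in all fibred charts of `N_L`. In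
each direction the given chart is paired with a chart of the other bundle, moved to the same base
chart by `withBase`. -/
theorem isCartanSolution_iff (hL : IsLagrangian L) (hreg : IsAlmostRegular k L)
    {H : Hamiltonian n m π} (hH : IsAssociated L H) {s : X → Jet n m π} (hs : IsJetSection s) :
    IsCartanSolution L s ↔ IsConstrainedHamiltonSolution k L H (legendreMapOnto L ∘ s) := by
  constructor
  · intro h
    refine ⟨hreg.submersion.contMDiff.comp hs.smooth, fun x => hs.isSection x, ?_⟩
    intro d x hx
    obtain ⟨c₀, hc₀⟩ := exists_fibChart (n := n) (m := m) π (s x).pt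
    have hc := c₀.mem_withBase_source d.base_smooth hc₀ (d.mapsTo _ hx)
    exact (eulerLagrange_constrained_iff_cartan hL hreg hH hs (c₀.withBase d.base d.base_smooth) d
      rfl hc hx).2 ⟨h.equation₁ _ x hc, h.equation₂ _ x hc⟩
  · intro h
    have hd := fun (c : FibChart n m π) (x : X) (hc : (s x).pt ∈ c.tot.source) =>
      (hreg.exists_fibChart (legendreMapOnto L (s x))).choose.mem_withBase_source c.base_smooth
        (hreg.exists_fibChart (legendreMapOnto L (s x))).choose_spec (c.mapsTo _ hc)
    have key := fun (c : FibChart n m π) (x : X) (hc : (s x).pt ∈ c.tot.source) =>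
      (eulerLagrange_constrained_iff_cartan hL hreg hH hs c _ rfl hc (hd c x hc)).1
        (h.equation _ x (hd c x hc))
    exact ⟨hs, fun c x hc => (key c x hc).1, fun c x hc => (key c x hc).2⟩

end

end CovariantField

end

theorem theorem2 {n m k : ℕ}
    {X : Type*} [TopologicalSpace X] [ChartedSpace (Euc n) X] [IsManifold (𝓡 n) ∞ X]
    {Y : Type*} [TopologicalSpace Y] [ChartedSpace (Euc (n + m)) Y] [IsManifold (𝓡 (n + m)) ∞ Y]
    (π : Y → X) [SmoothFiberBundle (𝓡 (n + m)) (𝓡 n) m π]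
    (L : JetDensity n m π) (hL : IsLagrangian L)
    [ChartedSpace (Euc (n + k)) (constraintSpace L)]
    [IsManifold (𝓡 (n + k)) ∞ (constraintSpace L)]
    (hreg : IsAlmostRegular k L)
    (H : Hamiltonian n m π) (hH : IsAssociated L H) :
    (∀ s : X → Jet n m π, IsJetSection s →
      (IsCartanSolution L s ↔ IsConstrainedHamiltonSolution k L H (legendreMapOnto L ∘ s))) ∧
    (∀ r : X → constraintSpace L, IsConstrainedHamiltonSolution k L H r →
      ∀ H' : Hamiltonian n m π, IsAssociated L H' →
        IsCartanSolution L (fun x => H'.map (r x))) := by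
  refine ⟨fun s hs => isCartanSolution_iff hL hreg hH hs, fun r hr H' hH' => ?_⟩
  have hs : IsJetSection fun x => H'.map (r x).1 :=
    ⟨H'.contMDiff_map.comp (hreg.contMDiff_val.comp hr.smooth), fun x => hr.isSection x⟩
  -- `L̂ ∘ Ĥ' ∘ L̂ = L̂` says that `L̂ ∘ Ĥ'` is the identity on `N_L`. This is all that is used of
  -- the association of `H'`, which may differ from the Hamiltonian `H` of the equations.
  have hr' : (legendreMapOnto L ∘ fun x => H'.map (r x).1) = r := by
    funext x
    obtain ⟨z, hz⟩ := (r x).2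
    refine Subtype.ext ?_
    change legendreMap L (H'.map (r x).1) = (r x).1
    rw [← hz, hH'.legendre_comp]
  rw [isCartanSolution_iff hL hreg hH hs, hr']
  exact hr
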